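/- **Notation.** For a polynomial $\tau\in\mathbb R[x]$ with $\tau(\pm1)\neq0$ and $\alpha,\beta\in\mathbb R$ let $\eta=\frac{\alpha+1}{x-1}+\frac{\beta+1}{x+1}$, $$T_{\rm ng}(\tau;\alpha,\beta)=(x^2-1)\Big(D^2-2\tfrac{\tau'}{\tau}D+\tfrac{\tau''}{\tau}+\eta\big(D-\tfrac{\tau'}{\tau}\big)\Big)+2x\tfrac{\tau'}{\tau},\qquad T_{\rm rg}(\tau;\alpha,\beta)=\tau^{-1}\circ T_{\rm ng}(\tau;\alpha,\beta)\circ\tau .$$ $T_{\rm rg}(\tau;\alpha,\beta)$ is called an exceptional Jacobi operator (in the rational gauge) if $T_{\rm ng}(\tau;\alpha,\beta)$ has eigenpolynomials of all but finitely many degrees; it is of class A if one of $\alpha,\beta$ is in $\mathbb N_0$ and the other is not an integer. A quasi-polynomial eigenfunction of $T=T_{\rm rg}$ is a rational solution of $T\pi=\lambda\pi$ without zeros or poles at $\pm1$; its degree is the degree of the numerator minus that of the denominator. A function $\phi$ is quasi-rational if $w=\phi'/\phi$ is rational; $\deg\phi$ is the coefficient of $1/x$ of $w$ at infinity. A quasi-rational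 eigenfunction has type $1$ if $w$ is regular at $\pm1$, type $2$ if $w$ has poles at both $\pm1$, type $3$ if $w$ has a pole at $1$ only, type $4$ if at $-1$ only; its index is $\deg\phi$, $\deg\phi+\alpha+\beta$, $\deg\phi+\alpha$, $\deg\phi+\beta$ respectively, and $I_\imath(T)$ is the set of indices of the type $\imath$ eigenfunctions. The quasi-rational spectrum is the set of $\lambda\in\mathbb R$ with a quasi-rational eigenfunction. The spectral diagram of $T$ assigns to each such $\lambda$ a label according to the types of its quasi-rational eigenfunctions up to scalars; in particular: $\circ$ (exactly one, of type 1), $-$ (exactly one, of type 4), $\ast$ (exactly two, one of type 2 and one of type 3). Put $\lambda_1(k)=k(k+\alpha+\beta+1)$, $\lambda_2(k)=(k-\alpha-\beta)(k+1)$, $\lambda_3(k)=(k-\alpha)(k+\beta+1)$, $\lambda_4(k)=(k-\beta)(k+\alpha+1)$. Let $\pi_n(x;a,b)$ be the monic Jacobi polynomials, and $$\nu(z;a,b)=2^{1+a+b+2z}\frac{\Gamma(z+1)\Gamma(a+b+z+1)\Gamma(a+z+1)\Gamma(b+z+1)}{\Gamma(a+b+2z+1)\Gamma(a+b+2z+2)},\qquad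 \nu(a,b)=\nu(0;a,b).$$ **Data.** Let $a\in\mathbb N_0$, $b\in\mathbb R\setminus\mathbb Z$, and let $K,L\subset\mathbb N_0$ be disjoint finite sets with $p=|K|$, $q=|L|$. Put $\alpha=a+p$, $\beta=b+p+2q$, and $$I_1=(\mathbb N_0\setminus(K\cup L))-p-q,\quad I_2=(\{0,\dots,a-1\}\cup(-K-1))+p+q,$$ $$I_3=(\{0,\dots,a-1\}\cup(K+a))-q,\quad I_4=(\mathbb N_0\cup(-L-1-a))+q,\qquad \sigma_\imath=\lambda_\imath(I_\imath).$$ Let $\Lambda_A(K,L,a,b)$ be the assignment $(\sigma_1,\sigma_2,\sigma_4)\mapsto(\circ,\ast,-)$. Let $\rho_{ij}=\int\pi_i(x;a,b)\pi_j(x;a,b)(1-x)^a(1+x)^b$ be the unique quasi-rational anti-derivative, $L=\{\ell_1<\dots<\ell_q\}$, $\mathcal R=(\rho_{\ell_i\ell_j})_{i,j=1}^q$, and let $\mathcal A(n)$ be the $(q+1)\times(q+1)$ matrix (indices $0,\dots,q$) with, for $\ell_0:=n$, row $0$ equal to $\big(\pi_{\ell_j}(x;a,b)\big)_{j=0}^q$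 and row $i\ge1$ equal to $(\rho_{\ell_i\ell_j})_{j=0}^q$. Put $k^*=-k-a-b-1$, $$\hat\chi(z;S)=\prod_{k\in S}\frac{z-k^*}{z-k},\quad \hat\tau=(1+x)^{-q(q+b)}\det\mathcal R,\quad \hat\pi_i=\hat\chi(i+q;L)(1+x)^{-q}\frac{\det\mathcal A(i+q)}{\det\mathcal R}\quad(i+q\in\mathbb N_0\setminus L),$$ and, with $k_1<\dots<k_p$ the increasing enumeration of $K-q$, $$\tau=\hat\tau\,\mathrm{Wr}[\hat\pi_{k_1},\dots,\hat\pi_{k_p}],\qquad \pi_i=\prod_{k\in K}\frac1{i+p+q-k}\cdot\frac{\mathrm{Wr}[\hat\pi_{k_1},\dots,\hat\pi_{k_p},\hat\pi_{i+p}]}{\mathrm{Wr}[\hat\pi_{k_1},\dots,\hat\pi_{k_p}]}\quad(i\in I_1).$$ **Proposition.** 1. $\tau$ is a polynomial, of degree $2\sum_{\ell\in L}\ell+\sum_{k\in K}k-\binom{p+q}2-\binom q2+qa$. 2. $\tau(\pm1)\ne0$ and $T=T_{\rm rg}(\tau;\alpha,\beta)$ is an exceptional Jacobi operator of class A. Its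 quasi-rational spectrum is $\lambda_1(\mathbb Z)\cup\lambda_1(\mathbb Z-\alpha)$, its spectral diagram is $\Lambda_A(K,L,a,b)$ (which assigns exactly one label to each of these eigenvalues), and $I_\imath(T)=I_\imath$ for $\imath=1,2,3,4$. 3. For $i\in I_1$ the function $\pi_i$ is a monic rational function of degree $i$ (numerator and denominator have the same leading coefficient), and a quasi-polynomial eigenfunction of $T$ with eigenvalue $\lambda_1(i)$; every quasi-polynomial eigenfunction of $T$ is a non-zero constant multiple of some $\pi_i$, $i\in I_1$. 4. The norms of the $\pi_i$ are $\nu_i=\kappa(i+p+q)\,\nu(i+p+q;a,b)$ with $\kappa(z)=\hat\chi(z;K)\,\hat\chi(z;L)^2$; that is, for all $i,j\in I_1$ the function $\big(\pi_i\pi_j-\nu_i\delta_{ij}/\nu(\alpha,\beta)\big)(1-x)^\alpha(1+x)^\beta$ has an anti-derivative of the form $g(x)(1-x)^{\alpha+1}(1+x)^{\beta+1}$ with $g$ rational and regular at $\pm1$. -/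

import Mathlib

open Polynomial
open scoped Topology

noncomputable section

namespace ExJacobi

/-! ### Rational functions and second order operators over the field of real rational functions -/

/-- The derivative of a rational function (quotient rule applied to its reduced fraction). -/
def ratDeriv (f : RatFunc ℝ) : RatFunc ℝ :=
  (algebraMap ℝ[X] (RatFunc ℝ) (derivative f.num) * algebraMap ℝ[X] (RatFunc ℝ) f.denom
      - algebraMap ℝ[X] (RatFunc ℝ) f.num * algebraMap ℝ[X] (RatFunc ℝ) (derivative f.denom))
    / algebraMap ℝ[X] (RatFunc ℝ) f.denom ^ 2

theorem ratDeriv_div (p q : ℝ[X]) (hq : q ≠ 0) :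
    ratDeriv (algebraMap ℝ[X] (RatFunc ℝ) p / algebraMap ℝ[X] (RatFunc ℝ) q) =
      (algebraMap ℝ[X] (RatFunc ℝ) (derivative p) * algebraMap ℝ[X] (RatFunc ℝ) q
        - algebraMap ℝ[X] (RatFunc ℝ) p * algebraMap ℝ[X] (RatFunc ℝ) (derivative q))
      / algebraMap ℝ[X] (RatFunc ℝ) q ^ 2 := by
  set f := algebraMap ℝ[X] (RatFunc ℝ) p / algebraMap ℝ[X] (RatFunc ℝ) q with hf
  have hd : f.denom ≠ 0 := f.denom_ne_zero
  have hq' : algebraMap ℝ[X] (RatFunc ℝ) q ≠ 0 := RatFunc.algebraMap_ne_zero hq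
  have hd' : algebraMap ℝ[X] (RatFunc ℝ) f.denom ≠ 0 := RatFunc.algebraMap_ne_zero hd
  have h1 : f.num * q = p * f.denom := by
    apply RatFunc.algebraMap_injective ℝ
    have h := RatFunc.num_div_denom f
    rw [div_eq_iff hd'] at h
    rw [map_mul, map_mul, h, hf]
    field_simp
  have h2 : derivative f.num * q + f.num * derivative q
      = derivative p * f.denom + p * derivative f.denom := by
    rw [← derivative_mul, ← derivative_mul, h1]
  have e1 := congrArg (algebraMap ℝ[X] (RatFunc ℝ)) h1
  have e2 := congrArg (algebraMap ℝ[X] (RatFunc ℝ)) h2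
  simp only [map_mul, map_add] at e1 e2
  rw [ratDeriv, div_eq_div_iff (pow_ne_zero 2 hd') (pow_ne_zero 2 hq')]
  linear_combination
    (algebraMap ℝ[X] (RatFunc ℝ) q * algebraMap ℝ[X] (RatFunc ℝ) f.denom) * e2
      - (algebraMap ℝ[X] (RatFunc ℝ) q * algebraMap ℝ[X] (RatFunc ℝ) (derivative f.denom)
          + algebraMap ℝ[X] (RatFunc ℝ) (derivative q) * algebraMap ℝ[X] (RatFunc ℝ) f.denom) * e1

theorem ratDeriv_mul (f g : RatFunc ℝ) :
    ratDeriv (f * g) = ratDeriv f * g + f * ratDeriv g := by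
  have hf : algebraMap ℝ[X] (RatFunc ℝ) f.denom ≠ 0 :=
    RatFunc.algebraMap_ne_zero f.denom_ne_zero
  have hg : algebraMap ℝ[X] (RatFunc ℝ) g.denom ≠ 0 :=
    RatFunc.algebraMap_ne_zero g.denom_ne_zero
  have h := ratDeriv_div (f.num * g.num) (f.denom * g.denom)
    (mul_ne_zero f.denom_ne_zero g.denom_ne_zero)
  have e : algebraMap ℝ[X] (RatFunc ℝ) (f.num * g.num)
      / algebraMap ℝ[X] (RatFunc ℝ) (f.denom * g.denom) = f * g := by
    rw [map_mul, map_mul, mul_div_mul_comm, RatFunc.num_div_denom, RatFunc.num_div_denom]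
  rw [e] at h
  rw [h, ratDeriv, ratDeriv]
  have ef : algebraMap ℝ[X] (RatFunc ℝ) f.num = f * algebraMap ℝ[X] (RatFunc ℝ) f.denom :=
    (div_eq_iff hf).1 (RatFunc.num_div_denom f)
  have eg : algebraMap ℝ[X] (RatFunc ℝ) g.num = g * algebraMap ℝ[X] (RatFunc ℝ) g.denom :=
    (div_eq_iff hg).1 (RatFunc.num_div_denom g)
  simp only [derivative_mul, map_mul, map_add]
  rw [ef, eg]
  field_simp
  ring

theorem ratDeriv_add (f g : RatFunc ℝ) : ratDeriv (f + g) = ratDeriv f + ratDeriv g := by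
  have hf : algebraMap ℝ[X] (RatFunc ℝ) f.denom ≠ 0 :=
    RatFunc.algebraMap_ne_zero f.denom_ne_zero
  have hg : algebraMap ℝ[X] (RatFunc ℝ) g.denom ≠ 0 :=
    RatFunc.algebraMap_ne_zero g.denom_ne_zero
  have h := ratDeriv_div (f.num * g.denom + f.denom * g.num) (f.denom * g.denom)
    (mul_ne_zero f.denom_ne_zero g.denom_ne_zero)
  have e : algebraMap ℝ[X] (RatFunc ℝ) (f.num * g.denom + f.denom * g.num)
      / algebraMap ℝ[X] (RatFunc ℝ) (f.denom * g.denom) = f + g := by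
    rw [map_add, map_mul, map_mul, map_mul, ← div_add_div _ _ hf hg,
      RatFunc.num_div_denom, RatFunc.num_div_denom]
  rw [e] at h
  rw [h, ratDeriv, ratDeriv]
  simp only [derivative_mul, map_mul, map_add]
  field_simp
  ring

/-- A differential operator `p D² + q D + r` with rational coefficients. -/
structure DiffOp2 where
  p : RatFunc ℝ
  q : RatFunc ℝ
  r : RatFunc ℝ

/-- The action of `p D² + q D + r` on a rational function. -/
def DiffOp2.apply (T : DiffOp2) (y : RatFunc ℝ) : RatFunc ℝ :=
  T.p * ratDeriv (ratDeriv y) + T.q * ratDeriv y + T.r * y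

/-- The coefficients of the gauge transformed operator `f⁻¹ ∘ T ∘ f`
(see `DiffOp2.gauge_apply`). -/
def DiffOp2.gauge (T : DiffOp2) (f : RatFunc ℝ) : DiffOp2 where
  p := T.p
  q := T.q + 2 * T.p * (ratDeriv f / f)
  r := T.r + T.q * (ratDeriv f / f) + T.p * (ratDeriv (ratDeriv f) / f)

theorem DiffOp2.gauge_apply (T : DiffOp2) (f y : RatFunc ℝ) (hf : f ≠ 0) :
    (T.gauge f).apply y = f⁻¹ * T.apply (f * y) := by
  simp only [DiffOp2.apply, DiffOp2.gauge, ratDeriv_mul, ratDeriv_add]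
  field_simp
  ring

/-! ### Exceptional Jacobi operators -/

/-- `η(x; α, β) = (α + 1) / (x - 1) + (β + 1) / (x + 1)`. -/
def eta (α β : ℝ) : RatFunc ℝ :=
  RatFunc.C (α + 1) / (RatFunc.X - 1) + RatFunc.C (β + 1) / (RatFunc.X + 1)

/-- The operator in the natural gauge,
`(x² - 1) (D² - 2 (τ'/τ) D + τ''/τ + η (D - τ'/τ)) + 2 x τ'/τ`. -/
def Tng (τ : ℝ[X]) (α β : ℝ) : DiffOp2 :=
  let t : RatFunc ℝ := algebraMap ℝ[X] (RatFunc ℝ) τ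
  { p := RatFunc.X ^ 2 - 1
    q := (RatFunc.X ^ 2 - 1) * (-2 * (ratDeriv t / t) + eta α β)
    r := (RatFunc.X ^ 2 - 1) * (ratDeriv (ratDeriv t) / t - eta α β * (ratDeriv t / t))
          + 2 * RatFunc.X * (ratDeriv t / t) }

/-- The operator in the rational gauge, `τ⁻¹ ∘ Tng(τ; α, β) ∘ τ`. -/
def Trg (τ : ℝ[X]) (α β : ℝ) : DiffOp2 :=
  (Tng τ α β).gauge (algebraMap ℝ[X] (RatFunc ℝ) τ)

/-- `P` is an eigenpolynomial of `T`. -/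
def IsEigenpolynomial (T : DiffOp2) (P : ℝ[X]) : Prop :=
  P ≠ 0 ∧ ∃ μ : ℝ, T.apply (algebraMap ℝ[X] (RatFunc ℝ) P)
    = RatFunc.C μ * algebraMap ℝ[X] (RatFunc ℝ) P

/-- An exceptional Jacobi operator: leading coefficient `x² - 1`, and eigenpolynomials of all but
finitely many degrees. -/
def IsExceptionalJacobi (T : DiffOp2) : Prop :=
  T.p = RatFunc.X ^ 2 - 1 ∧
    {n : ℕ | ¬ ∃ P : ℝ[X], IsEigenpolynomial T P ∧ P.natDegree = n}.Finite

/-- `Trg(τ; α, β)` is an exceptional Jacobi operator in the rational gauge: `τ(± 1) ≠ 0` and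
`Tng(τ; α, β)` is an exceptional Jacobi operator. -/
def IsExceptionalRationalGauge (τ : ℝ[X]) (α β : ℝ) : Prop :=
  τ.eval 1 ≠ 0 ∧ τ.eval (-1) ≠ 0 ∧ IsExceptionalJacobi (Tng τ α β)

/-- The parameters of degeneracy class A. -/
def IsClassA (α β : ℝ) : Prop :=
  ((∃ n : ℕ, α = n) ∧ ∀ m : ℤ, β ≠ m) ∨ ((∀ m : ℤ, α ≠ m) ∧ ∃ n : ℕ, β = n)

/-- The rational function `f` has no pole at `c`. -/
def RegularAt (f : RatFunc ℝ) (c : ℝ) : Prop := f.denom.eval c ≠ 0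

/-- `f` is a quasi-polynomial eigenfunction of `T` with eigenvalue `μ`: a rational eigenfunction
without zeros or poles at the zeros `± 1` of `x² - 1`. -/
def IsQuasiPolynomialEigenfunction (T : DiffOp2) (f : RatFunc ℝ) (μ : ℝ) : Prop :=
  T.apply f = RatFunc.C μ * f ∧
    f.num.eval 1 ≠ 0 ∧ f.denom.eval 1 ≠ 0 ∧ f.num.eval (-1) ≠ 0 ∧ f.denom.eval (-1) ≠ 0

/-- The numerator and the denominator of `f` have the same leading coefficient. -/
def IsMonicRat (f : RatFunc ℝ) : Prop := f.num.leadingCoeff = f.denom.leadingCoeff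

/-! ### Quasi-rational spectrum, asymptotic types, spectral diagrams

A quasi-rational eigenfunction `φ` is represented, up to a scalar factor, by its rational
logarithmic derivative `w = φ'/φ`; the equation `T φ = μ φ` is the Riccati equation for `w`. -/

/-- The rational solutions `w` of `p (w' + w²) + q w + r = μ`. -/
def Ric (T : DiffOp2) (μ : ℝ) : Set (RatFunc ℝ) :=
  {w | T.p * (ratDeriv w + w ^ 2) + T.q * w + T.r = RatFunc.C μ}

/-- The quasi-rational spectrum. -/
def qrSpectrum (T : DiffOp2) : Set ℝ := {μ | (Ric T μ).Nonempty}

/-- The four asymptotic types. -/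
inductive AsympType
  | one
  | two
  | three
  | four

/-- `w = φ'/φ` has the given asymptotic type, according to its poles at `1` and `-1`. -/
def HasType (w : RatFunc ℝ) : AsympType → Prop
  | .one => RegularAt w 1 ∧ RegularAt w (-1)
  | .two => ¬ RegularAt w 1 ∧ ¬ RegularAt w (-1)
  | .three => ¬ RegularAt w 1 ∧ RegularAt w (-1)
  | .four => RegularAt w 1 ∧ ¬ RegularAt w (-1)

/-- `d` is the coefficient of `1/x` in the expansion of `w` at infinity, that is, the degree of a
quasi-rational function with logarithmic derivative `w`. -/
def HasQRDegree (w : RatFunc ℝ) (d : ℝ) : Prop :=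
  ∃ P : ℝ[X], Filter.Tendsto
    (fun x : ℝ => x * (RatFunc.eval (RingHom.id ℝ) x w - P.eval x)) Filter.atTop (𝓝 d)

/-- The degrees of `μ₁ = 1`, `μ₂ = (1-x)^(-α) (1+x)^(-β)`, `μ₃ = (1-x)^(-α)`,
`μ₄ = (1+x)^(-β)`. -/
def degMu (α β : ℝ) : AsympType → ℝ
  | .one => 0
  | .two => -α - β
  | .three => -α
  | .four => -β

/-- The index set of the quasi-rational eigenfunctions of a given type of `T = Trg(τ; α, β)`; the
index of an eigenfunction `φ` of type `t` is `deg φ - deg μ_t`. -/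
def indexSet (T : DiffOp2) (α β : ℝ) (t : AsympType) : Set ℝ :=
  {k | ∃ (μ : ℝ) (w : RatFunc ℝ), w ∈ Ric T μ ∧ HasType w t ∧ HasQRDegree w (k + degMu α β t)}

/-- The eight labels: four simple ones for the types `1, 2, 3, 4`, the double ones for the types
`{2, 3}`, `{3, 4}`, `{1, 2}`, and the infinite one for the types `{2, 3, 4}`. -/
inductive Label
  | circ
  | times
  | plus
  | minus
  | asterisk
  | div
  | circtimes
  | bullet

/-- The meaning of the labels, in terms of the set of logarithmic derivatives of the
quasi-rational eigenfunctions at one eigenvalue. -/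
def HasLabel (S : Set (RatFunc ℝ)) : Label → Prop
  | .circ => ∃ w, S = {w} ∧ HasType w .one
  | .times => ∃ w, S = {w} ∧ HasType w .two
  | .plus => ∃ w, S = {w} ∧ HasType w .three
  | .minus => ∃ w, S = {w} ∧ HasType w .four
  | .asterisk => ∃ v w, v ≠ w ∧ S = {v, w} ∧ HasType v .two ∧ HasType w .three
  | .div => ∃ v w, v ≠ w ∧ S = {v, w} ∧ HasType v .three ∧ HasType w .four
  | .circtimes => ∃ v w, v ≠ w ∧ S = {v, w} ∧ HasType v .one ∧ HasType w .two
  | .bullet => S.Infinite ∧ (∃ w ∈ S, HasType w .two) ∧ (∃ w ∈ S, HasType w .three) ∧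
      (∃ w ∈ S, HasType w .four) ∧ ∀ w ∈ S, ¬ HasType w .one

/-- The spectral diagram of `T`, as the graph of the assignment of labels to eigenvalues. -/
def spectralDiagram (T : DiffOp2) : Set (ℝ × Label) :=
  {x | x.1 ∈ qrSpectrum T ∧ HasLabel (Ric T x.1) x.2}

/-- The eigenvalues `λ₁, λ₂, λ₃, λ₄` as functions of the index. -/
def lam (α β : ℝ) : AsympType → ℝ → ℝ
  | .one, k => k * (k + α + β + 1)
  | .two, k => (k - α - β) * (k + 1)
  | .three, k => (k - α) * (k + β + 1)
  | .four, k => (k - β) * (k + α + 1)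

/-- `λ₁(ℤ; α, β) ∪ λ₁(ℤ - α; α, β)`. -/
def sigmaQ (α β : ℝ) : Set ℝ :=
  {μ | ∃ n : ℤ, μ = lam α β .one n} ∪ {μ | ∃ n : ℤ, μ = lam α β .one (n - α)}

/-! ### Classical Jacobi polynomials and norms -/

/-- The classical Jacobi polynomial `P_n(x; a, b)`. -/
def jacobiP (n : ℕ) (a b : ℝ) : ℝ[X] :=
  C ((2 : ℝ) ^ n)⁻¹ * ∑ k ∈ Finset.range (n + 1),
    C (Ring.choose ((n : ℝ) + a) (n - k) * Ring.choose ((n : ℝ) + b) k)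
      * (X - 1) ^ k * (X + 1) ^ (n - k)

/-- The monic form `π_n = 2^n n! / (n + a + b + 1)_n P_n`, with the rising factorial `(t)_n`. -/
def jacobiMonic (n : ℕ) (a b : ℝ) : ℝ[X] :=
  C ((2 : ℝ) ^ n * (n.factorial : ℝ) / (ascPochhammer ℝ n).eval ((n : ℝ) + a + b + 1))
    * jacobiP n a b

/-- The classical norm `ν(z; a, b)`. -/
def nuC (z a b : ℝ) : ℝ :=
  (2 : ℝ) ^ (1 + a + b + 2 * z) *
    (Real.Gamma (z + 1) * Real.Gamma (a + b + z + 1) * Real.Gamma (a + z + 1)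
      * Real.Gamma (b + z + 1)) /
    (Real.Gamma (a + b + 2 * z + 1) * Real.Gamma (a + b + 2 * z + 2))

/-! ### The two stage construction, as functions on the interval `(-1, 1)` -/

/-- The quasi-rational anti-derivative of `f(x) (1+x)^b` for a polynomial `f` and `b ∉ ℤ`, obtained
from `∫ (1+x)^(b+k) = (1+x)^(b+k+1) / (b+k+1)` and the expansion of `f` in powers of `1 + x`. -/
def qrIntegral (f : ℝ[X]) (b : ℝ) (x : ℝ) : ℝ :=
  (taylor (-1) f).sum fun k c => c * ((1 + x) ^ (b + k + 1) / (b + k + 1))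

theorem hasDerivAt_qrIntegral (f : ℝ[X]) (b : ℝ) (hb : ∀ m : ℤ, b ≠ m) (x : ℝ) (hx : -1 < x) :
    HasDerivAt (qrIntegral f b) (f.eval x * (1 + x) ^ b) x := by
  have hx' : 0 < 1 + x := by linarith
  have hk : ∀ k : ℕ, HasDerivAt
      (fun t : ℝ => (taylor (-1) f).coeff k * ((1 + t) ^ (b + k + 1) / (b + k + 1)))
      ((taylor (-1) f).coeff k * (1 + x) ^ k * (1 + x) ^ b) x := by
    intro k
    have hne : b + k + 1 ≠ 0 := fun h => hb (-(k : ℤ) - 1) (by push_cast; linarith)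
    have h1 : HasDerivAt (fun t : ℝ => 1 + t) 1 x := (hasDerivAt_id x).const_add 1
    have h2 := ((h1.rpow_const (p := b + k + 1) (Or.inl hx'.ne')).div_const
      (b + k + 1)).const_mul ((taylor (-1) f).coeff k)
    refine h2.congr_deriv ?_
    have e : b + k + 1 - 1 = b + (k : ℝ) := by ring
    rw [e, Real.rpow_add hx', Real.rpow_natCast]
    field_simp
  have hs := HasDerivAt.fun_sum (u := (taylor (-1) f).support) (fun k _ => hk k)
  have e : f.eval x = ∑ k ∈ (taylor (-1) f).support, (taylor (-1) f).coeff k * (1 + x) ^ k := by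
    have h : f.eval x = (taylor (-1) f).eval (1 + x) := by
      rw [taylor_eval]; congr 1; ring
    rw [h, eval_eq_sum]; rfl
  rw [e, Finset.sum_mul]
  exact hs

/-- The incomplete inner product `ρ_{ij}(x; a, b) = ∫ π_i π_j (1-x)^a (1+x)^b`. -/
def rho (a : ℕ) (b : ℝ) (i j : ℕ) : ℝ → ℝ :=
  qrIntegral (jacobiMonic i a b * jacobiMonic j a b * (1 - X) ^ a) b

/-- The increasing enumeration `ℓ_1 < ℓ_2 < ⋯` of a finite set. -/
def enum (L : Finset ℕ) (i : Fin L.card) : ℕ := L.orderEmbOfFin rfl i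

/-- The matrix `R` with entries `ρ_{ℓ_i ℓ_j}(x; a, b)`. -/
def matR (L : Finset ℕ) (a : ℕ) (b x : ℝ) : Matrix (Fin L.card) (Fin L.card) ℝ :=
  Matrix.of fun i j => rho a b (enum L i) (enum L j) x

/-- The augmented matrix `A(n)`: with `ℓ_0 := n`, its row `0` is `π_{ℓ_j}` and its row `i ≥ 1` is
`ρ_{ℓ_i ℓ_j}`. -/
def matA (L : Finset ℕ) (a : ℕ) (b : ℝ) (n : ℕ) (x : ℝ) :
    Matrix (Fin (L.card + 1)) (Fin (L.card + 1)) ℝ :=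
  let idx : Fin (L.card + 1) → ℕ := Fin.cons n (enum L)
  Matrix.of fun i j =>
    Fin.cases ((jacobiMonic (idx j) a b).eval x) (fun i' => rho a b (enum L i') (idx j) x) i

/-- `χ̂(z; L, a, b) = ∏_{k ∈ L} (z - k*) / (z - k)`, with `k* = - k - a - b - 1`. -/
def chiHat (L : Finset ℕ) (a b z : ℝ) : ℝ :=
  ∏ k ∈ L, (z - (-(k : ℝ) - a - b - 1)) / (z - k)

/-- `χ(z; K) = ∏_{k ∈ K} (z - k)⁻¹`. -/
def chi (K : Finset ℕ) (z : ℝ) : ℝ := ∏ k ∈ K, (z - k)⁻¹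

/-- `τ̂ = (1+x)^(-q(q+b)) det R`, with `q = |L|`. -/
def tauHat (L : Finset ℕ) (a : ℕ) (b x : ℝ) : ℝ :=
  (1 + x) ^ (-((L.card : ℝ) * (L.card + b))) * (matR L a b x).det

/-- `π̂_i = χ̂(i+q) (1+x)^(-q) det A(i+q) / det R`, with `q = |L|`, for integers `i ≥ -q`. -/
def piHat (L : Finset ℕ) (a : ℕ) (b : ℝ) (i : ℤ) (x : ℝ) : ℝ :=
  chiHat L a b ((i : ℝ) + L.card) * ((1 + x) ^ L.card)⁻¹
    * ((matA L a b (i + L.card).toNat x).det / (matR L a b x).det)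

/-- The Wronskian determinant of `f_0, …, f_{n-1}`. -/
def wronskianDet {n : ℕ} (f : Fin n → ℝ → ℝ) (x : ℝ) : ℝ :=
  (Matrix.of fun i j : Fin n => iteratedDeriv (i : ℕ) (f j) x).det

/-- The functions `π̂_{k_1}, …, π̂_{k_p}`, where `k_1 < ⋯ < k_p` enumerates `K - q`. -/
def seeds (K L : Finset ℕ) (a : ℕ) (b : ℝ) (j : Fin K.card) : ℝ → ℝ :=
  piHat L a b ((enum K j : ℤ) - L.card)

/-- `τ = τ̂ Wr[π̂_{k_1}, …, π̂_{k_p}]`. -/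
def tauA (K L : Finset ℕ) (a : ℕ) (b x : ℝ) : ℝ :=
  tauHat L a b x * wronskianDet (seeds K L a b) x

/-- `π_i = χ(i+p+q; K) Wr[π̂_{k_1}, …, π̂_{k_p}, π̂_{i+p}] / Wr[π̂_{k_1}, …, π̂_{k_p}]`. -/
def piA (K L : Finset ℕ) (a : ℕ) (b : ℝ) (i : ℤ) (x : ℝ) : ℝ :=
  chi K ((i : ℝ) + K.card + L.card)
    * (wronskianDet (Fin.snoc (α := fun _ => ℝ → ℝ) (seeds K L a b)
          (piHat L a b (i + K.card))) x
        / wronskianDet (seeds K L a b) x)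

/-- The function `f` on `(-1, 1)` is the rational function `g`, up to finitely many points (the
zeros of the denominators that occur in the formula for `f`). -/
def AgreesWith (f : ℝ → ℝ) (g : RatFunc ℝ) : Prop :=
  {x : ℝ | x ∈ Set.Ioo (-1) 1 ∧ f x ≠ RatFunc.eval (RingHom.id ℝ) x g}.Finite

/-! ### Class A index sets and diagrams, and the norms -/

/-- The index sets, with `p = |K|`, `q = |L|`:
`I₁ = (ℕ \ (K ∪ L)) - p - q`, `I₂ = ({0, …, a-1} ∪ (-K-1)) + p + q`,
`I₃ = ({0, …, a-1} ∪ (K+a)) - q`, `I₄ = (ℕ ∪ (-L-1-a)) + q`. -/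
def indexA (K L : Finset ℕ) (a : ℕ) : AsympType → Set ℤ
  | .one => {i | ∃ n : ℕ, n ∉ K ∧ n ∉ L ∧ i = n - K.card - L.card}
  | .two => {i | (∃ n : ℕ, n < a ∧ i = n + K.card + L.card) ∨
      ∃ k ∈ K, i = (-(k : ℤ) - 1) + K.card + L.card}
  | .three => {i | (∃ n : ℕ, n < a ∧ i = n - L.card) ∨ ∃ k ∈ K, i = (k : ℤ) + a - L.card}
  | .four => {i | (∃ n : ℕ, i = n + L.card) ∨ ∃ l ∈ L, i = (-(l : ℤ) - 1 - a) + L.card}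

/-- The eigenvalue sets `σ_t = λ_t(I_t; α, β)`. -/
def sigmaA (K L : Finset ℕ) (a : ℕ) (α β : ℝ) (t : AsympType) : Set ℝ :=
  {μ | ∃ i ∈ indexA K L a t, μ = lam α β t i}

/-- The diagram `(σ₁, σ₂, σ₄) ↦ (circ, asterisk, minus)`. -/
def diagramA (K L : Finset ℕ) (a : ℕ) (α β : ℝ) : Set (ℝ × Label) :=
  {x | (x.1 ∈ sigmaA K L a α β .one ∧ x.2 = .circ) ∨
    (x.1 ∈ sigmaA K L a α β .two ∧ x.2 = .asterisk) ∨
    (x.1 ∈ sigmaA K L a α β .four ∧ x.2 = .minus)}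

/-- `κ(z; K, L, a, b) = χ̂(z; K, a, b) χ̂(z; L, a, b)²`. -/
def kappaA (K L : Finset ℕ) (a b z : ℝ) : ℝ := chiHat K a b z * chiHat L a b z ^ 2

/-- The anti-derivative of `f(x) (1-x)^α (1+x)^β` is `g(x) (1-x)^(α+1) (1+x)^(β+1)` for some
rational function `g` that is regular at `± 1`. -/
def HasQRAntideriv (f : RatFunc ℝ) (α β : ℝ) : Prop :=
  ∃ g : RatFunc ℝ, RegularAt g 1 ∧ RegularAt g (-1) ∧
    {x : ℝ | x ∈ Set.Ioo (-1) 1 ∧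
      ¬ HasDerivAt
        (fun t : ℝ => RatFunc.eval (RingHom.id ℝ) t g * (1 - t) ^ (α + 1) * (1 + t) ^ (β + 1))
        (RatFunc.eval (RingHom.id ℝ) x f * (1 - x) ^ α * (1 + x) ^ β) x}.Finite

/-- The constants `ν_i`, `i ∈ I`, are the norms of the quasi-polynomials `π_i`, `i ∈ I`, with
respect to the weight `(1-x)^α (1+x)^β`, in the generalized sense: for `i, j ∈ I` the function
`(π_i π_j - ν_i δ_{ij} / ν(α, β)) (1-x)^α (1+x)^β`, where `ν(α, β) = ν(0; α, β)`, has a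
quasi-rational anti-derivative of the form `(1-x)^(α+1) (1+x)^(β+1) g(x)` with `g` rational and regular at `± 1`. -/
def AreNorms (I : Set ℤ) (π : ℤ → RatFunc ℝ) (ν : ℤ → ℝ) (α β : ℝ) : Prop :=
  ∀ i ∈ I, ∀ j ∈ I,
    HasQRAntideriv (π i * π j - RatFunc.C (if i = j then ν i / nuC 0 α β else 0)) α β

end ExJacobi

end

open Polynomial
open scoped Topology

noncomputable section

namespace ExJacobi

-- The operator is reached from the classical Jacobi operator by rational Darboux transformations,
-- and each assertion is an invariant that every single transformation updates. The rational gauge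
-- depends on `τ` only through `u = τ'/τ` (`Trg_eq_opU`), so the operators are written `opU u α β`
-- with `u` any rational function. A quasi-rational eigenfunction is represented by its logarithmic
-- derivative, a rational solution of a Riccati equation. A seed `w₀` factors the operator as `B ∘
-- A` plus a constant, with `A = D - w₀`, and `A ∘ B` is, up to a constant, `opU (u + w₀) (α + 1) (β
-- + 1)`. Away from the seed's eigenvalue this is a bijection of Riccati solutions (`Ric_darboux`);
-- at that eigenvalue the transformed equation reduces to a first order linear one
-- (`mem_Ric_darboux_self`).
--
-- The transformed data are recorded in `ExcState`: a label at every eigenvalue `λ₁(n - s)`, `n ∈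
-- ℤ`, the eigenfunctions `π n` with their leading coefficients, the incomplete inner products `r n
-- m` freed of the factor `(1 + x)^(β + 1)`, whose values at `1` are the norms, and a local
-- condition `LocAt` at `1`. There are two kinds of steps.
--
-- A regular seed `π k` (`ExcState.kStep`) raises both parameters by one and turns the label at `k`
-- from `circ` into `ast`: the reciprocal solution is singular at both endpoints, and reduction of
-- order yields one further solution, with a pole at `1` only because the norm of `π k` is not zero.
--
-- A confluent step (`ExcState.lStep`) applies a second transformation at the same eigenvalue,
-- seeded by that further solution, and conjugates by `x - 1`. It restores `α`, raises `β` by two,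
-- and turns `circ` into `minus`. That no second solution reappears is `inhom_not_solvable`, where
-- `LocAt` enters.
--
-- The classical operator is itself built this way (`excState_base`): for `α = 0` the exponents at
-- `1` coincide, so labels and local condition can be computed directly, and `a` transformations
-- seeded by constants, that is differentiations, lead to `α = a` and create the `ast` labels at
-- `-1, …, -a`. Applying the confluent steps for `L` and then the regular steps for `K` gives
-- `exists_state`; column and row operations on bordered determinants identify the iterates with the
-- determinants and Wronskians of the construction.
--
-- The condition `b ∉ ℤ` acts mainly through `eq_zero_of_xp_ode`: a non-integral power of `1 + x` is
-- not rational. Hence anti-derivatives are unique and no function is both rational and twisted by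
-- `(1 + x)^(-β)`. The same condition separates the two degrees that an eigenvalue allows, so
-- rational eigenfunctions are unique up to scalars. Polynomiality of `τ` comes from the local
-- exponents at its zeros (`regP_tau_mul`).

local notation "∂" => ratDeriv
local notation "ι" => algebraMap ℝ[X] (RatFunc ℝ)
local notation "xm" => (RatFunc.X - 1 : RatFunc ℝ)
local notation "xp" => (RatFunc.X + 1 : RatFunc ℝ)
local notation "evR" => RatFunc.eval (RingHom.id ℝ)

/-! ### Calculus of rational functions -/

theorem ratDeriv_algebraMap (p : ℝ[X]) : ∂ (ι p) = ι (derivative p) := by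
  have h := ratDeriv_div p 1 one_ne_zero
  simpa using h

theorem ratDeriv_C (c : ℝ) : ∂ (RatFunc.C c) = 0 := by
  have h := ratDeriv_algebraMap (C c)
  simpa [RatFunc.algebraMap_C] using h

theorem ratDeriv_X : ∂ RatFunc.X = 1 := by
  have h := ratDeriv_algebraMap X
  simpa [RatFunc.algebraMap_X] using h

theorem ratDeriv_zero : ∂ 0 = 0 := by simpa using ratDeriv_C 0

theorem ratDeriv_one : ∂ 1 = 0 := by simpa using ratDeriv_C 1

theorem ratDeriv_neg (f : RatFunc ℝ) : ∂ (-f) = -∂ f := by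
  have h := ratDeriv_add f (-f)
  rw [add_neg_cancel, ratDeriv_zero] at h
  linear_combination -h

theorem ratDeriv_sub (f g : RatFunc ℝ) : ∂ (f - g) = ∂ f - ∂ g := by
  rw [sub_eq_add_neg, ratDeriv_add, ratDeriv_neg, sub_eq_add_neg]

theorem ratDeriv_inv (f : RatFunc ℝ) : ∂ f⁻¹ = -∂ f / f ^ 2 := by
  rcases eq_or_ne f 0 with rfl | hf
  · simp [ratDeriv_zero]
  have h := ratDeriv_mul f f⁻¹
  rw [mul_inv_cancel₀ hf, ratDeriv_one] at h
  field_simp at h ⊢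
  linear_combination -h

theorem ratDeriv_quot (f g : RatFunc ℝ) (hg : g ≠ 0) :
    ∂ (f / g) = (∂ f * g - f * ∂ g) / g ^ 2 := by
  rw [div_eq_mul_inv, ratDeriv_mul, ratDeriv_inv]
  field_simp
  ring

theorem ratDeriv_C_mul (c : ℝ) (f : RatFunc ℝ) :
    ∂ (RatFunc.C c * f) = RatFunc.C c * ∂ f := by
  rw [ratDeriv_mul, ratDeriv_C]; ring

theorem ratDeriv_natCast (n : ℕ) : ∂ (n : RatFunc ℝ) = 0 := by
  simpa using ratDeriv_C n

theorem ratDeriv_sum {κ : Type*} (s : Finset κ) (f : κ → RatFunc ℝ) :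
    ∂ (∑ i ∈ s, f i) = ∑ i ∈ s, ∂ (f i) := by
  classical
  induction s using Finset.induction_on with
  | empty => simp [ratDeriv_zero]
  | insert i s hi ih => rw [Finset.sum_insert hi, Finset.sum_insert hi, ratDeriv_add, ih]

theorem ratDeriv_pow (f : RatFunc ℝ) (n : ℕ) :
    ∂ (f ^ n) * f = n * f ^ n * ∂ f := by
  induction n with
  | zero => simp [ratDeriv_one]
  | succ n ih =>
    rw [pow_succ, ratDeriv_mul]
    push_cast
    linear_combination f * ih

theorem X_sub_one_ne_zero : xm ≠ 0 := by
  have h : (X - C (1 : ℝ)) ≠ 0 := X_sub_C_ne_zero 1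
  have := RatFunc.algebraMap_ne_zero h
  simpa using this

theorem X_add_one_ne_zero : xp ≠ 0 := by
  have h : (X - C (-1 : ℝ)) ≠ 0 := X_sub_C_ne_zero (-1)
  have := RatFunc.algebraMap_ne_zero h
  simpa using this

theorem one_sub_X_ne_zero : (1 - RatFunc.X : RatFunc ℝ) ≠ 0 := by
  rw [← neg_sub]; exact neg_ne_zero.2 X_sub_one_ne_zero

/-- The logarithmic derivative of a rational function. -/
def dlog (f : RatFunc ℝ) : RatFunc ℝ := ∂ f / f

theorem dlog_mul {f g : RatFunc ℝ} (hf : f ≠ 0) (hg : g ≠ 0) :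
    dlog (f * g) = dlog f + dlog g := by
  unfold dlog
  rw [ratDeriv_mul]
  field_simp

theorem dlog_one : dlog 1 = 0 := by simp [dlog, ratDeriv_one]

theorem dlog_C (c : ℝ) : dlog (RatFunc.C c) = 0 := by simp [dlog, ratDeriv_C]

theorem dlog_inv (f : RatFunc ℝ) : dlog f⁻¹ = -dlog f := by
  rcases eq_or_ne f 0 with rfl | hf
  · simp [dlog]
  unfold dlog
  rw [ratDeriv_inv]
  field_simp

theorem dlog_div {f g : RatFunc ℝ} (hf : f ≠ 0) (hg : g ≠ 0) :
    dlog (f / g) = dlog f - dlog g := by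
  rw [div_eq_mul_inv, dlog_mul hf (inv_ne_zero hg), dlog_inv, sub_eq_add_neg]

theorem dlog_pow (f : RatFunc ℝ) (n : ℕ) : dlog (f ^ n) = n * dlog f := by
  rcases eq_or_ne f 0 with rfl | hf
  · rcases n with _ | n
    · simp [dlog_one]
    · simp [dlog]
  have h := ratDeriv_pow f n
  unfold dlog
  field_simp
  linear_combination h

theorem dlog_zpow (f : RatFunc ℝ) (n : ℤ) : dlog (f ^ n) = n * dlog f := by
  rcases n with n | n
  · simpa using dlog_pow f n
  · rw [zpow_negSucc, dlog_inv, dlog_pow]; push_cast; ring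

theorem ratDeriv_eq_mul_dlog {f : RatFunc ℝ} (hf : f ≠ 0) : ∂ f = f * dlog f := by
  unfold dlog; field_simp

theorem dlog_C_mul {c : ℝ} (hc : c ≠ 0) {f : RatFunc ℝ} (hf : f ≠ 0) :
    dlog (RatFunc.C c * f) = dlog f := by
  rw [dlog_mul (by simpa using hc) hf, dlog_C, zero_add]

theorem dlog_neg (f : RatFunc ℝ) : dlog (-f) = dlog f := by
  unfold dlog; rw [ratDeriv_neg, neg_div_neg_eq]

theorem dlog_xm : dlog xm = 1 / xm := by
  unfold dlog; rw [ratDeriv_sub, ratDeriv_X, ratDeriv_one, sub_zero]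

theorem dlog_xp : dlog xp = 1 / xp := by
  unfold dlog; rw [ratDeriv_add, ratDeriv_X, ratDeriv_one, add_zero]

theorem dlog_one_sub_X : dlog (1 - RatFunc.X) = 1 / xm := by
  rw [← neg_sub, dlog_neg, dlog_xm]

/-- In lowest terms the denominator would divide its own derivative, so by degrees it is constant,
hence `1` by monicity; the numerator then has zero derivative. -/
theorem eq_C_of_ratDeriv_eq_zero {f : RatFunc ℝ} (h : ∂ f = 0) : ∃ c, f = RatFunc.C c := by
  have hd : f.denom ≠ 0 := f.denom_ne_zero
  have hd' : ι f.denom ≠ 0 := RatFunc.algebraMap_ne_zero hd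
  rw [ratDeriv, div_eq_zero_iff, or_iff_left (pow_ne_zero 2 hd'), ← map_mul, ← map_mul,
    ← map_sub, map_eq_zero_iff _ (RatFunc.algebraMap_injective ℝ)] at h
  have hdvd : f.denom ∣ derivative f.denom := by
    apply (RatFunc.isCoprime_num_denom f).symm.dvd_of_dvd_mul_left
    exact ⟨derivative f.num, by linear_combination -h⟩
  have h0 : derivative f.denom = 0 := by
    by_contra h0
    rcases Nat.eq_zero_or_pos f.denom.natDegree with h1 | h1
    · rw [natDegree_eq_zero] at h1
      obtain ⟨c, hc⟩ := h1
      rw [← hc] at h0; simp at h0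
    · exact absurd (natDegree_le_of_dvd hdvd h0) (not_le.2 (natDegree_derivative_lt h1.ne'))
  have h1 : f.denom = 1 := by
    exact (RatFunc.monic_denom f).natDegree_eq_zero.1 (derivative_eq_zero.1 h0)
  rw [h1] at h
  simp at h
  obtain ⟨c, hc⟩ := natDegree_eq_zero.1 h
  refine ⟨c, ?_⟩
  rw [← RatFunc.num_div_denom f, h1, ← hc]
  simp

theorem eq_C_mul_of_dlog_eq {f g : RatFunc ℝ} (hf : f ≠ 0) (hg : g ≠ 0) (h : dlog f = dlog g) :
    ∃ c : ℝ, c ≠ 0 ∧ f = RatFunc.C c * g := by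
  have h1 : dlog (f / g) = 0 := by rw [dlog_div hf hg, h, sub_self]
  have h2 : ∂ (f / g) = 0 := by
    rw [ratDeriv_eq_mul_dlog (div_ne_zero hf hg), h1, mul_zero]
  obtain ⟨c, hc⟩ := eq_C_of_ratDeriv_eq_zero h2
  have h3 : f = RatFunc.C c * g := by rw [← hc]; field_simp
  refine ⟨c, ?_, h3⟩
  rintro rfl
  simp at h3; exact hf h3

/-! ### Values at a point -/

/-- `f` is regular at `c` with value `y`. -/
def ValAt (c : ℝ) (f : RatFunc ℝ) (y : ℝ) : Prop :=
  ∃ A B : ℝ[X], f = ι A / ι B ∧ B.eval c ≠ 0 ∧ y = A.eval c / B.eval c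

theorem ne_zero_of_eval_ne_zero {B : ℝ[X]} {c : ℝ} (h : B.eval c ≠ 0) : B ≠ 0 := by
  rintro rfl; simp at h

theorem iota_ne_zero_of_eval {B : ℝ[X]} {c : ℝ} (h : B.eval c ≠ 0) : ι B ≠ 0 :=
  RatFunc.algebraMap_ne_zero (ne_zero_of_eval_ne_zero h)

theorem ValAt.add {c : ℝ} {f g : RatFunc ℝ} {y z : ℝ} (hf : ValAt c f y) (hg : ValAt c g z) :
    ValAt c (f + g) (y + z) := by
  obtain ⟨A, B, rfl, hB, rfl⟩ := hf
  obtain ⟨A', B', rfl, hB', rfl⟩ := hg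
  have h1 := iota_ne_zero_of_eval hB
  have h2 := iota_ne_zero_of_eval hB'
  refine ⟨A * B' + B * A', B * B', ?_, by simp [hB, hB'], ?_⟩
  · simp only [map_add, map_mul]; field_simp
  · simp only [eval_add, eval_mul]; field_simp

theorem ValAt.mul {c : ℝ} {f g : RatFunc ℝ} {y z : ℝ} (hf : ValAt c f y) (hg : ValAt c g z) :
    ValAt c (f * g) (y * z) := by
  obtain ⟨A, B, rfl, hB, rfl⟩ := hf
  obtain ⟨A', B', rfl, hB', rfl⟩ := hg
  have h1 := iota_ne_zero_of_eval hB
  have h2 := iota_ne_zero_of_eval hB'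
  refine ⟨A * A', B * B', ?_, by simp [hB, hB'], ?_⟩
  · simp only [map_mul]; field_simp
  · simp only [eval_mul]; field_simp

theorem ValAt.poly (c : ℝ) (p : ℝ[X]) : ValAt c (ι p) (p.eval c) :=
  ⟨p, 1, by simp, by simp, by simp⟩

theorem ValAt.const (c y : ℝ) : ValAt c (RatFunc.C y) y := by
  simpa [RatFunc.algebraMap_C] using ValAt.poly c (C y)

theorem ValAt.var (c : ℝ) : ValAt c RatFunc.X c := by
  simpa [RatFunc.algebraMap_X] using ValAt.poly c X

theorem ValAt.one (c : ℝ) : ValAt c 1 1 := by simpa using ValAt.const c 1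

theorem ValAt.zero (c : ℝ) : ValAt c 0 0 := by simpa using ValAt.const c 0

theorem ValAt.neg {c : ℝ} {f : RatFunc ℝ} {y : ℝ} (hf : ValAt c f y) : ValAt c (-f) (-y) := by
  have := (ValAt.const c (-1)).mul hf
  simpa using this

theorem ValAt.sub {c : ℝ} {f g : RatFunc ℝ} {y z : ℝ} (hf : ValAt c f y) (hg : ValAt c g z) :
    ValAt c (f - g) (y - z) := by
  simpa [sub_eq_add_neg] using hf.add hg.neg

theorem ValAt.inv {c : ℝ} {f : RatFunc ℝ} {y : ℝ} (hf : ValAt c f y) (hy : y ≠ 0) :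
    ValAt c f⁻¹ y⁻¹ := by
  obtain ⟨A, B, rfl, hB, rfl⟩ := hf
  have hA : A.eval c ≠ 0 := fun h => hy (by simp [h])
  exact ⟨B, A, by rw [inv_div], hA, by rw [inv_div]⟩

theorem ValAt.div {c : ℝ} {f g : RatFunc ℝ} {y z : ℝ} (hf : ValAt c f y) (hg : ValAt c g z)
    (hz : z ≠ 0) : ValAt c (f / g) (y / z) := by
  simpa [div_eq_mul_inv] using hf.mul (hg.inv hz)

theorem ValAt.pow {c : ℝ} {f : RatFunc ℝ} {y : ℝ} (hf : ValAt c f y) (n : ℕ) :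
    ValAt c (f ^ n) (y ^ n) := by
  induction n with
  | zero => simpa using ValAt.one c
  | succ n ih => rw [pow_succ, pow_succ]; exact ih.mul hf

theorem ValAt.unique {c : ℝ} {f : RatFunc ℝ} {y z : ℝ} (hf : ValAt c f y) (hg : ValAt c f z) :
    y = z := by
  obtain ⟨A, B, rfl, hB, rfl⟩ := hf
  obtain ⟨A', B', h, hB', rfl⟩ := hg
  rw [div_eq_div_iff (iota_ne_zero_of_eval hB) (iota_ne_zero_of_eval hB'), ← map_mul, ← map_mul] at h
  have h1 := congrArg (eval c) (RatFunc.algebraMap_injective ℝ h)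
  simp only [eval_mul] at h1
  rw [div_eq_div_iff hB hB', h1]

theorem ValAt.regularAt {c : ℝ} {f : RatFunc ℝ} {y : ℝ} (hf : ValAt c f y) : RegularAt f c := by
  obtain ⟨A, B, rfl, hB, rfl⟩ := hf
  obtain ⟨E, hE⟩ := RatFunc.denom_div_dvd A B
  intro h
  apply hB
  rw [hE, eval_mul, h, zero_mul]

theorem RegularAt.valAt {c : ℝ} {f : RatFunc ℝ} (hf : RegularAt f c) :
    ValAt c f (evR c f) :=
  ⟨f.num, f.denom, (RatFunc.num_div_denom f).symm, hf, by simp [RatFunc.eval, eval₂_id]⟩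

theorem ValAt.eval_eq {c : ℝ} {f : RatFunc ℝ} {y : ℝ} (hf : ValAt c f y) : evR c f = y :=
  hf.regularAt.valAt.unique hf

theorem RegularAt.exists_valAt {c : ℝ} {f : RatFunc ℝ} (hf : RegularAt f c) :
    ∃ y, ValAt c f y := ⟨_, hf.valAt⟩

theorem RegularAt.add {c : ℝ} {f g : RatFunc ℝ} (hf : RegularAt f c) (hg : RegularAt g c) :
    RegularAt (f + g) c := (hf.valAt.add hg.valAt).regularAt

theorem RegularAt.sub {c : ℝ} {f g : RatFunc ℝ} (hf : RegularAt f c) (hg : RegularAt g c) :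
    RegularAt (f - g) c := (hf.valAt.sub hg.valAt).regularAt

theorem RegularAt.neg {c : ℝ} {f : RatFunc ℝ} (hf : RegularAt f c) :
    RegularAt (-f) c := hf.valAt.neg.regularAt

theorem RegularAt.mul {c : ℝ} {f g : RatFunc ℝ} (hf : RegularAt f c) (hg : RegularAt g c) :
    RegularAt (f * g) c := (hf.valAt.mul hg.valAt).regularAt

theorem regularAt_C (c y : ℝ) : RegularAt (RatFunc.C y) c := (ValAt.const c y).regularAt

theorem regularAt_one (c : ℝ) : RegularAt 1 c := (ValAt.one c).regularAt

theorem RegularAt.ratDeriv {c : ℝ} {f : RatFunc ℝ} (hf : RegularAt f c) :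
    RegularAt (∂ f) c := by
  obtain ⟨y, A, B, rfl, hB, rfl⟩ := hf.exists_valAt
  rw [ratDeriv_div A B (ne_zero_of_eval_ne_zero hB)]
  have h : ValAt c _ _ := (((ValAt.poly c (derivative A)).mul (ValAt.poly c B)).sub
    ((ValAt.poly c A).mul (ValAt.poly c (derivative B)))).div
    ((ValAt.poly c B).pow 2) (pow_ne_zero 2 hB)
  exact h.regularAt

theorem ValAt.dlog_regularAt {c : ℝ} {f : RatFunc ℝ} {y : ℝ} (hf : ValAt c f y) (hy : y ≠ 0) :
    RegularAt (dlog f) c :=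
  (hf.regularAt.ratDeriv.valAt.div hf hy).regularAt

theorem valAt_xm : ValAt 1 xm 0 := by simpa using (ValAt.var 1).sub (ValAt.one 1)

theorem valAt_xp : ValAt 1 xp 2 := by
  have := (ValAt.var 1).add (ValAt.one 1); norm_num at this; exact this

theorem valAt_neg_xm : ValAt (-1) xm (-2) := by
  have := (ValAt.var (-1)).sub (ValAt.one (-1)); norm_num at this; exact this

theorem valAt_neg_xp : ValAt (-1) xp 0 := by
  simpa using (ValAt.var (-1)).add (ValAt.one (-1))

theorem iota_X_sub_C (c : ℝ) : ι (X - C c) = RatFunc.X - RatFunc.C c := by simp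

theorem X_sub_C_ne_zero' (c : ℝ) : (RatFunc.X - RatFunc.C c : RatFunc ℝ) ≠ 0 := by
  rw [← iota_X_sub_C]; exact RatFunc.algebraMap_ne_zero (X_sub_C_ne_zero c)

/-- The order of a rational function at a point. -/
theorem exists_order (c : ℝ) {f : RatFunc ℝ} (hf : f ≠ 0) :
    ∃ (k : ℤ) (g : RatFunc ℝ) (y : ℝ), y ≠ 0 ∧ ValAt c g y ∧
      f = (RatFunc.X - RatFunc.C c) ^ k * g := by
  have key : ∀ p : ℝ[X], p ≠ 0 → ∃ (m : ℕ) (r : ℝ[X]), r.eval c ≠ 0 ∧ p = (X - C c) ^ m * r := by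
    intro p hp
    obtain ⟨r, h1, h2⟩ := exists_eq_pow_rootMultiplicity_mul_and_not_dvd p hp c
    exact ⟨_, r, fun h => h2 (dvd_iff_isRoot.2 h), h1⟩
  obtain ⟨m, r, hr, h1⟩ := key f.num (RatFunc.num_ne_zero hf)
  obtain ⟨n, t, ht, h2⟩ := key f.denom f.denom_ne_zero
  refine ⟨(m : ℤ) - n, ι r / ι t, r.eval c / t.eval c, div_ne_zero hr ht,
    (ValAt.poly c r).div (ValAt.poly c t) ht, ?_⟩
  conv_lhs => rw [← RatFunc.num_div_denom f, h1, h2]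
  have h0 := X_sub_C_ne_zero' c
  have := iota_ne_zero_of_eval ht
  rw [zpow_sub₀ h0, map_mul, map_mul, map_pow, map_pow, iota_X_sub_C]
  simp only [zpow_natCast]
  field_simp

/-! ### Limits at infinity -/

/-- `f` tends to `y` at infinity. -/
def AtInf (f : RatFunc ℝ) (y : ℝ) : Prop :=
  Filter.Tendsto (fun x : ℝ => evR x f) Filter.atTop (𝓝 y)

theorem eventually_regularAt (f : RatFunc ℝ) : ∀ᶠ x in Filter.atTop, RegularAt f x := by
  filter_upwards [Polynomial.eventually_atTop_not_isRoot f.denom f.denom_ne_zero] with x hx using hx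

theorem AtInf.add {f g : RatFunc ℝ} {y z : ℝ} (hf : AtInf f y) (hg : AtInf g z) :
    AtInf (f + g) (y + z) := by
  refine (Filter.Tendsto.add hf hg).congr' ?_
  filter_upwards [eventually_regularAt f, eventually_regularAt g] with x h1 h2
  exact (h1.valAt.add h2.valAt).eval_eq.symm

theorem AtInf.mul {f g : RatFunc ℝ} {y z : ℝ} (hf : AtInf f y) (hg : AtInf g z) :
    AtInf (f * g) (y * z) := by
  refine (Filter.Tendsto.mul hf hg).congr' ?_
  filter_upwards [eventually_regularAt f, eventually_regularAt g] with x h1 h2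
  exact (h1.valAt.mul h2.valAt).eval_eq.symm

theorem AtInf.const (y : ℝ) : AtInf (RatFunc.C y) y := by
  refine tendsto_const_nhds.congr fun x => ?_
  exact (ValAt.const x y).eval_eq.symm

theorem AtInf.neg {f : RatFunc ℝ} {y : ℝ} (hf : AtInf f y) : AtInf (-f) (-y) := by
  have := (AtInf.const (-1)).mul hf
  simpa using this

theorem AtInf.sub {f g : RatFunc ℝ} {y z : ℝ} (hf : AtInf f y) (hg : AtInf g z) :
    AtInf (f - g) (y - z) := by
  simpa [sub_eq_add_neg] using hf.add hg.neg

theorem AtInf.inv {f : RatFunc ℝ} {y : ℝ} (hf : AtInf f y) (hy : y ≠ 0) : AtInf f⁻¹ y⁻¹ := by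
  refine (Filter.Tendsto.inv₀ hf hy).congr' ?_
  filter_upwards [eventually_regularAt f, Filter.Tendsto.eventually_ne hf hy] with x h1 h2
  exact (h1.valAt.inv h2).eval_eq.symm

theorem AtInf.unique {f : RatFunc ℝ} {y z : ℝ} (hf : AtInf f y) (hg : AtInf f z) : y = z :=
  tendsto_nhds_unique hf hg

theorem atInf_poly_div {A B : ℝ[X]} (hB : B ≠ 0) (h : A.natDegree ≤ B.natDegree) :
    AtInf (ι A / ι B) (A.coeff B.natDegree / B.leadingCoeff) := by
  have e : ∀ᶠ x in Filter.atTop, A.eval x / B.eval x = evR x (ι A / ι B) := by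
    filter_upwards [Polynomial.eventually_atTop_not_isRoot B hB] with x hx
    exact ((ValAt.poly x A).div (ValAt.poly x B) hx).eval_eq.symm
  rcases eq_or_ne A.degree B.degree with h1 | h1
  · have := Polynomial.div_tendsto_atTop_leadingCoeff_div_of_degree_eq A B h1
    rw [leadingCoeff, natDegree_eq_of_degree_eq h1] at this
    exact this.congr' e
  · have h2 : A.degree < B.degree := lt_of_le_of_ne (by
      rcases eq_or_ne A 0 with rfl | hA
      · simp
      · rw [degree_eq_natDegree hA, degree_eq_natDegree hB]; exact_mod_cast h) h1
    have := Polynomial.div_tendsto_atTop_zero_of_degree_lt A B h2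
    rw [coeff_eq_zero_of_degree_lt (by rwa [← degree_eq_natDegree hB]), zero_div]
    exact this.congr' e

theorem atInf_inv_X : AtInf (RatFunc.X)⁻¹ 0 := by
  have := atInf_poly_div (A := 1) (B := X) X_ne_zero (by simp)
  simpa [coeff_one] using this

theorem atInf_inv_X_zpow_neg (n : ℕ) : AtInf ((RatFunc.X : RatFunc ℝ)⁻¹ ^ (n + 1)) 0 := by
  induction n with
  | zero => simpa using atInf_inv_X
  | succ n ih => rw [pow_succ]; simpa using ih.mul atInf_inv_X

theorem ratX_ne_zero : (RatFunc.X : RatFunc ℝ) ≠ 0 := RatFunc.X_ne_zero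

/-- `f ~ c x ^ d` at infinity, with `c ≠ 0`. -/
def HasLead (f : RatFunc ℝ) (d : ℤ) (c : ℝ) : Prop :=
  c ≠ 0 ∧ AtInf (f * RatFunc.X ^ (-d)) c

theorem HasLead.ne_zero {f : RatFunc ℝ} {d : ℤ} {c : ℝ} (h : HasLead f d c) : f ≠ 0 := by
  rintro rfl
  apply h.1
  have h1 := h.2
  rw [zero_mul] at h1
  have := AtInf.const 0
  rw [map_zero] at this
  exact h1.unique this

theorem HasLead.mul {f g : RatFunc ℝ} {d e : ℤ} {c k : ℝ} (hf : HasLead f d c)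
    (hg : HasLead g e k) : HasLead (f * g) (d + e) (c * k) := by
  refine ⟨mul_ne_zero hf.1 hg.1, ?_⟩
  have := hf.2.mul hg.2
  convert this using 1
  rw [neg_add, zpow_add₀ ratX_ne_zero]; ring

theorem HasLead.inv {f : RatFunc ℝ} {d : ℤ} {c : ℝ} (hf : HasLead f d c) :
    HasLead f⁻¹ (-d) c⁻¹ := by
  refine ⟨inv_ne_zero hf.1, ?_⟩
  have := hf.2.inv hf.1
  convert this using 1
  rw [mul_inv, ← zpow_neg]

theorem HasLead.div {f g : RatFunc ℝ} {d e : ℤ} {c k : ℝ} (hf : HasLead f d c)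
    (hg : HasLead g e k) : HasLead (f / g) (d - e) (c / k) := by
  simpa [div_eq_mul_inv, sub_eq_add_neg] using hf.mul hg.inv

theorem HasLead.pow {f : RatFunc ℝ} {d : ℤ} {c : ℝ} (hf : HasLead f d c) (n : ℕ) :
    HasLead (f ^ n) (n * d) (c ^ n) := by
  induction n with
  | zero => exact ⟨by simp, by simpa using AtInf.const 1⟩
  | succ n ih =>
    have := ih.mul hf
    rw [pow_succ, pow_succ]
    convert this using 1
    push_cast; ring

theorem HasLead.C_mul {f : RatFunc ℝ} {d : ℤ} {c k : ℝ} (hk : k ≠ 0) (hf : HasLead f d c) :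
    HasLead (RatFunc.C k * f) d (k * c) := by
  refine ⟨mul_ne_zero hk hf.1, ?_⟩
  have := (AtInf.const k).mul hf.2
  rwa [← mul_assoc] at this

theorem hasLead_poly {A : ℝ[X]} (hA : A ≠ 0) : HasLead (ι A) A.natDegree A.leadingCoeff := by
  refine ⟨leadingCoeff_ne_zero.2 hA, ?_⟩
  have := atInf_poly_div (A := A) (B := X ^ A.natDegree) (pow_ne_zero _ X_ne_zero) (by simp)
  simpa [div_eq_mul_inv] using this

theorem HasLead.unique {f : RatFunc ℝ} {d e : ℤ} {c k : ℝ} (hf : HasLead f d c)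
    (hg : HasLead f e k) : d = e ∧ c = k := by
  have key : ∀ {d e : ℤ} {c k : ℝ}, HasLead f d c → HasLead f e k → ¬ d < e := by
    intro d e c k hf hg hlt
    obtain ⟨n, hn⟩ : ∃ n : ℕ, e - d = n + 1 := ⟨(e - d - 1).toNat, by omega⟩
    have h1 := hf.2.mul (atInf_inv_X_zpow_neg n)
    have h2 : f * RatFunc.X ^ (-d) * (RatFunc.X⁻¹) ^ (n + 1) = f * RatFunc.X ^ (-e) := by
      rw [mul_assoc, inv_pow, ← zpow_natCast, ← zpow_neg, ← zpow_add₀ ratX_ne_zero]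
      congr 2; push_cast; omega
    rw [h2, mul_zero] at h1
    exact hg.1 (hg.2.unique h1)
  have hde : d = e := le_antisymm (not_lt.1 (key hg hf)) (not_lt.1 (key hf hg))
  subst hde
  exact ⟨rfl, hf.2.unique hg.2⟩

theorem hasLead_self {f : RatFunc ℝ} (hf : f ≠ 0) :
    HasLead f f.intDegree f.num.leadingCoeff := by
  have h := (hasLead_poly (RatFunc.num_ne_zero hf)).div (hasLead_poly f.denom_ne_zero)
  rw [RatFunc.num_div_denom, (RatFunc.monic_denom f).leadingCoeff, div_one] at h
  exact h

theorem HasLead.isMonicRat {f : RatFunc ℝ} {d : ℤ} (h : HasLead f d 1) : IsMonicRat f := by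
  rw [IsMonicRat, (RatFunc.monic_denom f).leadingCoeff]
  exact ((hasLead_self h.ne_zero).unique h).2

theorem HasLead.intDegree_eq {f : RatFunc ℝ} {d : ℤ} {c : ℝ} (h : HasLead f d c) :
    f.intDegree = d := ((hasLead_self h.ne_zero).unique h).1

theorem hasLead_xm : HasLead xm 1 1 := by
  have := hasLead_poly (X_sub_C_ne_zero (1 : ℝ))
  rw [natDegree_X_sub_C, leadingCoeff_X_sub_C] at this
  simpa using this

theorem hasLead_one_sub_X : HasLead (1 - RatFunc.X) 1 (-1) := by
  have := hasLead_xm.C_mul (k := -1) (by norm_num)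
  simpa using this

theorem hasLead_xp : HasLead xp 1 1 := by
  have := hasLead_poly (X_sub_C_ne_zero (-1 : ℝ))
  rw [natDegree_X_sub_C, leadingCoeff_X_sub_C] at this
  simpa using this

theorem HasLead.atInf_zero {f : RatFunc ℝ} {d : ℤ} {c : ℝ} (h : HasLead f d c) (hd : d < 0) :
    AtInf f 0 := by
  obtain ⟨n, hn⟩ : ∃ n : ℕ, d = -((n + 1 : ℕ) : ℤ) := ⟨(-d - 1).toNat, by omega⟩
  have := h.2.mul (atInf_inv_X_zpow_neg n)
  rw [mul_zero] at this
  convert this using 1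
  rw [hn, neg_neg, zpow_natCast, inv_pow, mul_assoc,
    mul_inv_cancel₀ (pow_ne_zero _ ratX_ne_zero), mul_one]

theorem atInf_X_mul_dlog_poly {A : ℝ[X]} (hA : A ≠ 0) :
    AtInf (RatFunc.X * dlog (ι A)) A.natDegree := by
  have hdeg : (X * derivative A).natDegree ≤ A.natDegree := by
    rcases Nat.eq_zero_or_pos A.natDegree with h | h
    · rw [derivative_eq_zero.2 h]; simp
    · refine (natDegree_mul_le).trans ?_
      have := natDegree_derivative_lt h.ne'
      simp; omega
  have := atInf_poly_div hA hdeg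
  rw [dlog, ratDeriv_algebraMap]
  convert this using 1
  · rw [map_mul, RatFunc.algebraMap_X, mul_div_assoc]
  · have hl := leadingCoeff_ne_zero.2 hA
    rcases h : A.natDegree with _ | n
    · simp
    · rw [coeff_X_mul, coeff_derivative, ← h, coeff_natDegree, h]
      field_simp; push_cast; ring

theorem HasLead.atInf_X_mul_dlog {f : RatFunc ℝ} {d : ℤ} {c : ℝ} (h : HasLead f d c) :
    AtInf (RatFunc.X * dlog f) d := by
  have hd := h.intDegree_eq
  have hn := RatFunc.num_ne_zero h.ne_zero
  have h1 := (atInf_X_mul_dlog_poly hn).sub (atInf_X_mul_dlog_poly f.denom_ne_zero)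
  rw [← mul_sub, ← dlog_div (RatFunc.algebraMap_ne_zero hn)
    (RatFunc.algebraMap_ne_zero f.denom_ne_zero), RatFunc.num_div_denom] at h1
  rw [← hd, RatFunc.intDegree]
  push_cast
  exact h1

/-- Since `x f' = f · (x f'/f)` and the second factor tends to the degree of `f`, the limit is `y`
times that degree. A non-zero degree is compatible with a finite limit only if `y = 0`. -/
theorem atInf_X_mul_ratDeriv {f : RatFunc ℝ} {y : ℝ} (h : AtInf f y) :
    AtInf (RatFunc.X * ∂ f) 0 := by
  rcases eq_or_ne f 0 with rfl | hf
  · simpa [ratDeriv_zero] using AtInf.const 0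
  have hl := hasLead_self hf
  have h1 := hl.atInf_X_mul_dlog
  have h2 : RatFunc.X * ∂ f = f * (RatFunc.X * dlog f) := by
    rw [ratDeriv_eq_mul_dlog hf]; ring
  rw [h2]
  have h3 := h.mul h1
  rcases eq_or_ne f.intDegree 0 with h0 | h0
  · rw [h0] at h3; simpa using h3
  · have hy : y = 0 := by
      rcases lt_or_gt_of_ne h0 with h4 | h4
      · exact h.unique (hl.atInf_zero h4)
      · have h5 := hl.inv.atInf_zero (by omega)
        have h6 := h.mul h5
        rw [mul_inv_cancel₀ hf, mul_zero] at h6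
        have := h6.unique (by simpa using AtInf.const 1)
        norm_num at this
    rw [hy, zero_mul] at h3; exact h3

/-- `w ~ d / x` at infinity implies `x ^ 2 w' → -d`. -/
theorem AtInf.sq_mul_ratDeriv {w : RatFunc ℝ} {d : ℝ} (h : AtInf (RatFunc.X * w) d) :
    AtInf (RatFunc.X ^ 2 * ∂ w) (-d) := by
  have h1 := (atInf_X_mul_ratDeriv h).sub h
  rw [ratDeriv_mul, ratDeriv_X, zero_sub] at h1
  convert h1 using 1
  ring

/-- A non-zero solution is a multiple of `(1 + x)^(-c)`. Comparing the behaviour of logarithmic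
derivatives at infinity, `-c` would be the degree of a rational function, hence an integer. This is
the main use of non-integrality. -/
theorem eq_zero_of_xp_ode {e : RatFunc ℝ} {c : ℝ} (hc : ∀ m : ℤ, c ≠ m)
    (h : xp * ∂ e + RatFunc.C c * e = 0) : e = 0 := by
  by_contra he
  have h1 := (hasLead_self he).atInf_X_mul_dlog
  have h2 : AtInf (RatFunc.X * dlog xp) 1 := by
    simpa using hasLead_xp.atInf_X_mul_dlog
  have h3 : RatFunc.X * dlog e = RatFunc.C (-c) * (RatFunc.X * dlog xp) := by
    have := X_add_one_ne_zero
    rw [dlog_xp, dlog]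
    field_simp
    rw [map_neg]
    linear_combination RatFunc.X * h
  rw [h3] at h1
  have h4 := h1.unique ((AtInf.const (-c)).mul h2)
  apply hc (-e.intDegree)
  push_cast
  linarith

theorem hasQRDegree_of_atInf {w : RatFunc ℝ} {d : ℝ} (h : AtInf (RatFunc.X * w) d) :
    HasQRDegree w d := by
  refine ⟨0, h.congr' ?_⟩
  filter_upwards [eventually_regularAt w] with x hx
  rw [((ValAt.var x).mul hx.valAt).eval_eq]; simp

/-- Two admissible polynomial parts differ by a polynomial whose product with `x` has a finite
limit, which forces the difference to vanish. -/
theorem HasQRDegree.unique {w : RatFunc ℝ} {d e : ℝ} (hd : HasQRDegree w d)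
    (he : HasQRDegree w e) : d = e := by
  obtain ⟨A, hA⟩ := hd
  obtain ⟨B, hB⟩ := he
  have h := hB.sub hA
  have h' : Filter.Tendsto (fun x : ℝ => (X * (A - B)).eval x) Filter.atTop (𝓝 (e - d)) := by
    refine h.congr fun x => ?_
    simp only [eval_mul, eval_X, eval_sub]; ring
  rw [Polynomial.tendsto_nhds_iff] at h'
  rcases eq_or_ne (A - B) 0 with h0 | h0
  · rw [h0] at h'; simp at h'; linarith
  · have h1 := h'.2
    rw [mul_comm, degree_mul_X, degree_eq_natDegree h0] at h1
    norm_cast at h1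

/-! ### Second order operators and their Riccati equations -/

/-- The coefficient `(α + 1) (x + 1) + (β + 1) (x - 1)`. -/
def QQ (α β : ℝ) : RatFunc ℝ :=
  RatFunc.C (α + 1) * (RatFunc.X + 1) + RatFunc.C (β + 1) * (RatFunc.X - 1)

/-- The operator `Trg(τ; α, β)`, in terms of `u = τ' / τ`. -/
def opU (u : RatFunc ℝ) (α β : ℝ) : DiffOp2 :=
  ⟨RatFunc.X ^ 2 - 1, QQ α β, 2 * (RatFunc.X ^ 2 - 1) * ∂ u + 2 * RatFunc.X * u⟩

theorem ratC_two : (RatFunc.C 2 : RatFunc ℝ) = 2 := map_ofNat _ 2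

theorem mem_Ric_opU {u w : RatFunc ℝ} {α β μ : ℝ} :
    w ∈ Ric (opU u α β) μ ↔ (RatFunc.X ^ 2 - 1) * (∂ w + w ^ 2) + QQ α β * w
      + (2 * (RatFunc.X ^ 2 - 1) * ∂ u + 2 * RatFunc.X * u) = RatFunc.C μ := Iff.rfl

theorem ratDeriv_dlog {f : RatFunc ℝ} (hf : f ≠ 0) :
    ∂ (dlog f) = ∂ (∂ f) / f - dlog f ^ 2 := by
  unfold dlog
  rw [ratDeriv_quot _ _ hf]
  field_simp

/-- Conjugation by `τ` cancels the terms in `η τ'/τ` and leaves `τ` only in the zeroth order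
coefficient `2 (x² - 1) u' + 2 x u`. Intermediate steps may therefore use a `u` that is not the
logarithmic derivative of a polynomial. -/
theorem Trg_eq_opU {τ : ℝ[X]} (hτ : τ ≠ 0) (α β : ℝ) :
    Trg τ α β = opU (dlog (ι τ)) α β := by
  have ht : ι τ ≠ 0 := RatFunc.algebraMap_ne_zero hτ
  have h1 := X_sub_one_ne_zero
  have h2 := X_add_one_ne_zero
  have h3 : eta α β * (RatFunc.X ^ 2 - 1) = QQ α β := by
    rw [eta, QQ]; field_simp; ring
  have h4 := ratDeriv_dlog ht
  unfold Trg Tng DiffOp2.gauge opU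
  simp only [DiffOp2.mk.injEq, true_and]
  rw [h4, ← h3]
  unfold dlog
  constructor
  · ring
  · field_simp; ring

theorem apply_opU_iff {u f : RatFunc ℝ} {α β μ : ℝ} (hf : f ≠ 0) :
    (opU u α β).apply f = RatFunc.C μ * f ↔ dlog f ∈ Ric (opU u α β) μ := by
  rw [mem_Ric_opU, ratDeriv_dlog hf, DiffOp2.apply]
  simp only [opU]
  unfold dlog
  constructor
  · intro h; field_simp; linear_combination f * h
  · intro h
    field_simp at h
    apply mul_left_cancel₀ hf
    linear_combination h

theorem xm_mul_xp : (RatFunc.X ^ 2 - 1 : RatFunc ℝ) = xm * xp := by ring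

theorem sq_X_sub_one_ne_zero : (RatFunc.X ^ 2 - 1 : RatFunc ℝ) ≠ 0 := by
  rw [xm_mul_xp]; exact mul_ne_zero X_sub_one_ne_zero X_add_one_ne_zero

theorem ratDeriv_C_div_xm (k : ℝ) :
    ∂ (RatFunc.C k / xm) = -RatFunc.C k / xm ^ 2 := by
  rw [ratDeriv_quot _ _ X_sub_one_ne_zero, ratDeriv_C, ratDeriv_sub, ratDeriv_X, ratDeriv_one]
  ring

theorem ratDeriv_C_div_xp (k : ℝ) :
    ∂ (RatFunc.C k / xp) = -RatFunc.C k / xp ^ 2 := by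
  rw [ratDeriv_quot _ _ X_add_one_ne_zero, ratDeriv_C, ratDeriv_add, ratDeriv_X, ratDeriv_one]
  ring

theorem ratDeriv_QQ (α β : ℝ) : ∂ (QQ α β) = RatFunc.C (α + β + 2) := by
  unfold QQ
  rw [ratDeriv_add, ratDeriv_C_mul, ratDeriv_C_mul, ratDeriv_add, ratDeriv_sub, ratDeriv_X,
    ratDeriv_one, add_zero, sub_zero, mul_one, mul_one, ← map_add]
  congr 1; ring

theorem ratDeriv_sq_X_sub_one : ∂ (RatFunc.X ^ 2 - 1) = 2 * RatFunc.X := by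
  rw [pow_two, ratDeriv_sub, ratDeriv_mul, ratDeriv_X, ratDeriv_one]; ring

/-- The indicial equation: after clearing one factor `x - 1` and setting `x = 1`, every term
containing `u` vanishes and `2 k (k + α) = 0` remains. -/
theorem exponent_one {u w v : RatFunc ℝ} {α β μ k : ℝ} (hu : RegularAt u 1)
    (hv : RegularAt v 1) (hw : w = RatFunc.C k / xm + v) (h : w ∈ Ric (opU u α β) μ) :
    k * (k + α) = 0 := by
  have h1 := X_sub_one_ne_zero
  rw [mem_Ric_opU, hw, ratDeriv_add, ratDeriv_C_div_xm, QQ] at h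
  have e : xp * (RatFunc.C k ^ 2 - RatFunc.C k + xm * (2 * RatFunc.C k * v
        + xm * (∂ v + v ^ 2)))
      + (RatFunc.C (α + 1) * xp + RatFunc.C (β + 1) * xm) * (RatFunc.C k + xm * v)
      + xm * (2 * (xm * xp) * ∂ u + 2 * RatFunc.X * u) = RatFunc.C μ * xm := by
    field_simp at h
    apply mul_left_cancel₀ h1
    linear_combination h
  have two : ValAt 1 (2 : RatFunc ℝ) 2 := by
    rw [← ratC_two]; exact ValAt.const 1 2
  have hk := ValAt.const 1 k
  have hL := ((valAt_xp.mul (((hk.pow 2).sub hk).add (valAt_xm.mul (((two.mul hk).mul hv.valAt).add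
    (valAt_xm.mul (hv.ratDeriv.valAt.add (hv.valAt.pow 2))))))).add
    ((((ValAt.const 1 (α + 1)).mul valAt_xp).add ((ValAt.const 1 (β + 1)).mul valAt_xm)).mul
      (hk.add (valAt_xm.mul hv.valAt)))).add
    (valAt_xm.mul (((two.mul (valAt_xm.mul valAt_xp)).mul hu.ratDeriv.valAt).add
      ((two.mul (ValAt.var 1)).mul hu.valAt)))
  rw [e] at hL
  have := hL.unique ((ValAt.const 1 μ).mul valAt_xm)
  linarith

theorem exponent_neg_one {u w v : RatFunc ℝ} {α β μ k : ℝ} (hu : RegularAt u (-1))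
    (hv : RegularAt v (-1)) (hw : w = RatFunc.C k / xp + v) (h : w ∈ Ric (opU u α β) μ) :
    k * (k + β) = 0 := by
  have h1 := X_add_one_ne_zero
  rw [mem_Ric_opU, hw, ratDeriv_add, ratDeriv_C_div_xp, QQ] at h
  have e : xm * (RatFunc.C k ^ 2 - RatFunc.C k + xp * (2 * RatFunc.C k * v
        + xp * (∂ v + v ^ 2)))
      + (RatFunc.C (α + 1) * xp + RatFunc.C (β + 1) * xm) * (RatFunc.C k + xp * v)
      + xp * (2 * (xm * xp) * ∂ u + 2 * RatFunc.X * u) = RatFunc.C μ * xp := by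
    field_simp at h
    apply mul_left_cancel₀ h1
    linear_combination h
  have two : ValAt (-1) (2 : RatFunc ℝ) 2 := by
    rw [← ratC_two]; exact ValAt.const (-1) 2
  have hk := ValAt.const (-1) k
  have hL := ((valAt_neg_xm.mul (((hk.pow 2).sub hk).add (valAt_neg_xp.mul
    (((two.mul hk).mul hv.valAt).add
    (valAt_neg_xp.mul (hv.ratDeriv.valAt.add (hv.valAt.pow 2))))))).add
    ((((ValAt.const (-1) (α + 1)).mul valAt_neg_xp).add
      ((ValAt.const (-1) (β + 1)).mul valAt_neg_xm)).mul
      (hk.add (valAt_neg_xp.mul hv.valAt)))).add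
    (valAt_neg_xp.mul (((two.mul (valAt_neg_xm.mul valAt_neg_xp)).mul hu.ratDeriv.valAt).add
      ((two.mul (ValAt.var (-1))).mul hu.valAt)))
  rw [e] at hL
  have := hL.unique ((ValAt.const (-1) μ).mul valAt_neg_xp)
  linarith

/-- The indicial equation at infinity. With `u ~ M/x` the two terms of the zeroth order coefficient
tend to `-2M` and `2M` and cancel, so the degree of `τ` does not enter. -/
theorem degree_of_mem_Ric {u w : RatFunc ℝ} {α β μ d M : ℝ} (hu : AtInf (RatFunc.X * u) M)
    (hw : AtInf (RatFunc.X * w) d) (h : w ∈ Ric (opU u α β) μ) :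
    d * (d + α + β + 1) = μ := by
  have hX := ratX_ne_zero
  rw [mem_Ric_opU, QQ] at h
  have e : (1 - RatFunc.X⁻¹ * RatFunc.X⁻¹) * (RatFunc.X ^ 2 * ∂ w
        + (RatFunc.X * w) * (RatFunc.X * w))
      + (RatFunc.C (α + 1) * (1 + RatFunc.X⁻¹) + RatFunc.C (β + 1) * (1 - RatFunc.X⁻¹))
        * (RatFunc.X * w)
      + (RatFunc.C 2 * ((1 - RatFunc.X⁻¹ * RatFunc.X⁻¹) * (RatFunc.X ^ 2 * ∂ u))
        + RatFunc.C 2 * (RatFunc.X * u)) = RatFunc.C μ := by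
    rw [← h, ratC_two]
    field_simp
  have one : AtInf 1 1 := by simpa using AtInf.const 1
  have hI := atInf_inv_X
  have hL := (((one.sub (hI.mul hI)).mul (hw.sq_mul_ratDeriv.add (hw.mul hw))).add
    ((((AtInf.const (α + 1)).mul (one.add hI)).add ((AtInf.const (β + 1)).mul (one.sub hI))).mul
      hw)).add (((AtInf.const 2).mul ((one.sub (hI.mul hI)).mul hu.sq_mul_ratDeriv)).add
        ((AtInf.const 2).mul hu))
  rw [e] at hL
  have := hL.unique (AtInf.const μ)
  linarith

/-! ### Gauge transformations -/

theorem gauge_xp {u w : RatFunc ℝ} {α β μ : ℝ} : w ∈ Ric (opU u α β) μ ↔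
    w + RatFunc.C β / xp ∈ Ric (opU u α (-β)) (μ + β * (α + 1)) := by
  have h1 := X_add_one_ne_zero
  rw [mem_Ric_opU, mem_Ric_opU, ratDeriv_add, ratDeriv_C_div_xp, ← sub_eq_zero,
    ← sub_eq_zero (b := RatFunc.C (μ + _))]
  refine Eq.congr_left ?_
  simp only [QQ, map_add, map_mul, map_neg, map_one]
  field_simp
  ring

/-- Conjugation by `x - 1`, absorbing the singular part into `u`. -/
theorem gauge_mul_xm {u w : RatFunc ℝ} {α β μ : ℝ} :
    w - 1 / xm ∈ Ric (opU u α β) μ ↔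
      w ∈ Ric (opU (u + RatFunc.C (α - 1) / xm) (α - 2) β) (μ + α + β) := by
  have h1 := X_sub_one_ne_zero
  have h2 : ∂ (1 / xm) = -1 / xm ^ 2 := by simpa using ratDeriv_C_div_xm 1
  rw [mem_Ric_opU, mem_Ric_opU, ratDeriv_add, ratDeriv_sub, ratDeriv_C_div_xm, h2, ← sub_eq_zero,
    ← sub_eq_zero (b := RatFunc.C (μ + _ + _))]
  refine Eq.congr_left ?_
  have h3 : (RatFunc.C (α - 2) : RatFunc ℝ) = RatFunc.C α - 2 := by
    rw [map_sub, ratC_two]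
  simp only [QQ, map_add, map_sub, map_one, ratC_two]
  field_simp
  ring

/-! ### The Darboux transformation of Riccati equations -/

/-- Subtracting the seed's equation removes `u`. -/
theorem mem_Ric_iff_sub {u w w₀ : RatFunc ℝ} {α β μ μ₀ : ℝ} (h₀ : w₀ ∈ Ric (opU u α β) μ₀) :
    w ∈ Ric (opU u α β) μ ↔ (RatFunc.X ^ 2 - 1) * (∂ (w - w₀) + (w - w₀) ^ 2
      + 2 * w₀ * (w - w₀)) + QQ α β * (w - w₀) = RatFunc.C (μ - μ₀) := by
  rw [mem_Ric_opU] at *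
  rw [ratDeriv_sub, map_sub]
  constructor
  · intro h; linear_combination h - h₀
  · intro h; linear_combination h + h₀

/-- If `w = f'/f`, the quantity `V = (x² - 1)(w + w₀) + Q` is `(B f)/f` for the companion first
order operator `B`. The transformed Riccati equation is exactly the relation that `A B f` is a
multiple of `f`. -/
theorem mem_Ric_darboux_iff {u w w₀ : RatFunc ℝ} {α β μ μ₀ : ℝ}
    (h₀ : w₀ ∈ Ric (opU u α β) μ₀) :
    w ∈ Ric (opU (u + w₀) (α + 1) (β + 1)) (μ - (α + β + 2)) ↔
      ∂ ((RatFunc.X ^ 2 - 1) * (w + w₀) + QQ α β)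
        = (w₀ - w) * ((RatFunc.X ^ 2 - 1) * (w + w₀) + QQ α β) + RatFunc.C (μ - μ₀) := by
  rw [mem_Ric_opU] at *
  have hQ : QQ (α + 1) (β + 1) = QQ α β + 2 * RatFunc.X := by
    simp only [QQ, map_add, map_one]; ring
  rw [hQ, ratDeriv_add u, ratDeriv_add _ (QQ α β), ratDeriv_mul, ratDeriv_sq_X_sub_one,
    ratDeriv_QQ, ratDeriv_add, map_sub, map_sub]
  constructor
  · intro h; linear_combination h - h₀
  · intro h; linear_combination h + h₀

theorem darboux_ne {u w w₀ : RatFunc ℝ} {α β μ μ₀ : ℝ} (h₀ : w₀ ∈ Ric (opU u α β) μ₀)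
    (hμ : μ ≠ μ₀) (h : w ∈ Ric (opU u α β) μ) : w - w₀ ≠ 0 := by
  intro h1
  rw [mem_Ric_iff_sub h₀, h1, ratDeriv_zero] at h
  have : RatFunc.C (μ - μ₀) = (0 : RatFunc ℝ) := by rw [← h]; ring
  rw [map_eq_zero] at this
  exact hμ (sub_eq_zero.1 this)

/-- An eigenfunction `f` is sent to `f' - w₀ f = f (w - w₀)`, which explains the added logarithmic
derivative. -/
theorem darboux_mem {u w w₀ : RatFunc ℝ} {α β μ μ₀ : ℝ} (h₀ : w₀ ∈ Ric (opU u α β) μ₀)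
    (hμ : μ ≠ μ₀) (h : w ∈ Ric (opU u α β) μ) :
    w + dlog (w - w₀) ∈ Ric (opU (u + w₀) (α + 1) (β + 1)) (μ - (α + β + 2)) := by
  have hv := darboux_ne h₀ hμ h
  rw [mem_Ric_iff_sub h₀] at h
  rw [mem_Ric_darboux_iff h₀]
  obtain ⟨v, rfl⟩ : ∃ v, w = w₀ + v := ⟨w - w₀, by ring⟩
  rw [add_sub_cancel_left] at *
  have e : (RatFunc.X ^ 2 - 1) * (w₀ + v + dlog v + w₀) + QQ α β = RatFunc.C (μ - μ₀) / v := by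
    rw [← h]; unfold dlog; field_simp; ring
  rw [e, ratDeriv_quot _ _ hv, ratDeriv_C]
  unfold dlog
  field_simp
  ring

/-- The companion operator inverts the transformation up to the factor `μ - μ₀`: the preimage `y` is
found from `(y - w₀) V = μ - μ₀`, which also requires `V ≠ 0`. -/
theorem darboux_surj {u w w₀ : RatFunc ℝ} {α β μ μ₀ : ℝ} (h₀ : w₀ ∈ Ric (opU u α β) μ₀)
    (hμ : μ ≠ μ₀) (h : w ∈ Ric (opU (u + w₀) (α + 1) (β + 1)) (μ - (α + β + 2))) :
    (RatFunc.X ^ 2 - 1) * (w + w₀) + QQ α β ≠ 0 ∧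
    ∃ y ∈ Ric (opU u α β) μ, y - w₀ = RatFunc.C (μ - μ₀)
        / ((RatFunc.X ^ 2 - 1) * (w + w₀) + QQ α β) ∧ w = y + dlog (y - w₀) := by
  rw [mem_Ric_darboux_iff h₀] at h
  have hδ : (RatFunc.C (μ - μ₀) : RatFunc ℝ) ≠ 0 := by
    rw [_root_.map_ne_zero]; exact sub_ne_zero.2 hμ
  set V := (RatFunc.X ^ 2 - 1) * (w + w₀) + QQ α β with hV
  have hV0 : V ≠ 0 := by
    intro h1
    rw [h1, ratDeriv_zero, mul_zero, zero_add] at h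
    exact hδ h.symm
  refine ⟨hV0, w₀ + RatFunc.C (μ - μ₀) / V, ?_, by ring, ?_⟩
  · rw [mem_Ric_iff_sub h₀, add_sub_cancel_left, ratDeriv_quot _ _ hV0, ratDeriv_C, h]
    field_simp
    linear_combination (-RatFunc.C (μ - μ₀)) * hV
  · rw [add_sub_cancel_left, dlog_div hδ hV0, dlog_C]
    unfold dlog
    rw [h]
    field_simp
    ring

/-- The transformed Riccati equation at the eigenvalue of the seed. -/
theorem mem_Ric_darboux_self {u w w₀ : RatFunc ℝ} {α β μ₀ : ℝ}
    (h₀ : w₀ ∈ Ric (opU u α β) μ₀) :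
    w ∈ Ric (opU (u + w₀) (α + 1) (β + 1)) (μ₀ - (α + β + 2)) ↔
      w = -w₀ - QQ α β / (RatFunc.X ^ 2 - 1) ∨
      ∃ z, (RatFunc.X ^ 2 - 1) * ∂ z + (2 * (RatFunc.X ^ 2 - 1) * w₀ + QQ α β) * z = 1 ∧
        w = w₀ + dlog z := by
  have hP := sq_X_sub_one_ne_zero
  rw [mem_Ric_darboux_iff h₀, sub_self, map_zero, add_zero]
  constructor
  · intro h
    set V := (RatFunc.X ^ 2 - 1) * (w + w₀) + QQ α β with hV
    -- The equation is now `V' = (w₀ - w) V`. The zero solution gives the reciprocal eigenfunction;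
    -- otherwise `V⁻¹` satisfies a linear equation.
    rcases eq_or_ne V 0 with h0 | h0
    · left
      rw [h0] at hV
      field_simp
      linear_combination -hV
    · right
      refine ⟨V⁻¹, ?_, ?_⟩
      · rw [ratDeriv_inv, h]
        field_simp
        linear_combination -hV
      · rw [dlog_inv, dlog, h]
        field_simp; ring
  · rintro (rfl | ⟨z, hz, rfl⟩)
    · have : (RatFunc.X ^ 2 - 1) * (-w₀ - QQ α β / (RatFunc.X ^ 2 - 1) + w₀) + QQ α β = 0 := by
        field_simp; ring
      rw [this, ratDeriv_zero, mul_zero]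
    · have hz0 : z ≠ 0 := by
        rintro rfl
        rw [ratDeriv_zero, mul_zero, mul_zero, add_zero] at hz
        exact zero_ne_one hz
      have : (RatFunc.X ^ 2 - 1) * (w₀ + dlog z + w₀) + QQ α β = z⁻¹ := by
        unfold dlog
        field_simp
        linear_combination hz
      rw [this, ratDeriv_inv]
      unfold dlog
      field_simp
      ring

/-! ### Residues at `1` -/

/-- `f` has at most a simple pole at `1`, with residue `k`. -/
def HasRes (f : RatFunc ℝ) (k : ℝ) : Prop :=
  ∃ v, RegularAt v 1 ∧ f = RatFunc.C k / xm + v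

theorem HasRes.add {f g : RatFunc ℝ} {k l : ℝ} (hf : HasRes f k) (hg : HasRes g l) :
    HasRes (f + g) (k + l) := by
  obtain ⟨v, hv, rfl⟩ := hf
  obtain ⟨w, hw, rfl⟩ := hg
  exact ⟨v + w, hv.add hw, by rw [map_add]; ring⟩

theorem HasRes.neg {f : RatFunc ℝ} {k : ℝ} (hf : HasRes f k) : HasRes (-f) (-k) := by
  obtain ⟨v, hv, rfl⟩ := hf
  exact ⟨-v, hv.neg, by rw [map_neg]; ring⟩

theorem HasRes.sub {f g : RatFunc ℝ} {k l : ℝ} (hf : HasRes f k) (hg : HasRes g l) :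
    HasRes (f - g) (k - l) := by
  simpa [sub_eq_add_neg] using hf.add hg.neg

theorem RegularAt.hasRes {f : RatFunc ℝ} (hf : RegularAt f 1) : HasRes f 0 :=
  ⟨f, hf, by simp⟩

theorem HasRes.regularAt {f : RatFunc ℝ} (hf : HasRes f 0) : RegularAt f 1 := by
  obtain ⟨v, hv, rfl⟩ := hf
  simpa using hv

theorem hasRes_C_div (k : ℝ) : HasRes (RatFunc.C k / xm) k :=
  ⟨0, (ValAt.zero 1).regularAt, by simp⟩

theorem HasRes.unique {f : RatFunc ℝ} {k l : ℝ} (hf : HasRes f k) (hg : HasRes f l) : k = l := by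
  obtain ⟨v, hv, rfl⟩ := hf
  obtain ⟨w, hw, h⟩ := hg
  have h1 := X_sub_one_ne_zero
  have h2 : RatFunc.C k + xm * v = RatFunc.C l + xm * w := by
    field_simp at h; linear_combination h
  have h3 := (ValAt.const 1 k).add (valAt_xm.mul hv.valAt)
  rw [h2] at h3
  have := h3.unique ((ValAt.const 1 l).add (valAt_xm.mul hw.valAt))
  simpa using this

theorem HasRes.regularAt_iff {f : RatFunc ℝ} {k : ℝ} (hf : HasRes f k) :
    RegularAt f 1 ↔ k = 0 := by
  constructor
  · intro h; exact hf.unique h.hasRes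
  · rintro rfl; exact hf.regularAt

theorem exists_order_one {f : RatFunc ℝ} (hf : f ≠ 0) :
    ∃ (k : ℤ) (g : RatFunc ℝ) (y : ℝ), y ≠ 0 ∧ ValAt 1 g y ∧ f = xm ^ k * g := by
  simpa using exists_order 1 hf

theorem exists_order_neg_one {f : RatFunc ℝ} (hf : f ≠ 0) :
    ∃ (k : ℤ) (g : RatFunc ℝ) (y : ℝ), y ≠ 0 ∧ ValAt (-1) g y ∧ f = xp ^ k * g := by
  simpa using exists_order (-1) hf

theorem hasRes_dlog_of_eq {f g : RatFunc ℝ} {k : ℤ} {y : ℝ} (hy : y ≠ 0) (hg : ValAt 1 g y)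
    (hf : f = xm ^ k * g) : HasRes (dlog f) k := by
  have hg0 : g ≠ 0 := by
    rintro rfl; exact hy (hg.unique (ValAt.zero 1))
  refine ⟨dlog g, hg.dlog_regularAt hy, ?_⟩
  rw [hf, dlog_mul (zpow_ne_zero _ X_sub_one_ne_zero) hg0, dlog_zpow, dlog_xm]
  simp [div_eq_mul_inv]

theorem exists_hasRes_dlog {f : RatFunc ℝ} (hf : f ≠ 0) : ∃ k : ℤ, HasRes (dlog f) k := by
  obtain ⟨k, g, y, hy, hg, h⟩ := exists_order_one hf
  exact ⟨k, hasRes_dlog_of_eq hy hg h⟩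

theorem ValAt.zpow_xm_mul {g : RatFunc ℝ} {y : ℝ} (hg : ValAt 1 g y) (k : ℕ) :
    ValAt 1 (xm ^ (k : ℤ) * g) (0 ^ k * y) := by
  rw [zpow_natCast]; exact (valAt_xm.pow k).mul hg

theorem order_nonneg_of_regularAt {f g : RatFunc ℝ} {k : ℤ} {y : ℝ} (hy : y ≠ 0)
    (hg : ValAt 1 g y) (hf : f = xm ^ k * g) (hr : RegularAt f 1) : 0 ≤ k := by
  by_contra hk
  obtain ⟨n, hn⟩ : ∃ n : ℕ, -k = (n + 1 : ℕ) := ⟨(-k - 1).toNat, by omega⟩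
  have h1 : g = xm ^ ((n + 1 : ℕ) : ℤ) * f := by
    rw [hf, ← mul_assoc, ← zpow_add₀ X_sub_one_ne_zero, ← hn, neg_add_cancel, zpow_zero, one_mul]
  have h2 := hr.valAt.zpow_xm_mul (n + 1)
  rw [← h1] at h2
  exact hy (by simpa using hg.unique h2)

theorem RegularAt.exists_hasRes_dlog {f : RatFunc ℝ} (hf : f ≠ 0) (hr : RegularAt f 1) :
    ∃ k : ℕ, HasRes (dlog f) k := by
  obtain ⟨k, g, y, hy, hg, h⟩ := exists_order_one hf
  obtain ⟨n, rfl⟩ := Int.eq_ofNat_of_zero_le (order_nonneg_of_regularAt hy hg h hr)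
  exact ⟨n, by simpa using hasRes_dlog_of_eq hy hg h⟩

/-- The logarithmic derivative of a function with a simple pole has residue `-1`. -/
theorem HasRes.hasRes_dlog {f : RatFunc ℝ} {k : ℝ} (hf : HasRes f k) (hk : k ≠ 0) :
    HasRes (dlog f) (-1) := by
  obtain ⟨v, hv, h⟩ := hf
  have h1 := (ValAt.const 1 k).add (valAt_xm.mul hv.valAt)
  have h2 : f = xm ^ (-1 : ℤ) * (RatFunc.C k + xm * v) := by
    have := X_sub_one_ne_zero
    rw [h, zpow_neg_one]; field_simp
  have := hasRes_dlog_of_eq (by simpa using hk) h1 h2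
  simpa using this

/-! ### Labels and their behaviour under Darboux transformations -/

/-- `w` is the logarithmic derivative of a rational function. -/
def IsInt (w : RatFunc ℝ) : Prop := ∃ f, f ≠ 0 ∧ w = dlog f

/-- `w` is the logarithmic derivative of `(1 + x) ^ (-β)` times a rational function. -/
def IsTwisted (β : ℝ) (w : RatFunc ℝ) : Prop := ∃ f, f ≠ 0 ∧ w = dlog f - RatFunc.C β / xp

/-- Dividing the two representations would make a constant multiple of `(1 + x)^(-β)` rational. -/
theorem IsInt.not_isTwisted {w : RatFunc ℝ} {β : ℝ} (hβ : ∀ m : ℤ, β ≠ m) (h : IsInt w) :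
    ¬ IsTwisted β w := by
  rintro ⟨g, hg, h2⟩
  obtain ⟨f, hf, h1⟩ := h
  have h3 : dlog (f / g) = -(RatFunc.C β / xp) := by
    rw [dlog_div hf hg]; linear_combination h2 - h1
  have h4 : xp * ∂ (f / g) + RatFunc.C β * (f / g) = 0 := by
    have := X_add_one_ne_zero
    rw [ratDeriv_eq_mul_dlog (div_ne_zero hf hg), h3]
    field_simp
    ring
  exact div_ne_zero hf hg (eq_zero_of_xp_ode hβ h4)

theorem regularAt_C_div_xp (β : ℝ) : RegularAt (RatFunc.C β / xp) 1 :=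
  ((ValAt.const 1 β).div valAt_xp two_ne_zero).regularAt

theorem IsInt.exists_hasRes {w : RatFunc ℝ} (h : IsInt w) : ∃ k : ℤ, HasRes w k := by
  obtain ⟨f, hf, rfl⟩ := h
  exact exists_hasRes_dlog hf

theorem IsTwisted.exists_hasRes {β : ℝ} {w : RatFunc ℝ} (h : IsTwisted β w) :
    ∃ k : ℤ, HasRes w k := by
  obtain ⟨f, hf, rfl⟩ := h
  obtain ⟨k, hk⟩ := exists_hasRes_dlog hf
  exact ⟨k, by simpa using hk.sub (regularAt_C_div_xp β).hasRes⟩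

theorem HasRes.exponent {u w : RatFunc ℝ} {α β μ k : ℝ} (hu : RegularAt u 1)
    (h : HasRes w k) (hw : w ∈ Ric (opU u α β) μ) : k = 0 ∨ k = -α := by
  obtain ⟨v, hv, h⟩ := h
  rcases mul_eq_zero.1 (exponent_one hu hv h hw) with h | h
  · exact Or.inl h
  · right; linarith

/-- The possible sets of quasi-rational eigenfunctions at an eigenvalue, in class A. -/
inductive Lab
  | circ
  | ast
  | minus

/-- The meaning of the class A labels. -/
def LabOK (β : ℝ) (S : Set (RatFunc ℝ)) : Lab → Prop
  | .circ => ∃ w, S = {w} ∧ IsInt w ∧ RegularAt w 1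
  | .ast => ∃ v w, S = {v, w} ∧ (IsTwisted β v ∧ ¬ RegularAt v 1) ∧ (IsInt w ∧ ¬ RegularAt w 1)
  | .minus => ∃ w, S = {w} ∧ IsTwisted β w ∧ RegularAt w 1

theorem LabOK.image {β : ℝ} {S : Set (RatFunc ℝ)} {l : Lab} (h : LabOK β S l)
    (φ : RatFunc ℝ → RatFunc ℝ) (h1 : ∀ w ∈ S, IsInt w → IsInt (φ w))
    (h2 : ∀ w ∈ S, IsTwisted β w → IsTwisted (β + 1) (φ w))
    (h3 : ∀ w ∈ S, (IsInt w ∨ IsTwisted β w) → (RegularAt (φ w) 1 ↔ RegularAt w 1)) :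
    LabOK (β + 1) (φ '' S) l := by
  rcases l with _ | _ | _
  · obtain ⟨w, rfl, hw, hr⟩ := h
    exact ⟨φ w, Set.image_singleton, h1 w rfl hw, (h3 w rfl (Or.inl hw)).2 hr⟩
  · obtain ⟨v, w, rfl, ⟨hv, hvr⟩, hw, hwr⟩ := h
    exact ⟨φ v, φ w, Set.image_pair _ _ _, ⟨h2 v (by simp) hv,
      fun h => hvr ((h3 v (by simp) (Or.inr hv)).1 h)⟩, h1 w (by simp) hw,
      fun h => hwr ((h3 w (by simp) (Or.inl hw)).1 h)⟩
  · obtain ⟨w, rfl, hw, hr⟩ := h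
    exact ⟨φ w, Set.image_singleton, h2 w rfl hw, (h3 w rfl (Or.inr hw)).2 hr⟩

/-- The quasi-rational spectrum of `opU u α β` consists of the numbers `λ₁(n - s)`, `n ∈ ℤ`, with
the label `lab n`. -/
structure LabelState (u : RatFunc ℝ) (α β : ℝ) (s : ℤ) (lab : ℤ → Lab) : Prop where
  ok : ∀ n : ℤ, LabOK β (Ric (opU u α β) (lam α β .one (n - s))) (lab n)
  empty : ∀ μ : ℝ, (∀ n : ℤ, μ ≠ lam α β .one (n - s)) → Ric (opU u α β) μ = ∅

theorem lam_one_inj {α : ℤ} {β : ℝ} (hβ : ∀ m : ℤ, β ≠ m) {m n : ℤ}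
    (h : lam α β .one m = lam α β .one n) : m = n := by
  simp only [lam] at h
  have h1 : ((m : ℝ) - n) * (m + n + α + β + 1) = 0 := by linear_combination h
  rcases mul_eq_zero.1 h1 with h2 | h2
  · exact_mod_cast sub_eq_zero.1 h2
  · exact absurd (by push_cast; linarith) (hβ (-m - n - α - 1))

theorem isInt_darboux {w w₀ : RatFunc ℝ} (h : w - w₀ ≠ 0) (hw : IsInt w) :
    IsInt (w + dlog (w - w₀)) := by
  obtain ⟨f, hf, h1⟩ := hw
  exact ⟨f * (w - w₀), mul_ne_zero hf h, by rw [dlog_mul hf h, ← h1]⟩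

theorem isTwisted_darboux {β : ℝ} {w w₀ : RatFunc ℝ} (h : w - w₀ ≠ 0) (hw : IsTwisted β w) :
    IsTwisted (β + 1) (w + dlog (w - w₀)) := by
  obtain ⟨f, hf, h1⟩ := hw
  refine ⟨f * (w - w₀) * xp, mul_ne_zero (mul_ne_zero hf h) X_add_one_ne_zero, ?_⟩
  rw [dlog_mul (mul_ne_zero hf h) X_add_one_ne_zero, dlog_mul hf h, dlog_xp, map_add, map_one]
  linear_combination h1

theorem isInt_add_inv {w : RatFunc ℝ} (hw : IsInt w) : IsInt (w + 1 / xm) := by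
  obtain ⟨f, hf, rfl⟩ := hw
  exact ⟨f * xm, mul_ne_zero hf X_sub_one_ne_zero, by
    rw [dlog_mul hf X_sub_one_ne_zero, dlog_xm]⟩

theorem isTwisted_add_inv {β : ℝ} {w : RatFunc ℝ} (hw : IsTwisted β w) :
    IsTwisted β (w + 1 / xm) := by
  obtain ⟨f, hf, rfl⟩ := hw
  exact ⟨f * xm, mul_ne_zero hf X_sub_one_ne_zero, by
    rw [dlog_mul hf X_sub_one_ne_zero, dlog_xm]; ring⟩

theorem hasRes_inv_xm : HasRes (1 / xm) 1 := by simpa using hasRes_C_div 1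

theorem QQ_div (α β : ℝ) : QQ α β / (RatFunc.X ^ 2 - 1)
    = RatFunc.C (α + 1) / xm + RatFunc.C (β + 1) / xp := by
  have h1 := X_sub_one_ne_zero
  have h2 := X_add_one_ne_zero
  rw [xm_mul_xp, QQ]
  field_simp

/-- The set of rational solutions of the Riccati equation after a Darboux transformation, away from
the eigenvalue of the seed. -/
theorem Ric_darboux {u w₀ : RatFunc ℝ} {α β μ μ₀ : ℝ} (h₀ : w₀ ∈ Ric (opU u α β) μ₀)
    (hμ : μ ≠ μ₀) :
    Ric (opU (u + w₀) (α + 1) (β + 1)) (μ - (α + β + 2)) =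
      (fun w => w + dlog (w - w₀)) '' Ric (opU u α β) μ := by
  ext w
  constructor
  · intro h
    obtain ⟨-, y, hy, -, h1⟩ := darboux_surj h₀ hμ h
    exact ⟨y, hy, h1.symm⟩
  · rintro ⟨y, hy, rfl⟩
    exact darboux_mem h₀ hμ hy

/-- The Darboux transformation with a regular seed preserves regularity at `1`. -/
theorem regularAt_darboux_iff {u w w₀ : RatFunc ℝ} {α β μ μ₀ : ℝ} {k : ℝ} (hα : 0 ≤ α)
    (hu : RegularAt u 1) (h₀ : w₀ ∈ Ric (opU u α β) μ₀) (hr : RegularAt w₀ 1) (hμ : μ ≠ μ₀)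
    (hw : w ∈ Ric (opU u α β) μ) (hk : HasRes w k) :
    RegularAt (w + dlog (w - w₀)) 1 ↔ RegularAt w 1 := by
  have hne := darboux_ne h₀ hμ hw
  have hm := darboux_mem h₀ hμ hw
  rcases eq_or_ne k 0 with rfl | hk0
  · have hwr := hk.regularAt
    refine iff_of_true ?_ hwr
    -- The residue gained is an order of vanishing `m ≥ 0`, while the exponents of the new operator
    -- at `1` are `0` and `-(α + 1)`; hence `m = 0`.
    obtain ⟨m, hm'⟩ := (hwr.sub hr).exists_hasRes_dlog hne
    have h1 := hk.add hm'
    rw [zero_add] at h1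
    have h2 := h1.exponent (hu.add hr) hm
    rw [h1.regularAt_iff]
    rcases h2 with h2 | h2
    · exact h2
    · have : (0 : ℝ) ≤ m := Nat.cast_nonneg m
      linarith
  · refine iff_of_false ?_ (by rwa [hk.regularAt_iff])
    have hka := (hk.exponent hu hw).resolve_left hk0
    have h1 : HasRes (w - w₀) k := by simpa using hk.sub hr.hasRes
    have h2 := hk.add (h1.hasRes_dlog hk0)
    rw [h2.regularAt_iff]
    linarith

/-- The corresponding statement for a seed that is singular at `1`. -/
theorem regularAt_darboux_iff_of_pole {u w w₀ : RatFunc ℝ} {α β μ μ₀ : ℝ} {k : ℝ} (hα : 0 < α)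
    (hu : RegularAt u 1) (h₀ : w₀ ∈ Ric (opU u α β) μ₀) (hr : HasRes w₀ (-α)) (hμ : μ ≠ μ₀)
    (hw : w ∈ Ric (opU u α β) μ) (hk : HasRes w k) :
    RegularAt (w + dlog (w - w₀) + 1 / xm) 1 ↔ RegularAt w 1 := by
  have hne := darboux_ne h₀ hμ hw
  rcases eq_or_ne k 0 with rfl | hk0
  · refine iff_of_true ?_ hk.regularAt
    have h1 := hk.sub hr
    have h2 := (hk.add (h1.hasRes_dlog (by linarith))).add hasRes_inv_xm
    rw [h2.regularAt_iff]; ring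
  · refine iff_of_false (fun hreg => ?_) (by rwa [hk.regularAt_iff])
    have hka := (hk.exponent hu hw).resolve_left hk0
    subst hka
    have hvr : RegularAt (w - w₀) 1 := by
      have := hk.sub hr
      rw [sub_self] at this
      exact this.regularAt
    -- The poles of `w` and `w₀` cancel in `w - w₀`. If the transformed solution were regular, the
    -- second factor would vanish at `1`, although the product is the non-zero constant `μ - μ₀`.
    have e : (w - w₀) * ((RatFunc.X ^ 2 - 1) * (w + dlog (w - w₀) + w₀) + QQ α β)
        = RatFunc.C (μ - μ₀) := by
      rw [← (mem_Ric_iff_sub h₀).1 hw]; unfold dlog; field_simp; ring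
    set W := w + dlog (w - w₀) + 1 / xm with hW
    obtain ⟨v, hv, hv'⟩ := hr
    have h1 := X_sub_one_ne_zero
    have e2 : (RatFunc.X ^ 2 - 1) * (w + dlog (w - w₀) + w₀) + QQ α β
        = xp * (xm * W - 1 + (RatFunc.C (-α) + xm * v))
          + (RatFunc.C (α + 1) * xp + RatFunc.C (β + 1) * xm) := by
      rw [hW, hv', xm_mul_xp, QQ]; field_simp; ring
    have h3 : ValAt 1 ((RatFunc.X ^ 2 - 1) * (w + dlog (w - w₀) + w₀) + QQ α β) 0 := by
      rw [e2]
      have := (valAt_xp.mul (((valAt_xm.mul hreg.valAt).sub (ValAt.one 1)).add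
        ((ValAt.const 1 (-α)).add (valAt_xm.mul hv.valAt)))).add
        (((ValAt.const 1 (α + 1)).mul valAt_xp).add ((ValAt.const 1 (β + 1)).mul valAt_xm))
      convert this using 1
      ring
    have h4 := hvr.valAt.mul h3
    rw [e, mul_zero] at h4
    exact hμ (sub_eq_zero.1 ((ValAt.const 1 _).unique h4))

/-- If the difference `y - z` were non-zero, then `e = f² (y - z)(x - 1)^(α + 1)` would be a
non-zero solution of `(x + 1) e' + (β + 1) e = 0`, contradicting `β ∉ ℤ`. -/
theorem darboux_inhom_unique {f y z : RatFunc ℝ} {α : ℕ} {β : ℝ} (hβ : ∀ m : ℤ, β ≠ m)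
    (hf : f ≠ 0)
    (hy : (RatFunc.X ^ 2 - 1) * ∂ y + (2 * (RatFunc.X ^ 2 - 1) * dlog f + QQ α β) * y = 1)
    (hz : (RatFunc.X ^ 2 - 1) * ∂ z + (2 * (RatFunc.X ^ 2 - 1) * dlog f + QQ α β) * z = 1) :
    y = z := by
  by_contra hne
  have hd : y - z ≠ 0 := sub_ne_zero.2 hne
  have h1 := X_sub_one_ne_zero
  have h2 := X_add_one_ne_zero
  have e0 : f ^ 2 * (y - z) ≠ 0 := mul_ne_zero (pow_ne_zero 2 hf) hd
  have e1 : f ^ 2 * (y - z) * xm ^ (α + 1) ≠ 0 := mul_ne_zero e0 (pow_ne_zero _ h1)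
  refine e1 (eq_zero_of_xp_ode (c := β + 1) (fun m hm => hβ (m - 1) (by push_cast; linarith)) ?_)
  rw [ratDeriv_eq_mul_dlog e1, dlog_mul e0 (pow_ne_zero _ h1), dlog_mul (pow_ne_zero 2 hf) hd,
    dlog_pow, dlog_pow, dlog_xm]
  have h3 : (RatFunc.X ^ 2 - 1) * dlog (y - z)
      + (2 * (RatFunc.X ^ 2 - 1) * dlog f + QQ α β) = 0 := by
    apply mul_left_cancel₀ hd
    rw [mul_zero, mul_add, mul_left_comm, ← ratDeriv_eq_mul_dlog hd, ratDeriv_sub]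
    linear_combination hy - hz
  have h4 : dlog (y - z) = -(2 * dlog f) - QQ α β / (RatFunc.X ^ 2 - 1) := by
    have := sq_X_sub_one_ne_zero
    field_simp
    linear_combination h3
  rw [h4, QQ_div]
  simp only [map_add, map_one, map_natCast]
  field_simp
  push_cast
  ring

/-- At the seed's eigenvalue the solutions are the reciprocal one, belonging to `f⁻¹ (x - 1)^(-α -
1) (1 + x)^(-β - 1)`, and the one belonging to `f z`; the latter is singular at `1` by the
assumption on `z`. All other labels are carried along by the bijection of Riccati solutions. -/
theorem LabelState.kStep {u f z : RatFunc ℝ} {α : ℕ} {β : ℝ} {s : ℤ} {lab : ℤ → Lab}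
    (h : LabelState u α β s lab) (hβ : ∀ m : ℤ, β ≠ m) (hu : RegularAt u 1) {n₀ : ℤ}
    (hlab : lab n₀ = .circ) (hf : f ≠ 0)
    (hw : dlog f ∈ Ric (opU u α β) (lam α β .one (n₀ - s)))
    (hz : (RatFunc.X ^ 2 - 1) * ∂ z + (2 * (RatFunc.X ^ 2 - 1) * dlog f + QQ α β) * z = 1)
    (hzr : ¬ RegularAt (dlog z) 1) :
    LabelState (u + dlog f) ((α + 1 : ℕ) : ℝ) (β + 1) (s + 1) (Function.update lab n₀ .ast) := by
  have hr : RegularAt (dlog f) 1 := by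
    have h1 := h.ok n₀
    rw [hlab] at h1
    obtain ⟨w, hS, -, hr⟩ := h1
    rw [hS, Set.mem_singleton_iff] at hw
    rwa [hw]
  -- Raising `s` together with the parameters lets `n` keep naming the same eigenvalue up to an
  -- additive constant.
  have hshift : ∀ n : ℤ, lam ((α + 1 : ℕ) : ℝ) (β + 1) .one (n - (s + 1 : ℤ)) =
      lam α β .one (n - s) - (α + β + 2) := by
    intro n; simp only [lam]; push_cast; ring
  have hinj : ∀ n : ℤ, n ≠ n₀ → lam α β .one (n - s) ≠ lam α β .one (n₀ - s) := by
    intro n hn h1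
    have := lam_one_inj (α := α) hβ (m := n - s) (n := n₀ - s) (by push_cast; exact h1)
    omega
  have hα : ((α + 1 : ℕ) : ℝ) = (α : ℝ) + 1 := by push_cast; ring
  constructor
  · intro n
    rw [hshift, hα]
    rcases eq_or_ne n n₀ with rfl | hn
    · rw [Function.update_self]
      have hz0 : z ≠ 0 := by
        rintro rfl
        rw [ratDeriv_zero, mul_zero, mul_zero, add_zero] at hz
        exact zero_ne_one hz
      refine ⟨-dlog f - QQ α β / (RatFunc.X ^ 2 - 1), dlog f + dlog z, ?_, ⟨?_, ?_⟩, ?_, ?_⟩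
      · ext w
        rw [mem_Ric_darboux_self hw, Set.mem_insert_iff, Set.mem_singleton_iff]
        refine or_congr Iff.rfl ⟨?_, fun h => ⟨z, hz, h⟩⟩
        rintro ⟨y, hy, rfl⟩
        rw [darboux_inhom_unique hβ hf hy hz]
      · refine ⟨f⁻¹ * (xm ^ (α + 1))⁻¹, mul_ne_zero (inv_ne_zero hf)
          (inv_ne_zero (pow_ne_zero _ X_sub_one_ne_zero)), ?_⟩
        rw [dlog_mul (inv_ne_zero hf) (inv_ne_zero (pow_ne_zero _ X_sub_one_ne_zero)),
          dlog_inv, dlog_inv, dlog_pow, dlog_xm, QQ_div]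
        simp only [map_add, map_one, map_natCast]
        push_cast
        ring
      · have h1 := (hr.neg.hasRes.sub (hasRes_C_div ((α : ℝ) + 1))).sub
          (regularAt_C_div_xp (β + 1)).hasRes
        rw [QQ_div, ← sub_sub, h1.regularAt_iff]
        have : (0 : ℝ) ≤ α := Nat.cast_nonneg α
        intro h2; linarith
      · exact ⟨f * z, mul_ne_zero hf hz0, (dlog_mul hf hz0).symm⟩
      · intro h1
        apply hzr
        simpa using h1.sub hr
    · rw [Function.update_of_ne hn, Ric_darboux hw (hinj n hn)]
      refine (h.ok n).image _ (fun w hS hw' => isInt_darboux (darboux_ne hw (hinj n hn) hS) hw')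
        (fun w hS hw' => isTwisted_darboux (darboux_ne hw (hinj n hn) hS) hw') ?_
      intro w hS hw'
      obtain ⟨k, hk⟩ : ∃ k : ℤ, HasRes w k := hw'.elim IsInt.exists_hasRes IsTwisted.exists_hasRes
      exact regularAt_darboux_iff (Nat.cast_nonneg α) hu hw hr (hinj n hn) hS hk
  · intro μ hμ
    obtain ⟨κ, rfl⟩ : ∃ κ, μ = κ - (α + β + 2) := ⟨μ + (α + β + 2), by ring⟩
    have hκ : ∀ n : ℤ, κ ≠ lam α β .one (n - s) := by
      intro n hn
      apply hμ n
      rw [hshift, hn]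
    rw [hα, Ric_darboux hw (hκ n₀), h.empty κ hκ, Set.image_empty]

/-- The seed has residue `-(α + 1)` at `1`. Conjugation by `x - 1` removes this pole from `u` and
makes the reciprocal solution regular at `1`; since the inhomogeneous equation has no solution, this
is the only one at the seed's eigenvalue, and it is twisted at `-1`. -/
theorem LabelState.mStep {u f : RatFunc ℝ} {α : ℕ} {β : ℝ} {s : ℤ} {lab : ℤ → Lab}
    (h : LabelState u ((α + 1 : ℕ) : ℝ) β s lab) (hβ : ∀ m : ℤ, β ≠ m) (hu : RegularAt u 1)
    {n₀ : ℤ} (hlab : lab n₀ = .ast) (hf : f ≠ 0)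
    (hw : dlog f ∈ Ric (opU u ((α + 1 : ℕ) : ℝ) β) (lam ((α + 1 : ℕ) : ℝ) β .one (n₀ - s)))
    (hno : ∀ z, (RatFunc.X ^ 2 - 1) * ∂ z
      + (2 * (RatFunc.X ^ 2 - 1) * dlog f + QQ ((α + 1 : ℕ) : ℝ) β) * z ≠ 1) :
    LabelState (u + dlog f + RatFunc.C ((α + 1 : ℕ) : ℝ) / xm) α (β + 1) s
      (Function.update lab n₀ .minus) := by
  have hα0 : (0 : ℝ) < ((α + 1 : ℕ) : ℝ) := by positivity
  have hα : ((α + 1 : ℕ) : ℝ) = (α : ℝ) + 1 := by push_cast; ring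
  have hr : HasRes (dlog f) (-((α + 1 : ℕ) : ℝ)) := by
    obtain ⟨k, hk⟩ := exists_hasRes_dlog hf
    have h1 := h.ok n₀
    rw [hlab] at h1
    obtain ⟨v, w, hS, ⟨hv, -⟩, -, hwr⟩ := h1
    have h2 : dlog f = w := by
      have h3 := hw
      rw [hS, Set.mem_insert_iff, Set.mem_singleton_iff] at h3
      refine h3.resolve_left fun h4 => ?_
      rw [← h4] at hv
      exact IsInt.not_isTwisted hβ ⟨f, hf, rfl⟩ hv
    rw [← h2, hk.regularAt_iff] at hwr
    rwa [(hk.exponent hu hw).resolve_left hwr] at hk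
  set A : ℝ := ((α + 1 : ℕ) : ℝ) with hA
  have hinj : ∀ n : ℤ, n ≠ n₀ → lam A β .one (n - s) ≠ lam A β .one (n₀ - s) := by
    intro n hn h1
    have := lam_one_inj (α := (α + 1 : ℕ)) hβ (m := n - s) (n := n₀ - s)
      (by push_cast; rw [hA] at h1; push_cast at h1; exact h1)
    omega
  have hlam : ∀ n : ℤ, lam α (β + 1) .one (n - s) = lam A β .one (n - s) := by
    intro n; simp only [lam, hα]; ring
  have hgauge : ∀ μ w, w ∈ Ric (opU (u + dlog f + RatFunc.C A / xm) α (β + 1)) μ ↔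
      w - 1 / xm ∈ Ric (opU (u + dlog f) (A + 1) (β + 1)) (μ - (A + β + 2)) := by
    intro μ w
    rw [gauge_mul_xm, show A + 1 - 1 = A by ring, show A + 1 - 2 = (α : ℝ) by rw [hα]; ring,
      show μ - (A + β + 2) + (A + 1) + (β + 1) = μ by ring]
  have himg : ∀ μ, μ ≠ lam A β .one (n₀ - s) →
      Ric (opU (u + dlog f + RatFunc.C A / xm) α (β + 1)) μ =
        (fun w => w + dlog (w - dlog f) + 1 / xm) '' Ric (opU u A β) μ := by
    intro μ hμ
    ext w
    rw [hgauge, Ric_darboux hw hμ]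
    simp only [Set.mem_image]
    refine exists_congr fun y => and_congr_right fun _ => ?_
    constructor
    · intro h; linear_combination h
    · intro h; linear_combination h
  constructor
  · intro n
    rw [hlam]
    rcases eq_or_ne n n₀ with rfl | hn
    · rw [Function.update_self]
      refine ⟨-dlog f - QQ A β / (RatFunc.X ^ 2 - 1) + 1 / xm, ?_, ?_, ?_⟩
      · ext w
        rw [hgauge, mem_Ric_darboux_self hw, Set.mem_singleton_iff]
        constructor
        · rintro (h1 | ⟨z, hz, -⟩)
          · linear_combination h1
          · exact absurd hz (hno z)
        · intro h1
          left; linear_combination h1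
      · refine ⟨f⁻¹ * (xm ^ (α + 1))⁻¹, mul_ne_zero (inv_ne_zero hf)
          (inv_ne_zero (pow_ne_zero _ X_sub_one_ne_zero)), ?_⟩
        rw [dlog_mul (inv_ne_zero hf) (inv_ne_zero (pow_ne_zero _ X_sub_one_ne_zero)),
          dlog_inv, dlog_inv, dlog_pow, dlog_xm, QQ_div, hA]
        simp only [map_add, map_one, map_natCast]
        push_cast
        ring
      · have h1 := ((hr.neg.sub (hasRes_C_div (A + 1))).sub
          (regularAt_C_div_xp (β + 1)).hasRes).add hasRes_inv_xm
        rw [QQ_div, ← sub_sub, h1.regularAt_iff]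
        ring
    · rw [Function.update_of_ne hn, himg _ (hinj n hn)]
      refine (h.ok n).image _
        (fun w hS hw' => isInt_add_inv (isInt_darboux (darboux_ne hw (hinj n hn) hS) hw'))
        (fun w hS hw' => isTwisted_add_inv (isTwisted_darboux (darboux_ne hw (hinj n hn) hS) hw'))
        ?_
      intro w hS hw'
      obtain ⟨k, hk⟩ : ∃ k : ℤ, HasRes w k := hw'.elim IsInt.exists_hasRes IsTwisted.exists_hasRes
      exact regularAt_darboux_iff_of_pole hα0 hu hw hr (hinj n hn) hS hk
  · intro μ hμ
    have hμ' : ∀ n : ℤ, μ ≠ lam A β .one (n - s) := fun n => by rw [← hlam]; exact hμ n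
    rw [himg μ (hμ' n₀), h.empty μ hμ', Set.image_empty]

/-! ### Eigenfunctions with the same eigenvalue -/

theorem int_root_unique {s d e : ℝ} {m n : ℤ} (hs : ∀ k : ℤ, s ≠ k) (hm : d = m) (hn : e = n)
    (h : d * (d + s) = e * (e + s)) : m = n := by
  subst hm hn
  have h1 : ((m : ℝ) - n) * (m + n + s) = 0 := by linear_combination h
  rcases mul_eq_zero.1 h1 with h2 | h2
  · exact_mod_cast sub_eq_zero.1 h2
  · exact absurd (by push_cast; linarith) (hs (-m - n))

theorem apply_add_C_mul (T : DiffOp2) (f g : RatFunc ℝ) (c : ℝ) :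
    T.apply (f - RatFunc.C c * g) = T.apply f - RatFunc.C c * T.apply g := by
  simp only [DiffOp2.apply, ratDeriv_sub, ratDeriv_C_mul]
  ring

/-- The two degrees allowed by an eigenvalue add up to the non-integer `-(α + β + 1)`, so at most
one is integral. Subtracting a multiple that cancels the leading terms would leave an eigenfunction
of the same degree with no leading term, unless it leaves zero. -/
theorem eigenfunction_unique {u f g : RatFunc ℝ} {α β μ M : ℝ} (hαβ : ∀ m : ℤ, α + β ≠ m)
    (hu : AtInf (RatFunc.X * u) M) (hf : f ≠ 0) (hg : g ≠ 0)
    (h1 : dlog f ∈ Ric (opU u α β) μ) (h2 : dlog g ∈ Ric (opU u α β) μ) : dlog f = dlog g := by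
  have hs : ∀ k : ℤ, α + β + 1 ≠ k := fun k h => hαβ (k - 1) (by push_cast; linarith)
  have key : ∀ {h : RatFunc ℝ} {d : ℤ} {c : ℝ}, HasLead h d c → dlog h ∈ Ric (opU u α β) μ →
      (d : ℝ) * (d + (α + β + 1)) = μ := by
    intro h d c hl hr
    have := degree_of_mem_Ric hu hl.atInf_X_mul_dlog hr
    linarith
  have hlf := hasLead_self hf
  have hlg := hasLead_self hg
  have hd : f.intDegree = g.intDegree :=
    int_root_unique hs rfl rfl ((key hlf h1).trans (key hlg h2).symm)
  set c := f.num.leadingCoeff / g.num.leadingCoeff with hc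
  have hc0 : c ≠ 0 := div_ne_zero hlf.1 hlg.1
  by_cases he : f - RatFunc.C c * g = 0
  · rw [sub_eq_zero.1 he, dlog_C_mul hc0 hg]
  · exfalso
    have h3 : dlog (f - RatFunc.C c * g) ∈ Ric (opU u α β) μ := by
      rw [← apply_opU_iff he, apply_add_C_mul, (apply_opU_iff hf).2 h1, (apply_opU_iff hg).2 h2]
      ring
    have hle := hasLead_self he
    have hde := int_root_unique hs rfl rfl ((key hle h3).trans (key hlf h1).symm)
    rw [hde] at hle
    have h4 := hlf.2.sub ((AtInf.const c).mul (hd ▸ hlg.2))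
    have h5 : c * g.num.leadingCoeff = f.num.leadingCoeff := by
      rw [hc, div_mul_cancel₀ _ hlg.1]
    rw [h5, sub_self] at h4
    refine hle.1 (hle.2.unique ?_)
    convert h4 using 1
    ring

/-! ### Poles of eigenfunctions away from `± 1` -/

/-- `f` has no pole at the irreducible polynomial `P`. -/
def RegP (P : ℝ[X]) (f : RatFunc ℝ) : Prop := ∃ A B : ℝ[X], ¬ P ∣ B ∧ f = ι A / ι B

theorem not_dvd_ne_zero {P B : ℝ[X]} (h : ¬ P ∣ B) : B ≠ 0 := by
  rintro rfl; exact h (dvd_zero P)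

theorem RegP.add {P : ℝ[X]} (hP : Prime P) {f g : RatFunc ℝ} (hf : RegP P f) (hg : RegP P g) :
    RegP P (f + g) := by
  obtain ⟨A, B, hB, rfl⟩ := hf
  obtain ⟨A', B', hB', rfl⟩ := hg
  have h1 := RatFunc.algebraMap_ne_zero (not_dvd_ne_zero hB)
  have h2 := RatFunc.algebraMap_ne_zero (not_dvd_ne_zero hB')
  refine ⟨A * B' + B * A', B * B', fun h => (hP.dvd_or_dvd h).elim hB hB', ?_⟩
  rw [div_add_div _ _ h1 h2]; simp

theorem RegP.mul {P : ℝ[X]} (hP : Prime P) {f g : RatFunc ℝ} (hf : RegP P f) (hg : RegP P g) :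
    RegP P (f * g) := by
  obtain ⟨A, B, hB, rfl⟩ := hf
  obtain ⟨A', B', hB', rfl⟩ := hg
  refine ⟨A * A', B * B', fun h => (hP.dvd_or_dvd h).elim hB hB', ?_⟩
  rw [div_mul_div_comm]; simp

theorem regP_poly {P : ℝ[X]} (hP : Prime P) (A : ℝ[X]) : RegP P (ι A) :=
  ⟨A, 1, fun h => hP.not_isUnit (isUnit_of_dvd_one h), by simp⟩

theorem RegP.neg {P : ℝ[X]} {f : RatFunc ℝ} (hf : RegP P f) : RegP P (-f) := by
  obtain ⟨A, B, hB, rfl⟩ := hf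
  exact ⟨-A, B, hB, by rw [map_neg, neg_div]⟩

theorem RegP.ratDeriv {P : ℝ[X]} (hP : Prime P) {f : RatFunc ℝ} (hf : RegP P f) :
    RegP P (∂ f) := by
  obtain ⟨A, B, hB, rfl⟩ := hf
  refine ⟨derivative A * B - A * derivative B, B ^ 2, fun h => hB (hP.dvd_of_dvd_pow h), ?_⟩
  rw [ratDeriv_div A B (not_dvd_ne_zero hB)]; simp

theorem exists_order_prime {P : ℝ[X]} (hP : Prime P) {f : RatFunc ℝ} (hf : f ≠ 0) :
    ∃ (k : ℤ) (A B : ℝ[X]), ¬ P ∣ A ∧ ¬ P ∣ B ∧ f = ι P ^ k * (ι A / ι B) := by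
  have key : ∀ p : ℝ[X], p ≠ 0 → ∃ (m : ℕ) (r : ℝ[X]), ¬ P ∣ r ∧ p = P ^ m * r := by
    intro p hp
    obtain ⟨m, r, h1, h2⟩ := WfDvdMonoid.max_power_factor hp hP.irreducible
    exact ⟨m, r, h1, h2⟩
  obtain ⟨m, A, hA, h1⟩ := key f.num (RatFunc.num_ne_zero hf)
  obtain ⟨n, B, hB, h2⟩ := key f.denom f.denom_ne_zero
  refine ⟨(m : ℤ) - n, A, B, hA, hB, ?_⟩
  have h3 := RatFunc.algebraMap_ne_zero (not_dvd_ne_zero hB)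
  have h4 := RatFunc.algebraMap_ne_zero (K := ℝ) hP.ne_zero
  conv_lhs => rw [← RatFunc.num_div_denom f, h1, h2]
  rw [zpow_sub₀ h4, map_mul, map_mul, map_pow, map_pow]
  simp only [zpow_natCast]
  field_simp

theorem regP_dlog {P A B : ℝ[X]} (hP : Prime P) (hA : ¬ P ∣ A) (hB : ¬ P ∣ B) :
    RegP P (dlog (ι A / ι B)) := by
  have h1 := RatFunc.algebraMap_ne_zero (not_dvd_ne_zero hA)
  have h2 := RatFunc.algebraMap_ne_zero (not_dvd_ne_zero hB)
  rw [dlog_div h1 h2]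
  refine RegP.sub' hP ⟨derivative A, A, hA, ?_⟩ ⟨derivative B, B, hB, ?_⟩ <;>
  rw [dlog, ratDeriv_algebraMap]
where
  RegP.sub' {P : ℝ[X]} (hP : Prime P) {f g : RatFunc ℝ} (hf : RegP P f) (hg : RegP P g) :
      RegP P (f - g) := by
    rw [sub_eq_add_neg]; exact hf.add hP hg.neg

/-- `τ f` has no poles away from `± 1`, for every rational eigenfunction `f`. -/
theorem regP_tau_mul {τ P : ℝ[X]} {f : RatFunc ℝ} {α β μ : ℝ} (hτ : τ ≠ 0) (hf : f ≠ 0)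
    (h : dlog f ∈ Ric (opU (dlog (ι τ)) α β) μ) (hP : Prime P) (hPx : ¬ P ∣ X ^ 2 - 1) :
    RegP P (ι τ * f) := by
  obtain ⟨k, A, B, hA, hB, rfl⟩ := exists_order_prime hP hf
  obtain ⟨m, t, ht, hτm⟩ := WfDvdMonoid.max_power_factor hτ hP.irreducible
  have hιP := RatFunc.algebraMap_ne_zero (K := ℝ) hP.ne_zero
  have hιA := RatFunc.algebraMap_ne_zero (not_dvd_ne_zero hA)
  have hιB := RatFunc.algebraMap_ne_zero (not_dvd_ne_zero hB)
  have hιt := RatFunc.algebraMap_ne_zero (not_dvd_ne_zero ht)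
  obtain ⟨g, hg, hgP⟩ : ∃ g, g = dlog (ι A / ι B) ∧ RegP P g := ⟨_, rfl, regP_dlog hP hA hB⟩
  obtain ⟨v, hv, hvP⟩ : ∃ v, v = dlog (ι t) ∧ RegP P v := by
    refine ⟨_, rfl, ?_⟩
    have := regP_dlog hP ht (fun h => hP.not_isUnit (isUnit_of_dvd_one h))
    simpa using this
  have e1 : dlog (ι P ^ k * (ι A / ι B)) = k * (ι (derivative P) / ι P) + g := by
    rw [dlog_mul (zpow_ne_zero _ hιP) (div_ne_zero hιA hιB), dlog_zpow, hg, dlog,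
      ratDeriv_algebraMap]
  have e2 : dlog (ι τ) = m * (ι (derivative P) / ι P) + v := by
    rw [hτm, map_mul, map_pow, dlog_mul (pow_ne_zero _ hιP) hιt, dlog_pow, hv, dlog,
      ratDeriv_algebraMap]
  have hd : ∂ (ι (derivative P) / ι P) = ι (derivative (derivative P)) / ι P
      - ι (derivative P) ^ 2 / ι P ^ 2 := by
    rw [ratDeriv_quot _ _ hιP, ratDeriv_algebraMap, ratDeriv_algebraMap]; field_simp
  have hk' : ∂ (k : RatFunc ℝ) = 0 := by simpa using ratDeriv_C (k : ℝ)
  rw [mem_Ric_opU, e1, e2, ratDeriv_add, ratDeriv_add, ratDeriv_mul, ratDeriv_mul, hk',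
    ratDeriv_natCast, hd] at h
  have hQ : QQ α β = ι (C (α + 1) * (X + 1) + C (β + 1) * (X - 1)) := by simp [QQ]
  -- The double pole at `P` is isolated: `f` has order `k` and `τ` has order `m` there, and
  -- everything apart from the coefficient `k² - k - 2m` carries a factor `P`.
  have e3 : ι ((X ^ 2 - 1) * derivative P ^ 2 * C ((k : ℝ) ^ 2 - k - 2 * m)) =
      ι P * -(ι (X ^ 2 - 1) * (ι (C (k : ℝ) * derivative (derivative P)) + ι P * ∂ g
        + ι (C (2 * (k : ℝ)) * derivative P) * g + ι P * (g * g))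
        + ι (C (α + 1) * (X + 1) + C (β + 1) * (X - 1)) * (ι (C (k : ℝ) * derivative P) + ι P * g)
        + ι (2 * (X ^ 2 - 1)) * (ι (C (m : ℝ) * derivative (derivative P)) + ι P * ∂ v)
        + ι (2 * X) * (ι (C (m : ℝ) * derivative P) + ι P * v) + ι (-C μ * P)) := by
    rw [← hQ]
    simp only [map_mul, map_sub, map_pow, map_one, map_neg, RatFunc.algebraMap_X,
      RatFunc.algebraMap_C, map_intCast, map_natCast, map_ofNat]
    field_simp at h
    linear_combination h
  have hR : RegP P (-(ι (X ^ 2 - 1) * (ι (C (k : ℝ) * derivative (derivative P)) + ι P * ∂ g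
        + ι (C (2 * (k : ℝ)) * derivative P) * g + ι P * (g * g))
        + ι (C (α + 1) * (X + 1) + C (β + 1) * (X - 1)) * (ι (C (k : ℝ) * derivative P) + ι P * g)
        + ι (2 * (X ^ 2 - 1)) * (ι (C (m : ℝ) * derivative (derivative P)) + ι P * ∂ v)
        + ι (2 * X) * (ι (C (m : ℝ) * derivative P) + ι P * v) + ι (-C μ * P))) := by
    have p := regP_poly hP
    exact RegP.neg (RegP.add hP (RegP.add hP (RegP.add hP (RegP.add hP
      ((p _).mul hP ((((p _).add hP ((p _).mul hP (hgP.ratDeriv hP))).add hP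
        ((p _).mul hP hgP)).add hP ((p _).mul hP (hgP.mul hP hgP))))
      ((p _).mul hP ((p _).add hP ((p _).mul hP hgP))))
      ((p _).mul hP ((p _).add hP ((p _).mul hP (hvP.ratDeriv hP)))))
      ((p _).mul hP ((p _).add hP ((p _).mul hP hvP)))) (p _))
  obtain ⟨E, G, hG, hEG⟩ := hR
  rw [hEG] at e3
  have hιG := RatFunc.algebraMap_ne_zero (not_dvd_ne_zero hG)
  rw [mul_div_assoc', eq_div_iff hιG, ← map_mul, ← map_mul] at e3
  have e4 := RatFunc.algebraMap_injective ℝ e3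
  have hdvd : P ∣ (X ^ 2 - 1) * derivative P ^ 2 * C ((k : ℝ) ^ 2 - k - 2 * m) :=
    (hP.dvd_or_dvd ⟨E, e4⟩).resolve_right hG
  have hP' : ¬ P ∣ derivative P := by
    intro h1
    have h2 : P.natDegree ≠ 0 := by
      intro h3
      obtain ⟨c, rfl⟩ := natDegree_eq_zero.1 h3
      have hc : c ≠ 0 := fun h => hP.ne_zero (by simp [h])
      exact hP.not_isUnit (by simpa using hc)
    have h3 : derivative P ≠ 0 := fun h => h2 (derivative_eq_zero.1 h)
    exact absurd (natDegree_le_of_dvd h1 h3) (not_le.2 (natDegree_derivative_lt h2))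
  have hc : (k : ℝ) ^ 2 - k - 2 * m = 0 := by
    rcases hP.dvd_or_dvd hdvd with h1 | h1
    · rcases hP.dvd_or_dvd h1 with h2 | h2
      · exact absurd h2 hPx
      · exact absurd (hP.dvd_of_dvd_pow h2) hP'
    · by_contra h2
      exact hP.not_isUnit (isUnit_of_dvd_unit h1 (isUnit_C.2 (isUnit_iff_ne_zero.2 h2)))
  have hc' : k ^ 2 - k - 2 * (m : ℤ) = 0 := by exact_mod_cast hc
  -- From `k (k - 1) = 2m` one gets `2 (m + k) = k (k + 1)`, which is non-negative for an integer
  -- `k`.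
  have hkm : 0 ≤ (m : ℤ) + k := by nlinarith
  obtain ⟨j, hj⟩ := Int.eq_ofNat_of_zero_le hkm
  refine ⟨P ^ j * t * A, B, hB, ?_⟩
  have e5 : ι P ^ m * ι P ^ k = ι P ^ j := by
    rw [← zpow_natCast, ← zpow_natCast, ← zpow_add₀ hιP, hj]
  rw [hτm]
  simp only [map_mul, map_pow]
  rw [← e5]
  ring

theorem exists_poly_of_regular {f : RatFunc ℝ} (h1 : RegularAt f 1) (h2 : RegularAt f (-1))
    (h : ∀ P : ℝ[X], Prime P → ¬ P ∣ X ^ 2 - 1 → RegP P f) : ∃ N : ℝ[X], f = ι N := by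
  by_cases hu : IsUnit f.denom
  · refine ⟨f.num, ?_⟩
    rw [(RatFunc.monic_denom f).isUnit_iff] at hu
    conv_lhs => rw [← RatFunc.num_div_denom f, hu]
    simp
  · exfalso
    obtain ⟨P, hP, hPd⟩ := WfDvdMonoid.exists_irreducible_factor hu f.denom_ne_zero
    by_cases hPx : P ∣ X ^ 2 - 1
    · have hroot : ∀ c : ℝ, P ∣ X - C c → ¬ RegularAt f c := by
        intro c hc hr
        have h3 := (hP.dvd_symm (irreducible_X_sub_C c) hc).trans hPd
        exact hr (dvd_iff_isRoot.1 h3)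
      have e : (X ^ 2 - 1 : ℝ[X]) = (X - C 1) * (X - C (-1)) := by
        simp only [map_neg, map_one]; ring
      rw [e] at hPx
      rcases hP.prime.dvd_or_dvd hPx with h3 | h3
      · exact hroot _ h3 h1
      · exact hroot _ h3 h2
    · obtain ⟨A, B, hB, rfl⟩ := h P hP.prime hPx
      exact hB (hPd.trans (RatFunc.denom_div_dvd A B))

/-! ### Local solvability at `1` -/

/-- Every polar rational function is mapped to a polar one by `T - μ`, at the point `1`. -/
def LocAt (T : DiffOp2) (μ : ℝ) : Prop :=
  ∀ g : RatFunc ℝ, RegularAt (T.apply g - RatFunc.C μ * g) 1 → RegularAt g 1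

/-- If `(T' - μ') g` is regular, then `B g` is regular by the hypothesis on `T`. Hence `A B g` is
regular, and as `μ ≠ μ₀` the function `g` is recovered as a multiple of the difference of two
regular functions. -/
theorem LocAt.transport {T T' : DiffOp2} {A B : RatFunc ℝ → RatFunc ℝ} {μ μ₀ ν₀ : ℝ}
    (h : LocAt T μ) (hμ : μ ≠ μ₀)
    (hBA : ∀ f, T.apply f - RatFunc.C μ₀ * f = B (A f))
    (hAB : ∀ f, T'.apply f - RatFunc.C ν₀ * f = A (B f))
    (hadd : ∀ f g c, B (f + RatFunc.C c * g) = B f + RatFunc.C c * B g)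
    (hA : ∀ f, RegularAt f 1 → RegularAt (A f) 1) (hB : ∀ f, RegularAt f 1 → RegularAt (B f) 1) :
    LocAt T' (μ + ν₀ - μ₀) := by
  intro g hg
  have h1 : T.apply (B g) - RatFunc.C μ * B g
      = B (T'.apply g - RatFunc.C (μ + ν₀ - μ₀) * g) := by
    have e : T'.apply g - RatFunc.C (μ + ν₀ - μ₀) * g = A (B g) + RatFunc.C (μ₀ - μ) * g := by
      rw [← hAB]; simp only [map_sub, map_add]; ring
    rw [e, hadd, ← hBA, map_sub]; ring
  have h2 : RegularAt (B g) 1 := h _ (by rw [h1]; exact hB _ hg)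
  have h3 := (hA _ h2).sub hg
  rw [← hAB] at h3
  have h4 : (RatFunc.C ((μ - μ₀)⁻¹) : RatFunc ℝ) * (T'.apply g - RatFunc.C ν₀ * g
      - (T'.apply g - RatFunc.C (μ + ν₀ - μ₀) * g)) = g := by
    have h5 : (RatFunc.C μ - RatFunc.C μ₀ : RatFunc ℝ) ≠ 0 := by
      rw [← map_sub, _root_.map_ne_zero]; exact sub_ne_zero.2 hμ
    rw [map_inv₀]; simp only [map_sub, map_add]
    field_simp
    ring
  rw [← h4]
  exact (regularAt_C 1 _).mul h3

/-- The first order operator `D - w₀`. -/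
def darA (w₀ f : RatFunc ℝ) : RatFunc ℝ := ∂ f - w₀ * f

/-- The complementary first order operator. -/
def darB (α β : ℝ) (w₀ f : RatFunc ℝ) : RatFunc ℝ :=
  (RatFunc.X ^ 2 - 1) * ∂ f + ((RatFunc.X ^ 2 - 1) * w₀ + QQ α β) * f

theorem darB_darA {u w₀ : RatFunc ℝ} {α β μ₀ : ℝ} (h : w₀ ∈ Ric (opU u α β) μ₀) (f : RatFunc ℝ) :
    (opU u α β).apply f - RatFunc.C μ₀ * f = darB α β w₀ (darA w₀ f) := by
  rw [mem_Ric_opU] at h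
  simp only [DiffOp2.apply, opU, darB, darA, ratDeriv_sub, ratDeriv_mul]
  linear_combination f * h

theorem darA_darB {u w₀ : RatFunc ℝ} {α β μ₀ : ℝ} (h : w₀ ∈ Ric (opU u α β) μ₀) (f : RatFunc ℝ) :
    (opU (u + w₀) (α + 1) (β + 1)).apply f - RatFunc.C (μ₀ - (α + β + 2)) * f
      = darA w₀ (darB α β w₀ f) := by
  rw [mem_Ric_opU] at h
  have hQ : QQ (α + 1) (β + 1) = QQ α β + 2 * RatFunc.X := by
    simp only [QQ, map_add, map_one]; ring
  simp only [DiffOp2.apply, opU, darB, darA, ratDeriv_mul, ratDeriv_add, ratDeriv_QQ,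
    ratDeriv_sq_X_sub_one, hQ]
  rw [map_sub]
  linear_combination f * h

theorem darA_eq_mul {w₀ f : RatFunc ℝ} (hf : f ≠ 0) : darA w₀ f = f * (dlog f - w₀) := by
  rw [darA, ratDeriv_eq_mul_dlog hf]; ring

theorem darA_self (f : RatFunc ℝ) : darA (dlog f) f = 0 := by
  rcases eq_or_ne f 0 with rfl | hf
  · simp [darA, ratDeriv_zero]
  · rw [darA_eq_mul hf, sub_self, mul_zero]

theorem regularAt_QQ (α β : ℝ) : RegularAt (QQ α β) 1 :=
  ((regularAt_C _ _).mul valAt_xp.regularAt).add ((regularAt_C _ _).mul valAt_xm.regularAt)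

theorem regularAt_sq_X_sub_one : RegularAt (RatFunc.X ^ 2 - 1) 1 := by
  rw [xm_mul_xp]; exact valAt_xm.regularAt.mul valAt_xp.regularAt

theorem darB_add_C_mul (α β : ℝ) (w₀ f g : RatFunc ℝ) (c : ℝ) :
    darB α β w₀ (f + RatFunc.C c * g) = darB α β w₀ f + RatFunc.C c * darB α β w₀ g := by
  simp only [darB, ratDeriv_add, ratDeriv_C_mul]; ring

theorem LocAt.darboux {u w₀ : RatFunc ℝ} {α β μ μ₀ : ℝ} (h : LocAt (opU u α β) μ)
    (h₀ : w₀ ∈ Ric (opU u α β) μ₀) (hr : RegularAt w₀ 1) (hμ : μ ≠ μ₀) :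
    LocAt (opU (u + w₀) (α + 1) (β + 1)) (μ - (α + β + 2)) := by
  have := h.transport hμ (darB_darA h₀) (darA_darB h₀) (darB_add_C_mul α β w₀)
    (fun f hf => hf.ratDeriv.sub (hr.mul hf))
    (fun f hf => (regularAt_sq_X_sub_one.mul hf.ratDeriv).add
      (((regularAt_sq_X_sub_one.mul hr).add (regularAt_QQ α β)).mul hf))
  convert this using 1
  ring

theorem gauge_mul_xm_apply (u g : RatFunc ℝ) (α β : ℝ) :
    (opU (u + RatFunc.C (α - 1) / xm) (α - 2) β).apply (xm * g) =
      xm * ((opU u α β).apply g + RatFunc.C (α + β) * g) := by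
  have h1 := X_sub_one_ne_zero
  have h3 : (RatFunc.C (α - 2) : RatFunc ℝ) = RatFunc.C α - 2 := by
    rw [map_sub, ratC_two]
  have h4 : ∂ (u + RatFunc.C (α - 1) / xm) = ∂ u - (RatFunc.C α - 1) / xm ^ 2 := by
    rw [ratDeriv_add, ratDeriv_C_div_xm, map_sub, map_one]; ring
  simp only [DiffOp2.apply, opU, h4]
  simp only [ratDeriv_add, ratDeriv_mul, ratDeriv_sub, ratDeriv_X,
    ratDeriv_one, ratDeriv_zero, QQ, map_add, map_sub, map_one, ratC_two]
  field_simp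
  ring

theorem LocAt.darboux_of_pole {u w₀ : RatFunc ℝ} {α β μ μ₀ : ℝ} (h : LocAt (opU u α β) μ)
    (h₀ : w₀ ∈ Ric (opU u α β) μ₀) (hr : HasRes w₀ (-α)) (hμ : μ ≠ μ₀) :
    LocAt (opU (u + w₀ + RatFunc.C α / xm) (α - 1) (β + 1)) μ := by
  have h1 := X_sub_one_ne_zero
  obtain ⟨v, hv, hw⟩ := hr
  have hxw : xm * w₀ = RatFunc.C (-α) + xm * v := by rw [hw]; field_simp
  have hxr : RegularAt (xm * w₀) 1 := by
    rw [hxw]; exact (regularAt_C _ _).add (valAt_xm.regularAt.mul hv)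
  have := h.transport (T' := opU (u + w₀ + RatFunc.C α / xm) (α - 1) (β + 1)) (ν₀ := μ₀)
    (A := fun f => xm * darA w₀ f) (B := fun f => darB α β w₀ (f / xm)) hμ ?_ ?_ ?_ ?_ ?_
  · convert this using 1; ring
  · intro f
    rw [darB_darA h₀, mul_div_cancel_left₀ _ h1]
  · intro f
    have e := gauge_mul_xm_apply (u + w₀) (f / xm) (α + 1) (β + 1)
    rw [mul_div_cancel₀ _ h1, show α + 1 - 1 = α by ring, show α + 1 - 2 = α - 1 by ring] at e
    rw [e, ← darA_darB h₀]
    simp only [map_sub, map_add, map_one, ratC_two]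
    field_simp
    ring
  · intro f g c
    rw [← darB_add_C_mul]; congr 1; ring
  · intro f hf
    have e : xm * darA w₀ f = xm * ∂ f - (xm * w₀) * f := by rw [darA]; ring
    rw [e]
    exact (valAt_xm.regularAt.mul hf.ratDeriv).sub (hxr.mul hf)
  · intro f hf
    -- The polar contributions `-1`, `-α` and `α + 1` at `x = 1` add up to zero, so this composite
    -- preserves regularity although the seed has a pole.
    have e : darB α β w₀ (f / xm) = xp * ∂ f + (xp * v + RatFunc.C (β + 1)) * f := by
      rw [darB, ratDeriv_quot _ _ h1, ratDeriv_sub, ratDeriv_X, ratDeriv_one, hw, xm_mul_xp, QQ]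
      simp only [map_add, map_neg, map_one]
      field_simp
      ring
    rw [e]
    exact (valAt_xp.regularAt.mul hf.ratDeriv).add
      (((valAt_xp.regularAt.mul hv).add (regularAt_C _ _)).mul hf)

/-! ### Values and leading terms of eigenfunctions -/

theorem exists_valAt_of_dlog_regularAt {f : RatFunc ℝ} (hf : f ≠ 0) (h : RegularAt (dlog f) 1) :
    ∃ y, y ≠ 0 ∧ ValAt 1 f y := by
  obtain ⟨k, g, y, hy, hg, e⟩ := exists_order_one hf
  have h1 := (hasRes_dlog_of_eq hy hg e).regularAt_iff.1 h
  have h2 : k = 0 := by exact_mod_cast h1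
  rw [h2, zpow_zero, one_mul] at e
  exact ⟨y, hy, e ▸ hg⟩

/-- The exponents at `-1` are `0` and `-β`; only the first can be the order of a rational function.
-/
theorem exists_valAt_neg_one {u f : RatFunc ℝ} {α β μ : ℝ} (hβ : ∀ m : ℤ, β ≠ m)
    (hu : RegularAt u (-1)) (hf : f ≠ 0) (h : dlog f ∈ Ric (opU u α β) μ) :
    ∃ y, y ≠ 0 ∧ ValAt (-1) f y := by
  obtain ⟨k, g, y, hy, hg, e⟩ := exists_order_neg_one hf
  have hg0 : g ≠ 0 := by
    rintro rfl; exact hy (hg.unique (ValAt.zero (-1)))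
  have e1 : dlog f = RatFunc.C (k : ℝ) / xp + dlog g := by
    rw [e, dlog_mul (zpow_ne_zero _ X_add_one_ne_zero) hg0, dlog_zpow, dlog_xp]
    simp [div_eq_mul_inv]
  have h2 : k = 0 := by
    rcases mul_eq_zero.1 (exponent_neg_one hu (hg.dlog_regularAt hy) e1 h) with h3 | h3
    · exact_mod_cast h3
    · exact absurd (by push_cast; linarith) (hβ (-k))
  rw [h2, zpow_zero, one_mul] at e
  exact ⟨y, hy, e ▸ hg⟩

/-- Writing `D - w₀` as multiplication by `f'/f - w₀`, the leading term `(d - e)/x` of this factor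
supplies the new constant. -/
theorem HasLead.darA {f w₀ : RatFunc ℝ} {d e : ℤ} {c : ℝ} (hf : HasLead f d c)
    (hw : AtInf (RatFunc.X * w₀) e) (hde : d ≠ e) :
    HasLead (darA w₀ f) (d - 1) (c * (d - e)) := by
  refine ⟨mul_ne_zero hf.1 (by exact_mod_cast sub_ne_zero.2 hde), ?_⟩
  have h1 := hf.2.mul (hf.atInf_X_mul_dlog.sub hw)
  convert h1 using 1
  rw [darA_eq_mul hf.ne_zero, show -(d - 1) = -d + 1 by ring, zpow_add_one₀ ratX_ne_zero]
  ring

/-- On a term of order `k` at `-1` the left side acts by the factor `k + c`, which is never zero; so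
a pole of `r` would appear unchanged in `g`. -/
theorem regularAt_of_xp_ode {r g : RatFunc ℝ} {c : ℝ} (hc : ∀ m : ℤ, c ≠ m)
    (hg : RegularAt g (-1)) (h : xp * ∂ r + RatFunc.C c * r = g) : RegularAt r (-1) := by
  rcases eq_or_ne r 0 with rfl | hr
  · exact (ValAt.zero (-1)).regularAt
  obtain ⟨k, f, y, hy, hf, e⟩ := exists_order_neg_one hr
  have h2 := X_add_one_ne_zero
  have hz := zpow_ne_zero k h2
  have hf0 : f ≠ 0 := by
    rintro rfl; exact hy (hf.unique (ValAt.zero (-1)))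
  have h1 : xp ^ k * (xp * ∂ f + RatFunc.C (k + c) * f) = g := by
    rw [← h, e, ratDeriv_mul, ratDeriv_eq_mul_dlog hz, dlog_zpow, dlog_xp, map_add]
    simp only [map_intCast]
    field_simp
    ring
  rcases lt_or_ge k 0 with hk | hk
  · exfalso
    obtain ⟨n, hn⟩ : ∃ n : ℕ, -k = (n + 1 : ℕ) := ⟨(-k - 1).toNat, by omega⟩
    have h3 : xp * ∂ f + RatFunc.C (k + c) * f = xp ^ (n + 1) * g := by
      rw [← h1, ← zpow_natCast, ← hn, ← mul_assoc, ← zpow_add₀ h2, neg_add_cancel, zpow_zero,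
        one_mul]
    have h4 := (valAt_neg_xp.mul hf.regularAt.ratDeriv.valAt).add
      ((ValAt.const (-1) ((k : ℝ) + c)).mul hf)
    rw [h3] at h4
    have h5 := h4.unique ((valAt_neg_xp.pow (n + 1)).mul hg.valAt)
    simp only [zero_mul, zero_add, ne_eq, Nat.add_eq_zero_iff, one_ne_zero, and_false,
      not_false_eq_true, zero_pow] at h5
    rcases mul_eq_zero.1 h5 with h6 | h6
    · exact hc (-k) (by push_cast; linarith)
    · exact hy h6
  · obtain ⟨n, rfl⟩ := Int.eq_ofNat_of_zero_le hk
    rw [e, zpow_natCast]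
    exact ((valAt_neg_xp.pow n).mul hf).regularAt

/-! ### Exceptional operators of class A together with their eigenfunctions -/

/-- The operator `Trg(τ; α, β)` with the spectral diagram `lab`, the quasi-polynomial
eigenfunctions `π n`, `n ∈ J`, with leading coefficients `c n` and index `n - s`, and the
anti-derivatives `(1 + x) ^ (β + 1) r n m` of `π n π m (1 - x) ^ α (1 + x) ^ β`. -/
structure ExcState (τ : ℝ[X]) (α : ℕ) (β : ℝ) (s : ℤ) (J : Set ℕ) (lab : ℤ → Lab)
    (π : ℕ → RatFunc ℝ) (c N : ℕ → ℝ) (r : ℕ → ℕ → RatFunc ℝ) : Prop where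
  hβ : ∀ m : ℤ, β ≠ m
  tau_one : τ.eval 1 ≠ 0
  tau_neg_one : τ.eval (-1) ≠ 0
  labels : LabelState (dlog (ι τ)) α β s lab
  lab_circ : ∀ n ∈ J, lab n = .circ
  eig : ∀ n ∈ J, dlog (π n) ∈ Ric (opU (dlog (ι τ)) α β) (lam α β .one ((n : ℤ) - s))
  lead : ∀ n ∈ J, HasLead (π n) (n - s) (c n)
  ode : ∀ n ∈ J, ∀ m ∈ J, xp * ∂ (r n m) + RatFunc.C (β + 1) * r n m
    = (1 - RatFunc.X) ^ α * (π n * π m)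
  rval : ∀ n ∈ J, ∀ m ∈ J, ValAt 1 (r n m) (if n = m then N n else 0)
  norm_ne : ∀ n ∈ J, N n ≠ 0
  loc : ∀ n ∈ J, LocAt (opU (dlog (ι τ)) α β) (lam α β .one ((n : ℤ) - s))

section ExcState

variable {τ : ℝ[X]} {α : ℕ} {β : ℝ} {s : ℤ} {J : Set ℕ} {lab : ℤ → Lab}
    {π : ℕ → RatFunc ℝ} {c N : ℕ → ℝ} {r : ℕ → ℕ → RatFunc ℝ}

theorem ExcState.tau_ne_zero (h : ExcState τ α β s J lab π c N r) : τ ≠ 0 :=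
  ne_zero_of_eval_ne_zero h.tau_one

theorem ExcState.iota_tau_ne_zero (h : ExcState τ α β s J lab π c N r) : ι τ ≠ 0 :=
  RatFunc.algebraMap_ne_zero h.tau_ne_zero

theorem ExcState.regularAt_one (h : ExcState τ α β s J lab π c N r) :
    RegularAt (dlog (ι τ)) 1 := (ValAt.poly 1 τ).dlog_regularAt h.tau_one

theorem ExcState.regularAt_neg_one (h : ExcState τ α β s J lab π c N r) :
    RegularAt (dlog (ι τ)) (-1) := (ValAt.poly (-1) τ).dlog_regularAt h.tau_neg_one

theorem ExcState.atInf_u (h : ExcState τ α β s J lab π c N r) :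
    AtInf (RatFunc.X * dlog (ι τ)) τ.natDegree :=
  atInf_X_mul_dlog_poly h.tau_ne_zero

theorem ExcState.pi_ne_zero (h : ExcState τ α β s J lab π c N r) {n : ℕ} (hn : n ∈ J) :
    π n ≠ 0 := (h.lead n hn).ne_zero

theorem ExcState.regularAt_dlog (h : ExcState τ α β s J lab π c N r) {n : ℕ} (hn : n ∈ J) :
    RegularAt (dlog (π n)) 1 := by
  have h1 := h.labels.ok n
  rw [h.lab_circ n hn] at h1
  obtain ⟨w, hS, -, hr⟩ := h1
  have h2 := h.eig n hn
  rw [hS, Set.mem_singleton_iff] at h2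
  rwa [h2]

theorem ExcState.exists_valAt (h : ExcState τ α β s J lab π c N r) {n : ℕ} (hn : n ∈ J) :
    ∃ y, y ≠ 0 ∧ ValAt 1 (π n) y :=
  exists_valAt_of_dlog_regularAt (h.pi_ne_zero hn) (h.regularAt_dlog hn)

theorem ExcState.exists_valAt_neg (h : ExcState τ α β s J lab π c N r) {n : ℕ} (hn : n ∈ J) :
    ∃ y, y ≠ 0 ∧ ValAt (-1) (π n) y :=
  exists_valAt_neg_one h.hβ h.regularAt_neg_one (h.pi_ne_zero hn) (h.eig n hn)

theorem ExcState.lam_ne (h : ExcState τ α β s J lab π c N r) {n k : ℕ} (hn : n ≠ k) :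
    lam α β .one ((n : ℤ) - s) ≠ lam α β .one ((k : ℤ) - s) := by
  intro h1
  have := lam_one_inj (α := α) h.hβ (m := n - s) (n := k - s) (by push_cast at h1 ⊢; exact h1)
  omega

/-- The numerators `τ f` of rational eigenfunctions without poles at `± 1` are polynomials. -/
theorem exists_poly_tau_mul {f : RatFunc ℝ} {μ : ℝ} {y z : ℝ} (hτ : τ ≠ 0) (hf : f ≠ 0)
    (h : dlog f ∈ Ric (opU (dlog (ι τ)) α β) μ) (h1 : ValAt 1 f y) (h2 : ValAt (-1) f z) :
    ∃ P : ℝ[X], ι P = ι τ * f ∧ P.eval 1 = τ.eval 1 * y ∧ P.eval (-1) = τ.eval (-1) * z := by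
  have e1 := (ValAt.poly 1 τ).mul h1
  have e2 := (ValAt.poly (-1) τ).mul h2
  obtain ⟨P, hP⟩ := exists_poly_of_regular e1.regularAt e2.regularAt
    (fun P hP hPx => regP_tau_mul hτ hf h hP hPx)
  refine ⟨P, hP.symm, ?_, ?_⟩
  · rw [hP] at e1; exact (ValAt.poly 1 P).unique e1
  · rw [hP] at e2; exact (ValAt.poly (-1) P).unique e2

theorem lam_one_darboux (α : ℕ) (β : ℝ) (n s : ℤ) :
    lam ((α + 1 : ℕ) : ℝ) (β + 1) .one (n - (s + 1 : ℤ)) = lam α β .one (n - s) - (α + β + 2) := by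
  simp only [lam]; push_cast; ring

theorem ratDeriv_one_sub_X_pow (α : ℕ) : ∂ ((1 - RatFunc.X) ^ (α + 1)) =
    -((α + 1 : ℕ) : RatFunc ℝ) * (1 - RatFunc.X) ^ α := by
  have h := ratDeriv_pow (1 - RatFunc.X) (α + 1)
  have h1 := one_sub_X_ne_zero
  rw [ratDeriv_sub, ratDeriv_one, ratDeriv_X, zero_sub] at h
  apply mul_right_cancel₀ h1
  rw [h]; push_cast; ring

/-- Integration by parts for the Darboux transformation. -/
theorem darboux_ode {w₀ y y' z z' ρ : RatFunc ℝ} {δ : ℝ} (hy : y' = darA w₀ y)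
    (hz : darB α β w₀ z' = RatFunc.C δ * z)
    (hρ : xp * ∂ ρ + RatFunc.C (β + 1) * ρ = (1 - RatFunc.X) ^ α * (y * z)) :
    xp * ∂ (xp⁻¹ * ((1 - RatFunc.X) ^ (α + 1) * (y * z') + RatFunc.C δ * ρ))
      + RatFunc.C (β + 1 + 1) * (xp⁻¹ * ((1 - RatFunc.X) ^ (α + 1) * (y * z') + RatFunc.C δ * ρ))
      = (1 - RatFunc.X) ^ (α + 1) * (y' * z') := by
  have h1 := X_sub_one_ne_zero
  have h2 := X_add_one_ne_zero
  rw [darB, QQ] at hz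
  rw [ratDeriv_mul, ratDeriv_inv, ratDeriv_add RatFunc.X, ratDeriv_X, ratDeriv_one,
    ratDeriv_add _ (RatFunc.C δ * ρ), ratDeriv_C_mul, ratDeriv_mul, ratDeriv_mul y,
    ratDeriv_one_sub_X_pow, hy, darA]
  simp only [map_add, map_one, map_natCast] at *
  push_cast at *
  field_simp
  linear_combination RatFunc.C δ * hρ - (1 - RatFunc.X) ^ α * y * hz

theorem ValAt.ne_zero {a y : ℝ} {f : RatFunc ℝ} (hf : ValAt a f y) (hy : y ≠ 0) : f ≠ 0 := by
  rintro rfl; exact hy (hf.unique (ValAt.zero a))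

/-- `ρ / (φ² (x - 1) (1 - x) ^ α)` is, up to the seed `φ`, the second quasi-rational solution of the
transformed equation at the eigenvalue of the seed. -/
def secondSol (α : ℕ) (φ ρ : RatFunc ℝ) : RatFunc ℝ :=
  ρ / (φ ^ 2 * (xm * (1 - RatFunc.X) ^ α))

theorem secondSol_ne_zero {α : ℕ} {φ ρ : RatFunc ℝ} (hφ : φ ≠ 0) (hρ : ρ ≠ 0) :
    secondSol α φ ρ ≠ 0 :=
  div_ne_zero hρ (mul_ne_zero (pow_ne_zero 2 hφ)
    (mul_ne_zero X_sub_one_ne_zero (pow_ne_zero _ one_sub_X_ne_zero)))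

theorem dlog_secondSol {α : ℕ} {φ ρ : RatFunc ℝ} (hφ : φ ≠ 0) (hρ : ρ ≠ 0) :
    dlog (secondSol α φ ρ) = (dlog ρ - (2 : ℕ) * dlog φ) - RatFunc.C ((α : ℝ) + 1) / xm := by
  have h1 := X_sub_one_ne_zero
  have h3 := one_sub_X_ne_zero
  rw [secondSol, dlog_div hρ (mul_ne_zero (pow_ne_zero 2 hφ) (mul_ne_zero h1 (pow_ne_zero _ h3))),
    dlog_mul (pow_ne_zero 2 hφ) (mul_ne_zero h1 (pow_ne_zero _ h3)),
    dlog_mul h1 (pow_ne_zero _ h3), dlog_pow, dlog_pow, dlog_xm, dlog_one_sub_X]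
  simp only [map_add, map_one, map_natCast]
  ring

/-- Reduction of order: the inhomogeneous equation is integrated by the anti-derivative of the
weighted square of the seed. -/
theorem inhom_of_ode {α : ℕ} {β : ℝ} {φ ρ : RatFunc ℝ} (hφ : φ ≠ 0) (hρ : ρ ≠ 0)
    (ho : xp * ∂ ρ + RatFunc.C (β + 1) * ρ = (1 - RatFunc.X) ^ α * (φ * φ)) :
    (RatFunc.X ^ 2 - 1) * ∂ (secondSol α φ ρ)
      + (2 * (RatFunc.X ^ 2 - 1) * dlog φ + QQ α β) * secondSol α φ ρ = 1 := by
  have h1 := X_sub_one_ne_zero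
  have h2 := X_add_one_ne_zero
  have h3 := one_sub_X_ne_zero
  have hdr : dlog ρ = ((1 - RatFunc.X) ^ α * (φ * φ) / ρ - RatFunc.C (β + 1)) / xp := by
    rw [dlog]; field_simp; linear_combination ho
  rw [ratDeriv_eq_mul_dlog (secondSol_ne_zero hφ hρ), dlog_secondSol hφ hρ, hdr, QQ, secondSol]
  simp only [map_add, map_one, map_natCast]
  push_cast
  have h4 := pow_ne_zero α h3
  generalize (1 - RatFunc.X : RatFunc ℝ) ^ α = E at *
  field_simp
  ring

/-- Both `φ` and `ρ` are units at `1`, the latter because its value there is a non-zero norm. The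
pole thus comes entirely from the factor `(x - 1)(1 - x)^α` in the denominator. -/
theorem hasRes_dlog_second {α : ℕ} {φ ρ : RatFunc ℝ} {y z : ℝ} (hy : y ≠ 0) (hφ : ValAt 1 φ y)
    (hz : z ≠ 0) (hρ : ValAt 1 ρ z) : HasRes (dlog (secondSol α φ ρ)) (-((α : ℝ) + 1)) := by
  have e2 : RegularAt ((2 : ℕ) * dlog φ) 1 := by
    rw [← dlog_pow]
    exact (hφ.pow 2).dlog_regularAt (pow_ne_zero 2 hy)
  have e3 := ((hρ.dlog_regularAt hz).sub e2).hasRes.sub (hasRes_C_div ((α : ℝ) + 1))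
  rw [dlog_secondSol (hφ.ne_zero hy) (hρ.ne_zero hz)]
  simpa using e3

/-- The new inner products come from integration by parts (`darboux_ode`). At `x = 1` the boundary
term contains `(1 - x)^(α + 1)` and vanishes, while `(1 + x)⁻¹` contributes the `1/2` in the norms.
The non-zero norm of the seed supplies the additional singular eigenfunction. -/
theorem ExcState.kStep (h : ExcState τ α β s J lab π c N r) {k : ℕ} (hk : k ∈ J) :
    ∃ τ' : ℝ[X], ι τ' = ι τ * π k ∧
      ExcState τ' (α + 1) (β + 1) (s + 1) (J \ {k}) (Function.update lab k .ast)
        (fun n => darA (dlog (π k)) (π n)) (fun n => c n * (n - k))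
        (fun n => (lam α β .one ((n : ℤ) - s) - lam α β .one ((k : ℤ) - s)) * N n / 2)
        (fun n m => xp⁻¹ * ((1 - RatFunc.X) ^ (α + 1) * (π n * darA (dlog (π k)) (π m))
          + RatFunc.C (lam α β .one ((m : ℤ) - s) - lam α β .one ((k : ℤ) - s)) * r n m)) := by
  have hk0 := h.pi_ne_zero hk
  obtain ⟨y₁, hy₁, hv₁⟩ := h.exists_valAt hk
  obtain ⟨y₂, hy₂, hv₂⟩ := h.exists_valAt_neg hk
  have hek := h.eig k hk
  have hrk := h.regularAt_dlog hk
  obtain ⟨τ', hτ', hτ1, hτ2⟩ := exists_poly_tau_mul h.tau_ne_zero hk0 hek hv₁ hv₂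
  have hu : dlog (ι τ') = dlog (ι τ) + dlog (π k) := by
    rw [hτ', dlog_mul h.iota_tau_ne_zero hk0]
  have hα : ((α + 1 : ℕ) : ℝ) = (α : ℝ) + 1 := by push_cast; ring
  have hBA : ∀ n ∈ J, darB α β (dlog (π k)) (darA (dlog (π k)) (π n)) =
      RatFunc.C (lam α β .one ((n : ℤ) - s) - lam α β .one ((k : ℤ) - s)) * π n := by
    intro n hn
    rw [← darB_darA hek, (apply_opU_iff (h.pi_ne_zero hn)).2 (h.eig n hn), map_sub]
    ring
  have heig : ∀ n ∈ J \ {k}, dlog (darA (dlog (π k)) (π n)) ∈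
      Ric (opU (dlog (ι τ')) ((α + 1 : ℕ) : ℝ) (β + 1))
        (lam ((α + 1 : ℕ) : ℝ) (β + 1) .one ((n : ℤ) - (s + 1 : ℤ))) := by
    intro n hn
    have hne := h.lam_ne (n := n) (k := k) hn.2
    have hd := darboux_ne hek hne (h.eig n hn.1)
    rw [lam_one_darboux, hu, hα, darA_eq_mul (h.pi_ne_zero hn.1),
      dlog_mul (h.pi_ne_zero hn.1) hd]
    exact darboux_mem hek hne (h.eig n hn.1)
  refine ⟨τ', hτ', ?_, ?_, ?_, ?_, ?_, heig, ?_, ?_, ?_, ?_, ?_⟩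
  · intro m hm
    exact h.hβ (m - 1) (by push_cast; linarith)
  · rw [hτ1]; exact mul_ne_zero h.tau_one hy₁
  · rw [hτ2]; exact mul_ne_zero h.tau_neg_one hy₂
  · rw [hu]
    have hrv := h.rval k hk k hk
    rw [if_pos rfl] at hrv
    refine h.labels.kStep h.hβ h.regularAt_one (h.lab_circ k hk) hk0 hek
      (inhom_of_ode hk0 (hrv.ne_zero (h.norm_ne k hk)) (h.ode k hk k hk)) ?_
    rw [(hasRes_dlog_second hy₁ hv₁ (h.norm_ne k hk) hrv).regularAt_iff]
    have : (0 : ℝ) ≤ α := Nat.cast_nonneg α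
    intro h5; linarith
  · intro n hn
    have : (n : ℤ) ≠ k := by exact_mod_cast hn.2
    rw [Function.update_of_ne this]
    exact h.lab_circ n hn.1
  · intro n hn
    have h1 := (h.lead k hk).atInf_X_mul_dlog
    have h2 := (h.lead n hn.1).darA h1 (by
      have : (n : ℤ) ≠ k := by exact_mod_cast hn.2
      omega)
    have e : (n : ℤ) - s - 1 = n - (s + 1) := by ring
    rw [e] at h2
    convert h2 using 2
    push_cast; ring
  · intro n hn m hm
    exact darboux_ode rfl (hBA m hm.1) (h.ode n hn.1 m hm.1)
  · intro n hn m hm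
    have hne := h.lam_ne (n := m) (k := k) hm.2
    have hd := darboux_ne hek hne (h.eig m hm.1)
    obtain ⟨y, -, hy⟩ := h.exists_valAt hn.1
    have hA : RegularAt (darA (dlog (π k)) (π m)) 1 := by
      obtain ⟨z, -, hz⟩ := h.exists_valAt hm.1
      exact hz.regularAt.ratDeriv.sub (hrk.mul hz.regularAt)
    have h1 := (valAt_xp.inv two_ne_zero).mul (((((ValAt.one 1).sub (ValAt.var 1)).pow (α + 1)).mul
      (hy.mul hA.valAt)).add ((ValAt.const 1
        (lam α β .one ((m : ℤ) - s) - lam α β .one ((k : ℤ) - s))).mul (h.rval n hn.1 m hm.1)))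
    convert h1 using 1
    rw [sub_self, zero_pow (Nat.succ_ne_zero α), zero_mul, zero_add]
    rcases eq_or_ne n m with rfl | hnm
    · simp only [if_true]; ring
    · simp [hnm]
  · intro n hn
    exact div_ne_zero (mul_ne_zero (sub_ne_zero.2 (h.lam_ne hn.2)) (h.norm_ne n hn.1)) two_ne_zero
  · intro n hn
    rw [lam_one_darboux, hu, hα]
    exact (h.loc n hn.1).darboux hek hrk (h.lam_ne hn.2)
end ExcState

/-! ### The confluent transformation -/

section ExcState

variable {τ : ℝ[X]} {α : ℕ} {β : ℝ} {s : ℤ} {J : Set ℕ} {lab : ℤ → Lab}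
    {π : ℕ → RatFunc ℝ} {c N : ℕ → ℝ} {r : ℕ → ℕ → RatFunc ℝ}

theorem ExcState.r_symm (h : ExcState τ α β s J lab π c N r) {n m : ℕ} (hn : n ∈ J)
    (hm : m ∈ J) : r n m = r m n := by
  rw [← sub_eq_zero]
  refine eq_zero_of_xp_ode (c := β + 1) (fun k hk => h.hβ (k - 1) (by push_cast; linarith)) ?_
  rw [ratDeriv_sub]
  linear_combination h.ode n hn m hm - h.ode m hm n hn

/-- The Wronskian of two eigenfunctions in terms of their incomplete inner product. -/
theorem ExcState.wronskian (h : ExcState τ α β s J lab π c N r) {n m : ℕ} (hn : n ∈ J)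
    (hm : m ∈ J) :
    xm * (1 - RatFunc.X) ^ α * (π n * darA (dlog (π n)) (π m)) =
      RatFunc.C (lam α β .one ((m : ℤ) - s) - lam α β .one ((n : ℤ) - s)) * r n m := by
  have e := h.eig n hn
  have hn0 := h.pi_ne_zero hn
  have hBA : darB α β (dlog (π n)) (darA (dlog (π n)) (π m)) =
      RatFunc.C (lam α β .one ((m : ℤ) - s) - lam α β .one ((n : ℤ) - s)) * π m := by
    rw [← darB_darA e, (apply_opU_iff (h.pi_ne_zero hm)).2 (h.eig m hm), map_sub]
    ring
  -- Taking the first function equal to the seed makes its transform zero, so the boundary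
  -- expression solves a homogeneous equation and must vanish.
  have h1 := darboux_ode rfl hBA (h.ode n hn m hm)
  rw [darA_self, zero_mul, mul_zero] at h1
  have h2 := eq_zero_of_xp_ode (fun k hk => h.hβ (k - 2) (by push_cast; linarith)) h1
  have h3 := (mul_eq_zero.1 h2).resolve_left (inv_ne_zero X_add_one_ne_zero)
  rw [pow_succ] at h3
  linear_combination -h3

theorem darA_dlog_mul {f : RatFunc ℝ} (hf : f ≠ 0) (t : RatFunc ℝ) :
    darA (dlog f) (f * t) = f * ∂ t := by
  unfold darA dlog
  rw [ratDeriv_mul]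
  field_simp
  ring

/-- A second solution of the inhomogeneous equation after a Darboux transformation would produce a
polar function whose image under `T - μ₀` is regular. -/
theorem apply_of_inhom {u φ κ ζ : RatFunc ℝ} {α β μ₀ : ℝ} (hφ : φ ≠ 0) (hκ0 : κ ≠ 0)
    (h : dlog φ ∈ Ric (opU u α β) μ₀)
    (hκ : (RatFunc.X ^ 2 - 1) * ∂ κ + (2 * (RatFunc.X ^ 2 - 1) * dlog φ + QQ α β) * κ = 1)
    (hζ : (RatFunc.X ^ 2 - 1) * ∂ ζ
      + (2 * (RatFunc.X ^ 2 - 1) * dlog (φ * κ) + QQ (α + 1) (β + 1)) * ζ = 1) :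
    (opU u α β).apply (φ * ((RatFunc.X ^ 2 - 1) * (κ * ζ))) - RatFunc.C μ₀
        * (φ * ((RatFunc.X ^ 2 - 1) * (κ * ζ))) =
      φ * (1 - (RatFunc.X ^ 2 - 1) * ∂ ζ
        - (2 * (RatFunc.X ^ 2 - 1) * dlog φ + QQ α β) * ζ) := by
  have hQ : QQ (α + 1) (β + 1) = QQ α β + 2 * RatFunc.X := by
    simp only [QQ, map_add, map_one]; ring
  -- A Wronskian identity for the two inhomogeneous equations; consequently `A` maps the polar
  -- function to `φ (κ - ζ)`, in which the singular part `κ` is annihilated by `B` up to a regular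
  -- remainder.
  have hη : ∂ ((RatFunc.X ^ 2 - 1) * (κ * ζ)) = κ - ζ := by
    rw [dlog_mul hφ hκ0, hQ] at hζ
    have e : κ * dlog κ = ∂ κ := (ratDeriv_eq_mul_dlog hκ0).symm
    rw [ratDeriv_mul, ratDeriv_mul, ratDeriv_sq_X_sub_one]
    linear_combination κ * hζ - ζ * hκ - 2 * (RatFunc.X ^ 2 - 1) * ζ * e
  rw [darB_darA h, darA_dlog_mul hφ, hη]
  have e : ∂ φ = φ * dlog φ := ratDeriv_eq_mul_dlog hφ
  rw [darB, ratDeriv_mul, ratDeriv_sub, e]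
  linear_combination φ * hκ

/-- This excludes a second eigenfunction after the confluent step. The order of a solution `ζ` at
`1` must be zero. For `α = 0` its equation fails at `1`; for `α > 0` it would give a function with a
pole of order `α` whose image under `T - μ₀` is regular, against the local condition. -/
theorem inhom_not_solvable {u φ ρ ζ : RatFunc ℝ} {μ₀ y N : ℝ}
    (h : dlog φ ∈ Ric (opU u α β) μ₀) (hloc : LocAt (opU u α β) μ₀)
    (hy : y ≠ 0) (hφ : ValAt 1 φ y) (hN : N ≠ 0) (hρ : ValAt 1 ρ N)
    (ho : xp * ∂ ρ + RatFunc.C (β + 1) * ρ = (1 - RatFunc.X) ^ α * (φ * φ)) :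
    (RatFunc.X ^ 2 - 1) * ∂ ζ + (2 * (RatFunc.X ^ 2 - 1) * dlog (φ * secondSol α φ ρ)
      + QQ ((α : ℝ) + 1) (β + 1)) * ζ ≠ 1 := by
  intro hζ
  have h1 := X_sub_one_ne_zero
  have hφ0 := hφ.ne_zero hy
  have hρ0 := hρ.ne_zero hN
  have hκ0 := secondSol_ne_zero (α := α) hφ0 hρ0
  have hκ := inhom_of_ode hφ0 hρ0 ho
  have hA := apply_of_inhom hφ0 hκ0 h hκ hζ
  have hζ0 : ζ ≠ 0 := by
    rintro rfl
    rw [ratDeriv_zero, mul_zero, mul_zero, add_zero] at hζ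
    exact zero_ne_one hζ
  have hres : HasRes (dlog (φ * secondSol α φ ρ)) (-((α : ℝ) + 1)) := by
    rw [dlog_mul hφ0 hκ0]
    simpa using (hφ.dlog_regularAt hy).hasRes.add (hasRes_dlog_second (α := α) hy hφ hN hρ)
  obtain ⟨v, hv, hv'⟩ := hres
  obtain ⟨k, g, t, ht, hg, hk⟩ := exists_order_one hζ0
  have hg0 := hg.ne_zero ht
  -- Substituting `ζ = (x - 1)^k g` turns the equation into `(x - 1)^k G = 1`, and `G` takes the
  -- value `2 t (k - α)` at `1`. A negative `k` would require `k = α`, a positive one `0 = 1`.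
  set G := xp * (RatFunc.C (k : ℝ) * g + xm * ∂ g)
    + (2 * xp * (RatFunc.C (-((α : ℝ) + 1)) + xm * v)
      + (RatFunc.C ((α : ℝ) + 1 + 1) * xp + RatFunc.C (β + 1 + 1) * xm)) * g with hG
  have hkG : xm ^ k * G = 1 := by
    have e : ∂ ζ = xm ^ k * (k / xm * g + ∂ g) := by
      rw [hk, ratDeriv_mul, ratDeriv_eq_mul_dlog (zpow_ne_zero k h1), dlog_zpow, dlog_xm]
      ring
    rw [hv', e, QQ] at hζ
    conv at hζ => lhs; rw [hk]
    refine Eq.trans ?_ hζ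
    rw [hG]
    simp only [map_intCast]
    field_simp
    ring
  have two : ValAt 1 (2 : RatFunc ℝ) 2 := by
    rw [← ratC_two]; exact ValAt.const 1 2
  have hGv := (valAt_xp.mul (((ValAt.const 1 (k : ℝ)).mul hg).add
    (valAt_xm.mul hg.regularAt.ratDeriv.valAt))).add
    ((((two.mul valAt_xp).mul ((ValAt.const 1 (-((α : ℝ) + 1))).add (valAt_xm.mul hv.valAt))).add
      (((ValAt.const 1 ((α : ℝ) + 1 + 1)).mul valAt_xp).add
        ((ValAt.const 1 (β + 1 + 1)).mul valAt_xm))).mul hg)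
  rw [← hG] at hGv
  have hα : (0 : ℝ) ≤ α := Nat.cast_nonneg α
  have hk0 : k = 0 := by
    rcases lt_trichotomy k 0 with hlt | h0 | hgt
    · exfalso
      obtain ⟨j, hj⟩ : ∃ j : ℕ, -k = (j + 1 : ℕ) := ⟨(-k - 1).toNat, by omega⟩
      have e : G = xm ^ (j + 1) := by
        rw [← zpow_natCast, ← hj, zpow_neg]
        have := zpow_ne_zero k h1
        field_simp; linear_combination hkG
      rw [e] at hGv
      have h5 := hGv.unique (valAt_xm.pow (j + 1))
      rw [zero_pow (Nat.succ_ne_zero j)] at h5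
      have h6 : 2 * t * (k - α) = 0 := by linarith
      have h7 : (k : ℝ) < 0 := by exact_mod_cast hlt
      rcases mul_eq_zero.1 h6 with h8 | h8
      · exact ht (by linarith)
      · linarith
    · exact h0
    · exfalso
      obtain ⟨j, hj⟩ : ∃ j : ℕ, k = (j + 1 : ℕ) := ⟨(k - 1).toNat, by omega⟩
      have e := (valAt_xm.pow (j + 1)).mul hGv
      rw [← zpow_natCast, ← hj, hkG] at e
      have := e.unique (ValAt.one 1)
      rw [zero_pow (Nat.succ_ne_zero j), zero_mul] at this
      exact zero_ne_one this
  subst hk0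
  rw [zpow_zero, one_mul] at hkG hk
  rw [hkG] at hGv
  subst hk
  have h5 := hGv.unique (ValAt.one 1)
  have hα1 : α ≠ 0 := by
    rintro rfl
    push_cast at h5
    linarith
  have hwr := hφ.dlog_regularAt hy
  have two' := two.regularAt
  have hreg := hloc _ (by
    rw [hA]
    exact hφ.regularAt.mul (((regularAt_one 1).sub (regularAt_sq_X_sub_one.mul
      hg.regularAt.ratDeriv)).sub ((((two'.mul regularAt_sq_X_sub_one).mul hwr).add
      (regularAt_QQ α β)).mul hg.regularAt)))
  have hE : ValAt 1 ((1 - RatFunc.X : RatFunc ℝ) ^ α) 0 := by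
    have := ((ValAt.one 1).sub (ValAt.var 1)).pow α
    rwa [sub_self, zero_pow hα1] at this
  have h6 := hreg.valAt.mul hE
  have h7 := (((valAt_xp.mul hρ).mul hg).div hφ hy)
  -- After multiplication by `(1 - x)^α` the value at `1` is non-zero, yet regularity of the other
  -- factors would make it zero.
  have e : φ * ((RatFunc.X ^ 2 - 1) * (secondSol α φ ρ * ζ)) * (1 - RatFunc.X) ^ α
      = xp * ρ * ζ / φ := by
    have h4 := pow_ne_zero α one_sub_X_ne_zero
    unfold secondSol
    field_simp
    ring
  rw [e, mul_zero] at h6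
  have h8 := h7.unique h6
  exact div_ne_zero (mul_ne_zero (mul_ne_zero two_ne_zero hN) ht) hy h8

end ExcState

/-- The leading term of an anti-derivative. -/
theorem hasLead_of_xp_ode {r g : RatFunc ℝ} {c k : ℝ} {d : ℤ} (hc : ∀ m : ℤ, c ≠ m)
    (hg : HasLead g d k) (h : xp * ∂ r + RatFunc.C c * r = g) :
    HasLead r d (k / (d + c)) := by
  have hr : r ≠ 0 := by
    rintro rfl
    rw [ratDeriv_zero, mul_zero, mul_zero, add_zero] at h
    exact hg.ne_zero h.symm
  have hl := hasLead_self hr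
  have hX := ratX_ne_zero
  have hne : (r.intDegree : ℝ) + c ≠ 0 := fun h => hc (-r.intDegree) (by push_cast; linarith)
  have one : AtInf 1 1 := by simpa using AtInf.const 1
  have h1 := hl.2.mul (((one.add atInf_inv_X).mul hl.atInf_X_mul_dlog).add (AtInf.const c))
  have h2 : HasLead g r.intDegree (r.num.leadingCoeff * (r.intDegree + c)) := by
    refine ⟨mul_ne_zero hl.1 hne, ?_⟩
    convert h1 using 1
    · rw [← h, ratDeriv_eq_mul_dlog hr]
      field_simp
    · ring
  obtain ⟨rfl, rfl⟩ := h2.unique hg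
  rw [mul_div_cancel_right₀ _ hne]
  exact hl

section ExcState

variable {τ : ℝ[X]} {α : ℕ} {β : ℝ} {s : ℤ} {J : Set ℕ} {lab : ℤ → Lab}
    {π : ℕ → RatFunc ℝ} {c N : ℕ → ℝ} {r : ℕ → ℕ → RatFunc ℝ}

theorem ExcState.exists_hasLead_r (h : ExcState τ α β s J lab π c N r) {k : ℕ} (hk : k ∈ J) :
    ∃ y, HasLead (r k k) (2 * (k - s) + α) y := by
  have h1 := (hasLead_one_sub_X.pow α).mul ((h.lead k hk).mul (h.lead k hk))
  have h2 := hasLead_of_xp_ode (fun m hm => h.hβ (m - 1) (by push_cast; linarith)) h1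
    (h.ode k hk k hk)
  exact ⟨_, by convert h2 using 1; ring⟩

/-- The quotient rule: subtracting a rank one term from an inner product amounts to replacing both
functions by their projections along `f`. The extra `(1 + x)⁻²` matches the increase of `β` by two.
-/
theorem xp_mul_ode {α : ℕ} {β : ℝ} {p q f x y z w ρ : RatFunc ℝ} (hρ : ρ ≠ 0)
    (hx : xp * ∂ x + RatFunc.C (β + 1) * x = (1 - RatFunc.X) ^ α * (p * q))
    (hy : xp * ∂ y + RatFunc.C (β + 1) * y = (1 - RatFunc.X) ^ α * (p * f))
    (hz : xp * ∂ z + RatFunc.C (β + 1) * z = (1 - RatFunc.X) ^ α * (f * q))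
    (hw : xp * ∂ ρ + RatFunc.C (β + 1) * ρ = (1 - RatFunc.X) ^ α * (f * f))
    (hpw : w = y) :
    xp * ∂ (xp⁻¹ ^ 2 * (x - y * z / ρ)) + RatFunc.C (β + 2 + 1) * (xp⁻¹ ^ 2 * (x - y * z / ρ)) =
      (1 - RatFunc.X) ^ α * ((xp⁻¹ * (p - f * (w / ρ))) * (xp⁻¹ * (q - f * (z / ρ)))) := by
  have h2 := X_add_one_ne_zero
  subst hpw
  have e : ∀ {u v : RatFunc ℝ}, xp * ∂ u + RatFunc.C (β + 1) * u = v →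
      ∂ u = (v - RatFunc.C (β + 1) * u) / xp := by
    intro u v h; rw [eq_div_iff h2]; linear_combination h
  rw [pow_two, ratDeriv_mul, ratDeriv_mul xp⁻¹, ratDeriv_inv, ratDeriv_add RatFunc.X,
    ratDeriv_X, ratDeriv_one, ratDeriv_sub, ratDeriv_quot _ _ hρ, ratDeriv_mul, e hx, e hy, e hz,
    e hw]
  simp only [map_add, map_one, ratC_two]
  generalize (1 - RatFunc.X : RatFunc ℝ) ^ α = E
  field_simp
  ring

/-- Two Darboux transformations at the same eigenvalue are composed, the second seeded by the
singular solution created by the first. The composite is a projection along `π k` in terms of `r`.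
Orthogonality makes the correction to the inner products vanish at `1`, so only the factor `(1 +
x)⁻²`, equal to `1/4`, changes the norms. -/
theorem ExcState.lStep (h : ExcState τ α β s J lab π c N r) {k : ℕ} (hk : k ∈ J) :
    ∃ τ' : ℝ[X], ι τ' = ι τ * r k k ∧
      ExcState τ' α (β + 2) (s + 1) (J \ {k}) (Function.update lab k .minus)
        (fun n => xp⁻¹ * (π n - π k * (r k n / r k k)))
        (fun n => c n * (n - k) / (n + k - 2 * s + α + β + 1))
        (fun n => N n / 4)
        (fun n m => xp⁻¹ ^ 2 * (r n m - r n k * r k m / r k k)) := by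
  obtain ⟨τ₁, hτ₁, h1⟩ := h.kStep hk
  have hx1 := X_sub_one_ne_zero
  have hx2 := X_add_one_ne_zero
  have hx3 := one_sub_X_ne_zero
  have hE := pow_ne_zero α hx3
  have hφ := h.pi_ne_zero hk
  obtain ⟨y₁, hy₁, hv₁⟩ := h.exists_valAt hk
  obtain ⟨y₂, hy₂, hv₂⟩ := h.exists_valAt_neg hk
  have hρv := h.rval k hk k hk
  rw [if_pos rfl] at hρv
  have hN := h.norm_ne k hk
  have hρ := hρv.ne_zero hN
  have hode := h.ode k hk k hk
  have hκ := secondSol_ne_zero (α := α) hφ hρ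
  have hinh := inhom_of_ode hφ hρ hode
  have hα : ((α + 1 : ℕ) : ℝ) = (α : ℝ) + 1 := by push_cast; ring
  have hβ1 : ∀ m : ℤ, β + 1 ≠ m := fun m hm => h.hβ (m - 1) (by push_cast; linarith)
  obtain ⟨ψ, hψe⟩ : ∃ ψ, ψ = π k * secondSol α (π k) (r k k) := ⟨_, rfl⟩
  have hψ : ψ ≠ 0 := hψe ▸ mul_ne_zero hφ hκ
  have hψs : ψ = r k k / (π k * (xm * (1 - RatFunc.X) ^ α)) := by
    rw [hψe, secondSol]; field_simp
  have hu₁ : dlog (ι τ₁) = dlog (ι τ) + dlog (π k) := by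
    rw [hτ₁, dlog_mul h.iota_tau_ne_zero hφ]
  have hψm : dlog ψ ∈ Ric (opU (dlog (ι τ₁)) ((α + 1 : ℕ) : ℝ) (β + 1))
      (lam ((α + 1 : ℕ) : ℝ) (β + 1) .one (k - (s + 1 : ℤ))) := by
    have e := lam_one_darboux α β k s
    push_cast at e ⊢
    rw [e, hu₁]
    have h2 := (mem_Ric_darboux_self (h.eig k hk)).2
      (Or.inr ⟨secondSol α (π k) (r k k), hinh, dlog_mul hφ hκ⟩)
    rw [hψe]
    push_cast at h2
    exact h2
  have hres : HasRes (dlog ψ) (-((α + 1 : ℕ) : ℝ)) := by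
    rw [hψe, dlog_mul hφ hκ, hα]
    simpa using (h.regularAt_dlog hk).hasRes.add (hasRes_dlog_second (α := α) hy₁ hv₁ hN hρv)
  -- The poles at `1` and the factors `π k` cancel, so the polynomial after both transformations is
  -- `τ r k k`.
  have hu' : dlog (ι τ₁) + dlog ψ + RatFunc.C ((α + 1 : ℕ) : ℝ) / xm = dlog (ι τ * r k k) := by
    rw [hu₁, hψe, dlog_mul hφ hκ, dlog_secondSol hφ hρ, hα, dlog_mul h.iota_tau_ne_zero hρ]
    push_cast
    ring
  have hρr : RegularAt (r k k) (-1) := by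
    refine regularAt_of_xp_ode hβ1 ?_ hode
    exact ((((ValAt.one (-1)).sub (ValAt.var (-1))).pow α).mul (hv₂.mul hv₂)).regularAt
  obtain ⟨y₃, hy₃, hv₃⟩ : ∃ y, y ≠ 0 ∧ ValAt (-1) (r k k) y := by
    refine ⟨_, ?_, hρr.valAt⟩
    intro h0
    have e1 := (valAt_neg_xp.mul hρr.ratDeriv.valAt).add
      ((ValAt.const (-1) (β + 1)).mul hρr.valAt)
    rw [hode, h0] at e1
    have e2 := e1.unique ((((ValAt.one (-1)).sub (ValAt.var (-1))).pow α).mul (hv₂.mul hv₂))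
    rw [mul_zero, zero_mul, add_zero] at e2
    have : (1 - -1 : ℝ) ^ α ≠ 0 := pow_ne_zero _ (by norm_num)
    exact mul_ne_zero this (mul_ne_zero hy₂ hy₂) e2.symm
  have e1 := (ValAt.poly 1 τ).mul hρv
  have e2 := (ValAt.poly (-1) τ).mul hv₃
  -- Away from `± 1` this is a numerator of the singular seed for `τ₁`; multiplying it by `(x - 1)(1
  -- - x)^α` gives `τ r k k`.
  obtain ⟨τ', hτ'⟩ := exists_poly_of_regular e1.regularAt e2.regularAt (fun P hP hPx => by
    have h2 := (regP_tau_mul h1.tau_ne_zero hψ hψm hP hPx).mul hP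
      (regP_poly hP ((X - 1) * (1 - X) ^ α))
    have h3 : ι τ₁ * ψ * ι ((X - 1) * (1 - X) ^ α) = ι τ * r k k := by
      rw [hτ₁, hψs]
      simp only [map_mul, map_sub, map_one, map_pow, RatFunc.algebraMap_X]
      field_simp
    rwa [h3] at h2)
  have hst : ∀ n : ℤ, lam α (β + 2) .one (n - (s + 1 : ℤ)) =
      lam ((α + 1 : ℕ) : ℝ) (β + 1) .one (n - (s + 1 : ℤ)) := by
    intro n; simp only [lam]; push_cast; ring
  have hyψ : ∀ n ∈ J, darA (dlog (π k)) (π n) = ψ * (RatFunc.C (lam α β .one ((n : ℤ) - s)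
      - lam α β .one ((k : ℤ) - s)) * (r k n / r k k)) := by
    intro n hn
    have hw := h.wronskian hk hn
    rw [hψs]
    field_simp
    linear_combination hw
  -- The first transform is the seed `ψ` times a quotient of inner products, by the Wronskian
  -- identity; the second transformation differentiates that quotient, which gives the closed
  -- formula.
  have hkey : ∀ n ∈ J, xm * darA (dlog ψ) (darA (dlog (π k)) (π n)) =
      RatFunc.C (lam α β .one ((n : ℤ) - s) - lam α β .one ((k : ℤ) - s))
        * (xp⁻¹ * (π n - π k * (r k n / r k k))) := by
    intro n hn
    rw [hyψ n hn, darA_dlog_mul hψ, ratDeriv_C_mul, ratDeriv_quot _ _ hρ]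
    have o1 := h.ode k hk n hn
    generalize RatFunc.C (lam α β .one ((n : ℤ) - s) - lam α β .one ((k : ℤ) - s)) = δ
    have e : ∀ {u v : RatFunc ℝ}, xp * ∂ u + RatFunc.C (β + 1) * u = v →
        ∂ u = (v - RatFunc.C (β + 1) * u) / xp := by
      intro u v h; rw [eq_div_iff hx2]; linear_combination h
    rw [e o1, e hode, hψs]
    generalize (1 - RatFunc.X : RatFunc ℝ) ^ α = E at *
    field_simp
    ring
  have hlamC : ∀ n ∈ J \ {k}, lam ((α + 1 : ℕ) : ℝ) (β + 1) .one ((n : ℤ) - (s + 1 : ℤ)) ≠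
      lam ((α + 1 : ℕ) : ℝ) (β + 1) .one (k - (s + 1 : ℤ)) := by
    intro n hn
    have := h1.lam_ne (n := n) (k := k) hn.2
    push_cast at this ⊢
    exact this
  have hδ : ∀ n ∈ J \ {k}, lam α β .one ((n : ℤ) - s) - lam α β .one ((k : ℤ) - s) ≠ 0 :=
    fun n hn => sub_ne_zero.2 (h.lam_ne hn.2)
  have hlead : ∀ n ∈ J \ {k}, HasLead (xp⁻¹ * (π n - π k * (r k n / r k k)))
      (n - (s + 1)) (c n * (n - k) / (n + k - 2 * s + α + β + 1)) := by
    intro n hn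
    obtain ⟨y, hy⟩ := h.exists_hasLead_r hk
    have l1 := hy.div ((h.lead k hk).mul (hasLead_xm.mul (hasLead_one_sub_X.pow α)))
    rw [← hψs] at l1
    have hnk : (n : ℤ) ≠ k := by exact_mod_cast hn.2
    have l2 := (h1.lead n hn).darA l1.atInf_X_mul_dlog (by omega)
    have l3 := (hasLead_xm.mul l2).C_mul (inv_ne_zero (hδ n hn))
    have hC : (RatFunc.C (lam α β .one ((n : ℤ) - s) - lam α β .one ((k : ℤ) - s))
        : RatFunc ℝ) ≠ 0 := by
      rw [_root_.map_ne_zero]; exact hδ n hn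
    rw [hkey n hn.1, map_inv₀, ← mul_assoc, inv_mul_cancel₀ hC, one_mul] at l3
    convert l3 using 1
    · ring
    · have h4 := hδ n hn
      have h5 : lam α β .one ((n : ℤ) - s) - lam α β .one ((k : ℤ) - s) =
          (n - k) * (n + k - 2 * s + α + β + 1) := by
        simp only [lam]; push_cast; ring
      rw [h5] at h4 ⊢
      have h6 := left_ne_zero_of_mul h4
      have h7 := right_ne_zero_of_mul h4
      push_cast
      field_simp
      ring
  have heig : ∀ n ∈ J \ {k}, dlog (xp⁻¹ * (π n - π k * (r k n / r k k))) ∈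
      Ric (opU (dlog (ι τ')) α (β + 2)) (lam α (β + 2) .one ((n : ℤ) - (s + 1 : ℤ))) := by
    intro n hn
    have hm := h1.eig n hn
    have hy0 := h1.pi_ne_zero hn
    have hd := darboux_ne hψm (hlamC n hn) hm
    have h2 := darboux_mem hψm (hlamC n hn) hm
    have h3 : dlog (darA (dlog (π k)) (π n)) + dlog (dlog (darA (dlog (π k)) (π n)) - dlog ψ) =
        dlog (xp⁻¹ * (π n - π k * (r k n / r k k))) - 1 / xm := by
      rw [← dlog_C_mul (hδ n hn) (hlead n hn).ne_zero, ← hkey n hn.1, darA_eq_mul hy0,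
        dlog_mul hx1 (mul_ne_zero hy0 hd), dlog_mul hy0 hd, dlog_xm]
      ring
    rw [h3, gauge_mul_xm] at h2
    rw [hst, ← hτ', ← hu']
    convert h2 using 2
    · rw [hα]; ring_nf
    · ring
  refine ⟨τ', hτ'.symm, ?_, ?_, ?_, ?_, ?_, heig, ?_, ?_, ?_, ?_, ?_⟩
  · intro m hm
    exact h.hβ (m - 2) (by push_cast; linarith)
  · rw [hτ'] at e1
    rw [(ValAt.poly 1 τ').unique e1]; exact mul_ne_zero h.tau_one hN
  · rw [hτ'] at e2
    rw [(ValAt.poly (-1) τ').unique e2]; exact mul_ne_zero h.tau_neg_one hy₃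
  · have h2 := h1.labels.mStep hβ1 h1.regularAt_one (by rw [Function.update_self]) hψ hψm
      (fun z => by rw [hψe, hα]; exact inhom_not_solvable (h.eig k hk) (h.loc k hk) hy₁ hv₁ hN hρv hode)
    rw [Function.update_idem, hu', hτ'] at h2
    convert h2 using 1
    ring
  · intro n hn
    have : (n : ℤ) ≠ k := by exact_mod_cast hn.2
    rw [Function.update_of_ne this]
    exact h.lab_circ n hn.1
  · exact hlead
  · intro n hn m hm
    exact xp_mul_ode hρ (h.ode n hn.1 m hm.1) (h.ode n hn.1 k hk) (h.ode k hk m hm.1) hode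
      (h.r_symm hk hn.1)
  · intro n hn m hm
    have hnk : n ≠ k := hn.2
    have hmk : k ≠ m := fun h => hm.2 h.symm
    have r1 := h.rval n hn.1 m hm.1
    have r2 := h.rval n hn.1 k hk
    have r3 := h.rval k hk m hm.1
    rw [if_neg hnk] at r2
    rw [if_neg hmk] at r3
    have h2 := ((valAt_xp.inv two_ne_zero).pow 2).mul (r1.sub ((r2.mul r3).div hρv hN))
    convert h2 using 1
    split_ifs <;> norm_num
    ring
  · intro n hn
    exact div_ne_zero (h.norm_ne n hn.1) (by norm_num)
  · intro n hn
    have h2 := (h1.loc n hn).darboux_of_pole hψm hres (hlamC n hn)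
    rw [hst, ← hτ', ← hu']
    convert h2 using 2
    · rw [hα]; ring
    · ring

/-- Rescaling the eigenfunctions. -/
theorem ExcState.rescale (h : ExcState τ α β s J lab π c N r) {k : ℕ → ℝ}
    (hk : ∀ n ∈ J, k n ≠ 0) :
    ExcState τ α β s J lab (fun n => RatFunc.C (k n) * π n) (fun n => k n * c n)
      (fun n => k n ^ 2 * N n) (fun n m => RatFunc.C (k n * k m) * r n m) := by
  refine ⟨h.hβ, h.tau_one, h.tau_neg_one, h.labels, h.lab_circ, ?_, ?_, ?_, ?_, ?_, h.loc⟩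
  · intro n hn
    rw [dlog_C_mul (hk n hn) (h.pi_ne_zero hn)]
    exact h.eig n hn
  · intro n hn
    exact (h.lead n hn).C_mul (hk n hn)
  · intro n hn m hm
    rw [ratDeriv_C_mul, map_mul]
    linear_combination RatFunc.C (k n) * RatFunc.C (k m) * h.ode n hn m hm
  · intro n hn m hm
    have := (ValAt.const 1 (k n * k m)).mul (h.rval n hn m hm)
    convert this using 1
    split_ifs with hnm
    · subst hnm; ring
    · ring
  · intro n hn
    exact mul_ne_zero (pow_ne_zero 2 (hk n hn)) (h.norm_ne n hn)

end ExcState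

/-! ### The Jacobi equation -/

theorem choose_succ_mul (r : ℝ) (m : ℕ) :
    Ring.choose r (m + 1) * (m + 1) = Ring.choose r m * (r - m) := by
  rw [Ring.choose_eq_smul, Ring.choose_eq_smul, descPochhammer_succ_right, smeval_mul,
    smeval_sub, smeval_X, smeval_natCast, Nat.factorial_succ]
  have h1 : (m.factorial : ℝ) ≠ 0 := by exact_mod_cast m.factorial_ne_zero
  have h2 : (m : ℝ) + 1 ≠ 0 := by positivity
  simp only [smul_eq_mul, pow_one, pow_zero, nsmul_eq_mul, mul_one]
  push_cast
  field_simp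

/-- The coefficients of `jacobiP`. -/
def jacobiCoeff (n : ℕ) (a b : ℝ) (k : ℕ) : ℝ :=
  Ring.choose ((n : ℝ) + a) (n - k) * Ring.choose ((n : ℝ) + b) k

/-- This recurrence is the cancellation condition between neighbouring terms in the Jacobi equation.
-/
theorem jacobiCoeff_succ {n k : ℕ} (a b : ℝ) (hk : k < n) :
    jacobiCoeff n a b (k + 1) * ((k + 1) * (k + 1 + a))
      = jacobiCoeff n a b k * ((n - k) * (n - k + b)) := by
  obtain ⟨m, rfl⟩ : ∃ m, n = k + 1 + m := ⟨n - k - 1, by omega⟩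
  have h1 := choose_succ_mul (((k + 1 + m : ℕ) : ℝ) + b) k
  have h2 := choose_succ_mul (((k + 1 + m : ℕ) : ℝ) + a) m
  simp only [jacobiCoeff]
  rw [show k + 1 + m - (k + 1) = m by omega, show k + 1 + m - k = m + 1 by omega]
  push_cast at h1 h2 ⊢
  linear_combination Ring.choose ((k : ℝ) + 1 + m + a) m * (k + 1 + a) * h1
    - Ring.choose ((k : ℝ) + 1 + m + b) k * (k + 1 + m + b - k) * h2

/-- `(x - 1) ^ k (x + 1) ^ j`. -/
def mono (k j : ℤ) : RatFunc ℝ := xm ^ k * xp ^ j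

theorem mono_ne_zero (k j : ℤ) : mono k j ≠ 0 :=
  mul_ne_zero (zpow_ne_zero _ X_sub_one_ne_zero) (zpow_ne_zero _ X_add_one_ne_zero)

theorem ratDeriv_mono (k j : ℤ) : ∂ (mono k j) = mono k j * (k / xm + j / xp) := by
  rw [ratDeriv_eq_mul_dlog (mono_ne_zero k j), mono, dlog_mul (zpow_ne_zero _ X_sub_one_ne_zero)
    (zpow_ne_zero _ X_add_one_ne_zero), dlog_zpow, dlog_zpow, dlog_xm, dlog_xp]
  ring

/-- On monomials in `x - 1` and `x + 1` of fixed total degree the operator is an eigenvalue plus two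
differences of neighbours. Integer exponents allow the formula at the ends of the sum, where a
neighbour may have a negative exponent. -/
theorem apply_mono (α β : ℝ) (k j : ℤ) :
    (opU 0 α β).apply (mono k j) - RatFunc.C ((k + j) * (k + j + α + β + 1)) * mono k j =
      RatFunc.C (k * (k + α)) * (mono (k - 1) (j + 1) - mono k j)
      + RatFunc.C (j * (j + β)) * (mono (k + 1) (j - 1) - mono k j) := by
  have h1 := X_sub_one_ne_zero
  have h2 := X_add_one_ne_zero
  have e1 : mono (k - 1) (j + 1) = mono k j * (xp / xm) := by
    rw [mono, mono, zpow_sub_one₀ h1, zpow_add_one₀ h2]; field_simp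
  have e2 : mono (k + 1) (j - 1) = mono k j * (xm / xp) := by
    rw [mono, mono, zpow_sub_one₀ h2, zpow_add_one₀ h1]; field_simp
  have hk : ∂ ((k : RatFunc ℝ) / xm) = -k / xm ^ 2 := by
    simpa using ratDeriv_C_div_xm (k : ℝ)
  have hj : ∂ ((j : RatFunc ℝ) / xp) = -j / xp ^ 2 := by
    simpa using ratDeriv_C_div_xp (j : ℝ)
  rw [e1, e2]
  simp only [DiffOp2.apply, opU, ratDeriv_zero, ratDeriv_mono, ratDeriv_mul, ratDeriv_add, hk, hj,
    QQ, map_add, map_mul, map_one, map_intCast, xm_mul_xp]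
  field_simp
  ring

theorem apply_sum (T : DiffOp2) (s : Finset ℕ) (c : ℕ → ℝ) (f : ℕ → RatFunc ℝ) :
    T.apply (∑ k ∈ s, RatFunc.C (c k) * f k) = ∑ k ∈ s, RatFunc.C (c k) * T.apply (f k) := by
  simp only [DiffOp2.apply, ratDeriv_sum, ratDeriv_C_mul, Finset.mul_sum, ← Finset.sum_add_distrib]
  exact Finset.sum_congr rfl fun k _ => by ring

theorem apply_C_mul (T : DiffOp2) (c : ℝ) (f : RatFunc ℝ) :
    T.apply (RatFunc.C c * f) = RatFunc.C c * T.apply f := by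
  simp only [DiffOp2.apply, ratDeriv_C_mul]; ring

theorem iota_jacobiP (n : ℕ) (a b : ℝ) : ι (jacobiP n a b) = RatFunc.C ((2 : ℝ) ^ n)⁻¹ *
    ∑ k ∈ Finset.range (n + 1), RatFunc.C (jacobiCoeff n a b k) * mono k (n - k) := by
  rw [jacobiP, map_mul, map_sum, RatFunc.algebraMap_C]
  congr 1
  refine Finset.sum_congr rfl fun k hk => ?_
  have hk' : k ≤ n := by have := Finset.mem_range.1 hk; omega
  simp only [map_mul, map_pow, map_sub, map_add, map_one, RatFunc.algebraMap_X,
    RatFunc.algebraMap_C, mono, jacobiCoeff]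
  rw [← Nat.cast_sub hk', zpow_natCast, zpow_natCast]
  ring

theorem apply_jacobiP (n : ℕ) (a b : ℝ) : (opU 0 a b).apply (ι (jacobiP n a b)) =
    RatFunc.C (n * (n + a + b + 1)) * ι (jacobiP n a b) := by
  rw [iota_jacobiP, apply_C_mul, mul_left_comm]
  congr 1
  rw [apply_sum, Finset.mul_sum, ← sub_eq_zero, ← Finset.sum_sub_distrib]
  set A : ℕ → RatFunc ℝ := fun k => RatFunc.C (jacobiCoeff n a b k * (k * (k + a)))
    * (mono (k - 1) (n - k + 1) - mono k (n - k)) with hA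
  set B : ℕ → RatFunc ℝ := fun k => RatFunc.C (jacobiCoeff n a b k * ((n - k) * (n - k + b)))
    * (mono (k + 1) (n - k - 1) - mono k (n - k)) with hB
  have h1 : ∀ k ∈ Finset.range (n + 1), RatFunc.C (jacobiCoeff n a b k) *
      (opU 0 a b).apply (mono k (n - k)) - RatFunc.C (n * (n + a + b + 1)) *
        (RatFunc.C (jacobiCoeff n a b k) * mono k (n - k)) = A k + B k := by
    intro k _
    have h := apply_mono a b k (n - k)
    rw [show ((k : ℤ) : ℝ) + ((n - k : ℤ) : ℝ) = n by push_cast; ring] at h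
    rw [hA, hB]
    push_cast at h
    simp only [map_mul] at h ⊢
    linear_combination RatFunc.C (jacobiCoeff n a b k) * h
  -- One sum is shifted against the other; its first term and the last term of the other vanish
  -- through the factors `k` and `n - k`, so nothing is lost at the ends.
  rw [Finset.sum_congr rfl h1, Finset.sum_add_distrib, Finset.sum_range_succ' A,
    Finset.sum_range_succ B]
  have hA0 : A 0 = 0 := by simp [hA]
  have hBn : B n = 0 := by simp [hB]
  rw [hA0, hBn, add_zero, add_zero, ← Finset.sum_add_distrib]
  refine Finset.sum_eq_zero fun k hk => ?_
  have h := jacobiCoeff_succ a b (Finset.mem_range.1 hk)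
  simp only [hA, hB]
  rw [← h]
  push_cast
  rw [show (k : ℤ) + 1 - 1 = k by ring, show (n : ℤ) - (k + 1) + 1 = n - k by ring,
    show (n : ℤ) - (k + 1) = n - k - 1 by ring]
  ring

/-- The Vandermonde convolution. Since all basis monomials are monic of degree `n`, this sum is the
leading coefficient up to `2^(-n)`. -/
theorem sum_jacobiCoeff (n : ℕ) (a b : ℝ) :
    ∑ k ∈ Finset.range (n + 1), jacobiCoeff n a b k = Ring.choose ((n : ℝ) + a + b + n) n := by
  have h := Ring.add_choose_eq n (Commute.all ((n : ℝ) + b) (n + a))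
  rw [Finset.Nat.sum_antidiagonal_eq_sum_range_succ
    (fun i j => Ring.choose ((n : ℝ) + b) i * Ring.choose ((n : ℝ) + a) j)] at h
  rw [show (n : ℝ) + a + b + n = n + b + (n + a) by ring, h]
  exact Finset.sum_congr rfl fun k _ => mul_comm _ _

theorem choose_eq_ascPochhammer (n : ℕ) (a b : ℝ) : Ring.choose ((n : ℝ) + a + b + n) n =
    (ascPochhammer ℝ n).eval ((n : ℝ) + a + b + 1) / n.factorial := by
  rw [Ring.choose_eq_smul, descPochhammer_smeval_eq_ascPochhammer,
    ascPochhammer_smeval_eq_eval, div_eq_inv_mul, smul_eq_mul]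
  congr 3
  ring

theorem ascPochhammer_ne_zero {n : ℕ} {t : ℝ} (ht : ∀ m : ℤ, t ≠ m) :
    (ascPochhammer ℝ n).eval t ≠ 0 := by
  induction n with
  | zero => simp
  | succ n ih =>
    rw [ascPochhammer_succ_eval]
    exact mul_ne_zero ih fun h => ht (-n) (by push_cast; linarith)

theorem jacobiMonic_spec {a b : ℝ} (hab : ∀ m : ℤ, a + b ≠ m) (n : ℕ) :
    (jacobiMonic n a b).Monic ∧ (jacobiMonic n a b).natDegree = n := by
  have hcoeff : (jacobiMonic n a b).coeff n = 1 := by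
    have e : ∀ k ∈ Finset.range (n + 1), ((C (jacobiCoeff n a b k) * (X - 1) ^ k
        * (X + 1) ^ (n - k) : ℝ[X])).coeff n = jacobiCoeff n a b k := by
      intro k hk
      have hk' : k ≤ n := by have := Finset.mem_range.1 hk; omega
      have m1 : ((X - 1 : ℝ[X]) ^ k * (X + 1) ^ (n - k)).Monic :=
        ((monic_X_sub_C (1 : ℝ)).pow k).mul ((monic_X_add_C (1 : ℝ)).pow (n - k))
      have m2 : ((X - 1 : ℝ[X]) ^ k * (X + 1) ^ (n - k)).natDegree = n := by
        have h1 := ((monic_X_sub_C (1 : ℝ)).pow k).natDegree_mul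
          ((monic_X_add_C (1 : ℝ)).pow (n - k))
        rw [natDegree_pow, natDegree_pow, natDegree_X_sub_C, natDegree_X_add_C, map_one] at h1
        rw [h1]; omega
      rw [mul_assoc, coeff_C_mul]
      have := m1.coeff_natDegree
      rw [m2] at this
      rw [this, mul_one]
    have h0 : jacobiP n a b = C ((2 : ℝ) ^ n)⁻¹ * ∑ k ∈ Finset.range (n + 1),
      C (jacobiCoeff n a b k) * (X - 1) ^ k * (X + 1) ^ (n - k) := rfl
    have h2 : (ascPochhammer ℝ n).eval ((n : ℝ) + a + b + 1) ≠ 0 :=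
      ascPochhammer_ne_zero fun m hm => hab (m - n - 1) (by push_cast; linarith)
    have h3 : (n.factorial : ℝ) ≠ 0 := by exact_mod_cast n.factorial_ne_zero
    rw [jacobiMonic, h0, coeff_C_mul, coeff_C_mul, finsetSum_coeff, Finset.sum_congr rfl e,
      sum_jacobiCoeff, choose_eq_ascPochhammer]
    field_simp
  have hdeg : (jacobiMonic n a b).natDegree ≤ n := by
    rw [jacobiMonic, jacobiP]
    refine (natDegree_C_mul_le _ _).trans ((natDegree_C_mul_le _ _).trans ?_)
    refine natDegree_sum_le_of_forall_le _ _ fun k hk => ?_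
    have hk' : k ≤ n := by have := Finset.mem_range.1 hk; omega
    rw [mul_assoc]
    refine (natDegree_C_mul_le _ _).trans (natDegree_mul_le.trans ?_)
    have h1 : (X - 1 : ℝ[X]).natDegree = 1 := natDegree_X_sub_C (1 : ℝ)
    have h2 : (X + 1 : ℝ[X]).natDegree = 1 := natDegree_X_add_C (1 : ℝ)
    rw [natDegree_pow, natDegree_pow, h1, h2]
    omega
  have hd : (jacobiMonic n a b).natDegree = n :=
    le_antisymm hdeg (le_natDegree_of_ne_zero (by rw [hcoeff]; exact one_ne_zero))
  exact ⟨by rw [Monic, leadingCoeff, hd, hcoeff], hd⟩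

theorem hasLead_jacobiMonic {a b : ℝ} (hab : ∀ m : ℤ, a + b ≠ m) (n : ℕ) :
    HasLead (ι (jacobiMonic n a b)) n 1 := by
  obtain ⟨h1, h2⟩ := jacobiMonic_spec hab n
  have := hasLead_poly h1.ne_zero
  rwa [h2, h1.leadingCoeff] at this

theorem dlog_jacobiMonic_mem {a b : ℝ} (hab : ∀ m : ℤ, a + b ≠ m) (n : ℕ) :
    dlog (ι (jacobiMonic n a b)) ∈ Ric (opU 0 a b) (lam a b .one n) := by
  rw [← apply_opU_iff (hasLead_jacobiMonic hab n).ne_zero, jacobiMonic, map_mul,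
    RatFunc.algebraMap_C, apply_C_mul, apply_jacobiP, lam]
  ring

/-! ### Quasi-rational eigenfunctions of the classical operator -/

theorem AtInf.pow {f : RatFunc ℝ} {y : ℝ} (hf : AtInf f y) (n : ℕ) : AtInf (f ^ n) (y ^ n) := by
  induction n with
  | zero => simpa using AtInf.const 1
  | succ n ih => rw [pow_succ, pow_succ]; exact ih.mul hf

theorem HasLead.nonpos_of_atInf {f : RatFunc ℝ} {d : ℤ} {c y : ℝ} (h : HasLead f d c)
    (hy : AtInf f y) : d ≤ 0 := by
  by_contra hd
  have h1 := hy.mul (h.inv.atInf_zero (by omega))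
  rw [mul_inv_cancel₀ h.ne_zero, mul_zero] at h1
  have := h1.unique (by simpa using AtInf.const 1)
  norm_num at this

/-- If `w` grew like `c x^n` with `n ≥ 0`, then after division by `x^(2n + 2)` only `(x² - 1) w²`
would survive at infinity, giving `c² = 0`. -/
theorem exists_atInf_of_mem_Ric {w : RatFunc ℝ} {α β μ : ℝ} (h : w ∈ Ric (opU 0 α β) μ) :
    ∃ d, AtInf (RatFunc.X * w) d := by
  rcases eq_or_ne w 0 with rfl | hw
  · exact ⟨0, by simpa using AtInf.const 0⟩
  have hX := ratX_ne_zero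
  have hl := hasLead_self hw
  rcases lt_or_ge w.intDegree 0 with hd | hd
  · obtain ⟨n, hn⟩ : ∃ n : ℕ, w.intDegree = -(n : ℤ) - 1 := ⟨(-w.intDegree - 1).toNat, by omega⟩
    have h1 := hl.2.mul (atInf_inv_X.pow n)
    refine ⟨w.num.leadingCoeff * 0 ^ n, ?_⟩
    · convert h1 using 1
      rw [hn, show -(-(n : ℤ) - 1) = n + 1 by ring, zpow_add_one₀ hX, zpow_natCast, inv_pow]
      field_simp
  · exfalso
    obtain ⟨n, hn⟩ := Int.eq_ofNat_of_zero_le hd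
    have one : AtInf 1 1 := by simpa using AtInf.const 1
    have hI := atInf_inv_X
    have h2 := hl.2
    rw [hn, zpow_neg, ← inv_zpow, zpow_natCast] at h2
    have e : (1 - RatFunc.X⁻¹ * RatFunc.X⁻¹) * (RatFunc.X⁻¹ * RatFunc.X⁻¹ ^ n
          * (w * RatFunc.X⁻¹ ^ n) * (RatFunc.X * dlog w)
          + (w * RatFunc.X⁻¹ ^ n) * (w * RatFunc.X⁻¹ ^ n))
        + (RatFunc.C (α + 1) * (1 + RatFunc.X⁻¹) + RatFunc.C (β + 1) * (1 - RatFunc.X⁻¹))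
          * (RatFunc.X⁻¹ * RatFunc.X⁻¹ ^ n * (w * RatFunc.X⁻¹ ^ n))
        = RatFunc.C μ * (RatFunc.X⁻¹ * RatFunc.X⁻¹ ^ n * (RatFunc.X⁻¹ * RatFunc.X⁻¹ ^ n)) := by
      rw [mem_Ric_opU, QQ, ratDeriv_zero, ratDeriv_eq_mul_dlog hw] at h
      rw [← h, inv_pow]
      field_simp
      ring
    have h3 := (((one.sub (hI.mul hI)).mul ((((hI.mul (hI.pow n)).mul h2).mul
      hl.atInf_X_mul_dlog).add (h2.mul h2))).add ((((AtInf.const (α + 1)).mul (one.add hI)).add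
        ((AtInf.const (β + 1)).mul (one.sub hI))).mul ((hI.mul (hI.pow n)).mul h2)))
    rw [e] at h3
    have h4 := h3.unique ((AtInf.const μ).mul ((hI.mul (hI.pow n)).mul (hI.mul (hI.pow n))))
    simp only [zero_mul, mul_zero, zero_add, sub_zero, one_mul, add_zero] at h4
    exact hl.1 (by simpa using h4)

theorem exists_factor (c : ℝ) {p : ℝ[X]} (hp : p ≠ 0) :
    ∃ (m : ℕ) (r : ℝ[X]), r.eval c ≠ 0 ∧ p = (X - C c) ^ m * r := by
  obtain ⟨r, h1, h2⟩ := exists_eq_pow_rootMultiplicity_mul_and_not_dvd p hp c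
  exact ⟨_, r, fun h => h2 (dvd_iff_isRoot.2 h), h1⟩

/-- A Riccati solution is logarithmic at its poles away from `± 1`: in lowest terms `N/D`, the
equation forces `D` to divide `(x² - 1)(N - D')`. Hence `w - D'/D` has denominator `x² - 1`, and
decay at infinity bounds its numerator. -/
theorem exists_dlog_of_mem_Ric {w : RatFunc ℝ} {α β μ : ℝ} (h : w ∈ Ric (opU 0 α β) μ) :
    ∃ (M : ℝ[X]) (k l : ℝ), M.eval 1 ≠ 0 ∧ M.eval (-1) ≠ 0 ∧
      w = dlog (ι M) + RatFunc.C k / xm + RatFunc.C l / xp := by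
  have h1 := X_sub_one_ne_zero
  have h2 := X_add_one_ne_zero
  obtain ⟨d, hd⟩ := exists_atInf_of_mem_Ric h
  have hD := w.denom_ne_zero
  have hD' := RatFunc.algebraMap_ne_zero (K := ℝ) hD
  obtain ⟨N, hN⟩ : ∃ N, N = w.num := ⟨_, rfl⟩
  obtain ⟨D, hDe⟩ : ∃ D, D = w.denom := ⟨_, rfl⟩
  rw [← hDe] at hD hD'
  have hw : w = ι N / ι D := by rw [hN, hDe, RatFunc.num_div_denom]
  have hcop : IsCoprime N D := by rw [hN, hDe]; exact RatFunc.isCoprime_num_denom w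
  have e1 : (X ^ 2 - 1) * N * (N - derivative D) = D * (C μ * D - (X ^ 2 - 1) * derivative N
      - (C (α + 1) * (X + 1) + C (β + 1) * (X - 1)) * N) := by
    apply RatFunc.algebraMap_injective ℝ
    rw [mem_Ric_opU, hw, ratDeriv_div N D hD, QQ, ratDeriv_zero] at h
    simp only [map_mul, map_sub, map_add, map_pow, map_one, RatFunc.algebraMap_X,
      RatFunc.algebraMap_C] at h ⊢
    field_simp at h
    linear_combination h
  have hdvd : D ∣ (X ^ 2 - 1) * (N - derivative D) := by
    apply hcop.symm.dvd_of_dvd_mul_left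
    exact ⟨_, by rw [← e1]; ring⟩
  obtain ⟨S, hS⟩ := hdvd
  obtain ⟨m, D₁, hD₁, hDm⟩ := exists_factor 1 hD
  have hD₁0 := ne_zero_of_eval_ne_zero hD₁
  obtain ⟨n, M, hM, hDn⟩ := exists_factor (-1) hD₁0
  have hM0 := RatFunc.algebraMap_ne_zero (K := ℝ) (ne_zero_of_eval_ne_zero hM)
  have hM1 : M.eval 1 ≠ 0 := by
    intro h0; apply hD₁; rw [hDn, eval_mul, h0, mul_zero]
  have hdD : dlog (ι D) = m / xm + n / xp + dlog (ι M) := by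
    have e : ι D = xm ^ m * (xp ^ n * ι M) := by
      rw [hDm, hDn]; simp
    rw [e, dlog_mul (pow_ne_zero _ h1) (mul_ne_zero (pow_ne_zero _ h2) hM0),
      dlog_mul (pow_ne_zero _ h2) hM0, dlog_pow, dlog_pow, dlog_xm, dlog_xp]
    ring
  obtain ⟨S', hS'⟩ : ∃ S', S' = S + C (m : ℝ) * (X + 1) + C (n : ℝ) * (X - 1) := ⟨_, rfl⟩
  have hwM : w = dlog (ι M) + ι S' / (RatFunc.X ^ 2 - 1) := by
    have e2 : w = dlog (ι D) + ι S / (RatFunc.X ^ 2 - 1) := by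
      have hS2 := congrArg ι hS
      simp only [map_mul, map_sub, map_pow, map_one, RatFunc.algebraMap_X] at hS2
      have := sq_X_sub_one_ne_zero
      rw [hw, dlog, ratDeriv_algebraMap]
      field_simp
      linear_combination hS2
    rw [e2, hdD, hS', xm_mul_xp]
    simp only [map_mul, map_sub, map_add, map_one, RatFunc.algebraMap_X,
      map_natCast]
    field_simp
    ring
  -- Both `w` and `M'/M` are `O(1/x)`, hence so is `S'/(x² - 1)`.
  have hdeg : S'.natDegree ≤ 1 := by
    rcases eq_or_ne S' 0 with h0 | h0
    · simp [h0]
    have h3 := hd.sub (atInf_X_mul_dlog_poly (ne_zero_of_eval_ne_zero hM))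
    have e3 : RatFunc.X * w - RatFunc.X * dlog (ι M) = ι (X * S') / (xm * xp) := by
      rw [hwM, xm_mul_xp, map_mul, RatFunc.algebraMap_X]; ring
    have h4 := (hasLead_poly (mul_ne_zero X_ne_zero h0)).div (hasLead_xm.mul hasLead_xp)
    rw [← e3] at h4
    have h5 := h4.nonpos_of_atInf h3
    rw [natDegree_X_mul h0] at h5
    push_cast at h5
    omega
  obtain ⟨s₁, s₀, hs⟩ := exists_eq_X_add_C_of_natDegree_le_one hdeg
  refine ⟨M, (s₁ + s₀) / 2, (s₁ - s₀) / 2, hM1, hM, ?_⟩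
  rw [hwM, hs, xm_mul_xp]
  simp only [map_mul, map_add, map_sub, RatFunc.algebraMap_X, RatFunc.algebraMap_C, map_div₀,
    ratC_two]
  field_simp
  ring

theorem regularAt_zero (c : ℝ) : RegularAt 0 c := (ValAt.zero c).regularAt

/-- For `α = 0` the exponent at `1` is a double zero, so no pole occurs there; at `-1` the exponents
`0` and `-b` separate the rational from the twisted solutions, and the degree of the polynomial part
determines the eigenvalue. -/
theorem mem_Ric_zero_cases {w : RatFunc ℝ} {b μ : ℝ} (h : w ∈ Ric (opU 0 0 b) μ) :
    RegularAt w 1 ∧ ((IsInt w ∧ ∃ m : ℕ, μ = lam 0 b .one m) ∨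
      (IsTwisted b w ∧ ∃ m : ℕ, μ = lam 0 b .one (-m - 1))) := by
  obtain ⟨M, k, l, hM1, hM2, hw⟩ := exists_dlog_of_mem_Ric h
  have hM0 := ne_zero_of_eval_ne_zero hM1
  have hv1 : RegularAt (dlog (ι M) + RatFunc.C l / xp) 1 :=
    ((ValAt.poly 1 M).dlog_regularAt hM1).add (regularAt_C_div_xp l)
  have hk : k = 0 := by
    have := exponent_one (regularAt_zero 1) hv1 (by rw [hw]; ring) h
    simpa using this
  subst hk
  rw [map_zero, zero_div, add_zero] at hw
  have hl := exponent_neg_one (regularAt_zero (-1)) ((ValAt.poly (-1) M).dlog_regularAt hM2)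
    (by rw [hw]; ring) h
  have hu : AtInf (RatFunc.X * (0 : RatFunc ℝ)) 0 := by simpa using AtInf.const 0
  have hM' := RatFunc.algebraMap_ne_zero (K := ℝ) hM0
  refine ⟨hw ▸ hv1, ?_⟩
  have hxp : AtInf (RatFunc.X * (RatFunc.C l / xp)) l := by
    have := (AtInf.const l).mul hasLead_xp.atInf_X_mul_dlog
    rw [dlog_xp] at this
    convert this using 1
    · ring
    · push_cast; ring
  have hdeg := degree_of_mem_Ric hu
    (by rw [hw, mul_add]; exact (atInf_X_mul_dlog_poly hM0).add hxp) h
  rcases mul_eq_zero.1 hl with h0 | h0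
  · left
    subst h0
    refine ⟨⟨ι M, hM', by rw [hw]; simp⟩, M.natDegree, ?_⟩
    rw [← hdeg, lam]; ring
  · right
    have h1 : l = -b := by linarith
    subst h1
    refine ⟨⟨ι M, hM', by rw [hw, map_neg]; ring⟩, M.natDegree, ?_⟩
    rw [← hdeg, lam]; ring

/-- The labels of the classical operator. -/
def baseLab (a : ℕ) (n : ℤ) : Lab := if 0 ≤ n then .circ else if -(a : ℤ) ≤ n then .ast else .minus

theorem atInf_X_mul_zero : AtInf (RatFunc.X * (0 : RatFunc ℝ)) 0 := by simpa using AtInf.const 0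

/-- Non-negative `n` carry the Jacobi polynomials; negative `n` carry those of parameter `-b`,
multiplied by `(1 + x)^(-b)`. -/
theorem labelState_zero {b : ℝ} (hb : ∀ m : ℤ, b ≠ m) : LabelState 0 ((0 : ℕ) : ℝ) b 0 (baseLab 0) := by
  have hb' : ∀ m : ℤ, -b ≠ m := fun m hm => hb (-m) (by push_cast; linarith)
  have hb0 : ∀ m : ℤ, 0 + b ≠ m := fun m => by rw [zero_add]; exact hb m
  have hb0' : ∀ m : ℤ, 0 + -b ≠ m := fun m => by rw [zero_add]; exact hb' m
  have inj : ∀ {m n : ℤ}, lam 0 b .one m = lam 0 b .one n → m = n := by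
    intro m n h
    exact lam_one_inj (α := 0) hb (by simpa using h)
  rw [Nat.cast_zero]
  constructor
  · intro n
    rw [Int.cast_zero, sub_zero, baseLab]
    rcases le_or_gt 0 n with hn | hn
    · rw [if_pos hn]
      obtain ⟨m, rfl⟩ := Int.eq_ofNat_of_zero_le hn
      have h0 := dlog_jacobiMonic_mem hb0 m
      have hne := (hasLead_jacobiMonic hb0 m).ne_zero
      refine ⟨_, ?_, ⟨_, hne, rfl⟩, (mem_Ric_zero_cases h0).1⟩
      ext w
      rw [Set.mem_singleton_iff]
      constructor
      · intro hw
        obtain ⟨-, ⟨⟨f, hf, rfl⟩, -⟩ | ⟨-, j, hj⟩⟩ := mem_Ric_zero_cases hw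
        · exact eigenfunction_unique hb0 atInf_X_mul_zero hf hne hw h0
        · exfalso
          have := inj (m := (m : ℤ)) (n := -j - 1) (by push_cast at hj ⊢; exact hj)
          omega
      · rintro rfl; exact h0
    · rw [if_neg (not_le.2 hn), if_neg (by push_cast; omega)]
      obtain ⟨m, rfl⟩ : ∃ m : ℕ, n = -(m : ℤ) - 1 := ⟨(-n - 1).toNat, by omega⟩
      have h0 := dlog_jacobiMonic_mem hb0' m
      have hne := (hasLead_jacobiMonic hb0' m).ne_zero
      have hg : ∀ w : RatFunc ℝ, w - RatFunc.C b / xp ∈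
          Ric (opU 0 0 b) (lam 0 b .one ((-(m : ℤ) - 1 : ℤ) : ℝ)) ↔
          w ∈ Ric (opU 0 0 (-b)) (lam 0 (-b) .one m) := by
        intro w
        rw [gauge_xp, sub_add_cancel]
        have e : lam 0 b .one ((-(m : ℤ) - 1 : ℤ) : ℝ) + b * (0 + 1) = lam 0 (-b) .one m := by
          simp only [lam]; push_cast; ring
        rw [e]
      have h1 := (hg _).2 h0
      refine ⟨_, ?_, ⟨_, hne, rfl⟩, (mem_Ric_zero_cases h1).1⟩
      ext w
      rw [Set.mem_singleton_iff]
      constructor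
      · intro hw
        obtain ⟨-, ⟨-, j, hj⟩ | ⟨⟨f, hf, rfl⟩, -⟩⟩ := mem_Ric_zero_cases hw
        · exfalso
          have := inj (m := -(m : ℤ) - 1) (n := j) (by push_cast at hj ⊢; exact hj)
          omega
        · rw [eigenfunction_unique hb0' atInf_X_mul_zero hf hne ((hg _).1 hw) h0]
      · rintro rfl; exact h1
  · intro μ hμ
    rw [Set.eq_empty_iff_forall_notMem]
    intro w hw
    rcases (mem_Ric_zero_cases hw).2 with ⟨-, m, hm⟩ | ⟨-, m, hm⟩
    · exact hμ m (by rw [hm]; push_cast; ring_nf)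
    · exact hμ (-m - 1) (by rw [hm]; push_cast; ring_nf)

/-- With coinciding exponents the indicial factor is `2 k²`, so an order `k < 0` always leaves a
pole in the image. For `α > 0` an order `-α` would escape this argument; hence the start at `α = 0`.
-/
theorem locAt_zero (b μ : ℝ) : LocAt (opU 0 0 b) μ := by
  intro g hg
  rcases eq_or_ne g 0 with rfl | hg0
  · exact regularAt_zero 1
  obtain ⟨k, f, t, ht, hf, e⟩ := exists_order_one hg0
  have h1 := X_sub_one_ne_zero
  have hz := zpow_ne_zero k h1
  have hd : ∀ y : RatFunc ℝ, ∂ (xm ^ k * y) = xm ^ k * (k / xm * y + ∂ y) := by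
    intro y
    rw [ratDeriv_mul, ratDeriv_eq_mul_dlog hz, dlog_zpow, dlog_xm]; ring
  have hk' : ∂ ((k : RatFunc ℝ) / xm) = -k / xm ^ 2 := by simpa using ratDeriv_C_div_xm (k : ℝ)
  set G := xp * (RatFunc.C (k * (k - 1) : ℝ) * f + xm * (RatFunc.C (2 * k : ℝ) * ∂ f
      + xm * ∂ (∂ f))) + (xp + RatFunc.C (b + 1) * xm) * (RatFunc.C (k : ℝ) * f + xm * ∂ f)
      - RatFunc.C μ * (xm * f) with hG
  have hE : xm * ((opU 0 0 b).apply g - RatFunc.C μ * g) = xm ^ k * G := by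
    rw [e, hG]
    simp only [DiffOp2.apply, opU, hd, ratDeriv_zero, ratDeriv_add, ratDeriv_mul (_ / _), hk', QQ,
      map_add, map_one, map_mul, map_sub, map_intCast, map_zero, ratC_two, xm_mul_xp]
    field_simp
    ring
  have two : ValAt 1 (2 : RatFunc ℝ) 2 := by
    rw [← ratC_two]; exact ValAt.const 1 2
  have hGv := ((valAt_xp.mul (((ValAt.const 1 (k * (k - 1) : ℝ)).mul hf).add (valAt_xm.mul
    (((ValAt.const 1 (2 * k : ℝ)).mul hf.regularAt.ratDeriv.valAt).add
      (valAt_xm.mul hf.regularAt.ratDeriv.ratDeriv.valAt))))).add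
    ((valAt_xp.add ((ValAt.const 1 (b + 1)).mul valAt_xm)).mul (((ValAt.const 1 (k : ℝ)).mul hf).add
      (valAt_xm.mul hf.regularAt.ratDeriv.valAt)))).sub
    ((ValAt.const 1 μ).mul (valAt_xm.mul hf))
  rw [← hG] at hGv
  rcases lt_or_ge k 0 with hk | hk
  · exfalso
    obtain ⟨n, hn⟩ : ∃ n : ℕ, -k = (n : ℤ) := ⟨(-k).toNat, by omega⟩
    have e2 : xm ^ n * xm * ((opU 0 0 b).apply g - RatFunc.C μ * g) = G := by
      rw [mul_assoc, hE, ← mul_assoc, ← zpow_natCast, ← hn, ← zpow_add₀ h1, neg_add_cancel,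
        zpow_zero, one_mul]
    have h2 := ((valAt_xm.pow n).mul valAt_xm).mul hg.valAt
    rw [e2] at h2
    have h3 := h2.unique hGv
    have h4 : (2 : ℝ) * k * k * t = 0 := by linarith
    have h5 : (k : ℝ) ≠ 0 := by exact_mod_cast hk.ne
    simp [h5, ht] at h4
  · obtain ⟨n, rfl⟩ := Int.eq_ofNat_of_zero_le hk
    rw [e]
    exact (hf.zpow_xm_mul n).regularAt

/-! ### Incomplete inner products of Jacobi polynomials -/

/-- The polynomial `r` with `∫ f (1 + x) ^ b = (1 + x) ^ (b + 1) r`. -/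
def antiderivPoly (b : ℝ) (f : ℝ[X]) : ℝ[X] :=
  (taylor (-1) f).sum fun k y => C (y / (b + k + 1)) * (X + 1) ^ k

theorem antiderivPoly_ode {b : ℝ} (hb : ∀ m : ℤ, b ≠ m) (f : ℝ[X]) :
    (X + 1) * derivative (antiderivPoly b f) + C (b + 1) * antiderivPoly b f = f := by
  have h := sum_taylor_eq f (-1)
  rw [antiderivPoly, Polynomial.sum, derivative_sum, Finset.mul_sum, Finset.mul_sum,
    ← Finset.sum_add_distrib]
  conv_rhs => rw [← h, Polynomial.sum]
  refine Finset.sum_congr rfl fun k _ => ?_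
  have hne : b + k + 1 ≠ 0 := fun h => hb (-(k : ℤ) - 1) (by push_cast; linarith)
  have e : (X - C (-1) : ℝ[X]) = X + 1 := by simp
  generalize (taylor (-1) f).coeff k = y
  have hy : C (y / (b + k + 1)) * (C b + k + 1) = (C y : ℝ[X]) := by
    rw [← map_natCast (C : ℝ →+* ℝ[X]), ← map_one (C : ℝ →+* ℝ[X]), ← map_add, ← map_add, ← map_mul,
      div_mul_cancel₀ _ hne]
  rw [e, ← hy]
  rcases k with _ | k
  · simp; ring
  · rw [derivative_mul, derivative_C, derivative_pow]
    simp only [Nat.add_sub_cancel, derivative_X, derivative_one, map_add, map_one]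
    simp only [map_natCast]
    push_cast
    ring

theorem qrIntegral_eq (b : ℝ) (f : ℝ[X]) {x : ℝ} (hx : -1 < x) :
    qrIntegral f b x = (1 + x) ^ (b + 1) * (antiderivPoly b f).eval x := by
  have h : 0 < 1 + x := by linarith
  rw [qrIntegral, antiderivPoly, Polynomial.sum, Polynomial.sum, eval_finsetSum, Finset.mul_sum]
  refine Finset.sum_congr rfl fun k _ => ?_
  simp only [eval_mul, eval_C, eval_pow, eval_add, eval_X, eval_one]
  rw [show b + (k : ℝ) + 1 = b + 1 + k by ring, Real.rpow_add h, Real.rpow_natCast]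
  ring

theorem iota_antiderivPoly_ode {b : ℝ} (hb : ∀ m : ℤ, b ≠ m) (f : ℝ[X]) :
    xp * ∂ (ι (antiderivPoly b f)) + RatFunc.C (b + 1) * ι (antiderivPoly b f) = ι f := by
  have h := congrArg ι (antiderivPoly_ode hb f)
  rw [ratDeriv_algebraMap]
  simpa using h

theorem xp_ode_unique {b : ℝ} (hb : ∀ m : ℤ, b ≠ m) {f g : RatFunc ℝ}
    (h : xp * ∂ f + RatFunc.C (b + 1) * f = xp * ∂ g + RatFunc.C (b + 1) * g) : f = g := by
  rw [← sub_eq_zero]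
  refine eq_zero_of_xp_ode (c := b + 1) (fun m hm => hb (m - 1) (by push_cast; linarith)) ?_
  rw [ratDeriv_sub]
  linear_combination h

/-- `ρ_{nm} = (1 + x) ^ (b + 1) jacobiRho a b n m`. -/
def jacobiRho (a : ℕ) (b : ℝ) (n m : ℕ) : ℝ[X] :=
  antiderivPoly b (jacobiMonic n a b * jacobiMonic m a b * (1 - X) ^ a)

/-- The norms of the monic Jacobi polynomials, up to the factor `2 ^ (b + 1)`. -/
def jacobiNorm (a : ℕ) (b : ℝ) (n : ℕ) : ℝ := (jacobiRho a b n n).eval 1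

theorem rho_eq (a : ℕ) (b : ℝ) (n m : ℕ) {x : ℝ} (hx : -1 < x) :
    rho a b n m x = (1 + x) ^ (b + 1) * (jacobiRho a b n m).eval x := qrIntegral_eq b _ hx

theorem jacobiRho_ode {b : ℝ} (hb : ∀ m : ℤ, b ≠ m) (a n m : ℕ) :
    xp * ∂ (ι (jacobiRho a b n m)) + RatFunc.C (b + 1) * ι (jacobiRho a b n m) =
      (1 - RatFunc.X) ^ a * (ι (jacobiMonic n a b) * ι (jacobiMonic m a b)) := by
  rw [jacobiRho, iota_antiderivPoly_ode hb]
  simp only [map_mul, map_pow, map_sub, map_one, RatFunc.algebraMap_X]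
  ring

theorem add_ne_int {a : ℕ} {b : ℝ} (hb : ∀ m : ℤ, b ≠ m) (m : ℤ) : (a : ℝ) + b ≠ m :=
  fun h => hb (m - a) (by push_cast; linarith)

theorem add_one_ne_int {b : ℝ} (hb : ∀ m : ℤ, b ≠ m) (m : ℤ) : b + 1 ≠ m :=
  fun h => hb (m - 1) (by push_cast; linarith)

theorem jacobiMonic_zero {a b : ℝ} (hab : ∀ m : ℤ, a + b ≠ m) : jacobiMonic 0 a b = 1 := by
  obtain ⟨h1, h2⟩ := jacobiMonic_spec hab 0
  exact h1.natDegree_eq_zero.1 h2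

theorem one_mem_Ric (a b : ℝ) : dlog (1 : RatFunc ℝ) ∈ Ric (opU 0 a b) 0 := by
  rw [mem_Ric_opU, dlog_one]; simp [ratDeriv_zero]

/-- Differentiation is the Darboux transformation with constant seed; uniqueness of eigenfunctions
and leading coefficients identify the result. -/
theorem derivative_jacobiMonic {a : ℕ} {b : ℝ} (hb : ∀ m : ℤ, b ≠ m) (n : ℕ) :
    ∂ (ι (jacobiMonic (n + 1) a b)) =
      RatFunc.C ((n : ℝ) + 1) * ι (jacobiMonic n ((a + 1 : ℕ) : ℝ) (b + 1)) := by
  have hab := add_ne_int (a := a) hb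
  have hab' := add_ne_int (a := a + 1) (add_one_ne_int hb)
  have hl := hasLead_jacobiMonic hab (n + 1)
  have hl' := hasLead_jacobiMonic hab' n
  have h0 := hl.darA (w₀ := 0) (e := 0) (by simpa using atInf_X_mul_zero) (by push_cast; omega)
  have e : darA 0 (ι (jacobiMonic (n + 1) a b)) = ∂ (ι (jacobiMonic (n + 1) a b)) := by
    rw [darA]; ring
  rw [e] at h0
  have hne : lam a b .one ((n + 1 : ℕ) : ℝ) ≠ 0 := by
    simp only [lam]
    refine mul_ne_zero (by positivity) fun h => hab (-n - 2) (by push_cast at h ⊢; linarith)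
  have h1 := dlog_jacobiMonic_mem hab (n + 1)
  have h2 := darboux_mem (one_mem_Ric a b) hne h1
  have h3 : dlog (∂ (ι (jacobiMonic (n + 1) a b))) ∈ Ric (opU 0 ((a + 1 : ℕ) : ℝ) (b + 1))
      (lam ((a + 1 : ℕ) : ℝ) (b + 1) .one n) := by
    have hd := darboux_ne (one_mem_Ric a b) hne h1
    rw [ratDeriv_eq_mul_dlog hl.ne_zero]
    rw [dlog_one, sub_zero] at h2 hd
    rw [dlog_mul hl.ne_zero hd]
    convert h2 using 2
    · push_cast; simp
    · simp only [lam]; push_cast; ring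
  have h4 := eigenfunction_unique hab' atInf_X_mul_zero h0.ne_zero hl'.ne_zero h3
    (dlog_jacobiMonic_mem hab' n)
  obtain ⟨c, hc, h5⟩ := eq_C_mul_of_dlog_eq h0.ne_zero hl'.ne_zero h4
  rw [h5] at h0 ⊢
  have h6 := (h0.unique (hl'.C_mul hc)).2
  rw [mul_one] at h6
  rw [← h6]
  push_cast
  simp

/-- Both sides are anti-derivatives of the same weighted product, by integration by parts with
constant seed. -/
theorem jacobiRho_succ {a : ℕ} {b : ℝ} (hb : ∀ m : ℤ, b ≠ m) (n m : ℕ) :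
    xp⁻¹ * ((1 - RatFunc.X) ^ (a + 1) * (ι (jacobiMonic (n + 1) a b)
        * ∂ (ι (jacobiMonic (m + 1) a b)))
      + RatFunc.C (lam a b .one ((m : ℝ) + 1)) * ι (jacobiRho a b (n + 1) (m + 1))) =
    RatFunc.C (((n : ℝ) + 1) * ((m : ℝ) + 1)) * ι (jacobiRho (a + 1) (b + 1) n m) := by
  have hab := add_ne_int (a := a) hb
  have hD : ∀ f : RatFunc ℝ, ∂ f = darA (dlog 1) f := by
    intro f; rw [darA, dlog_one]; ring
  have hBA : darB a b (dlog 1) (∂ (ι (jacobiMonic (m + 1) a b))) =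
      RatFunc.C (lam a b .one ((m : ℝ) + 1)) * ι (jacobiMonic (m + 1) a b) := by
    have h1 := (apply_opU_iff (hasLead_jacobiMonic hab (m + 1)).ne_zero).2
      (dlog_jacobiMonic_mem hab (m + 1))
    rw [hD, ← darB_darA (one_mem_Ric a b), h1, map_zero]
    push_cast; ring
  refine xp_ode_unique (add_one_ne_int hb) ?_
  rw [darboux_ode (hD _) hBA (jacobiRho_ode hb a (n + 1) (m + 1)), ratDeriv_C_mul,
    derivative_jacobiMonic hb, derivative_jacobiMonic hb, map_mul]
  linear_combination (-RatFunc.C ((n : ℝ) + 1) * RatFunc.C ((m : ℝ) + 1))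
    * jacobiRho_ode (add_one_ne_int hb) (a + 1) n m

theorem jacobiNorm_succ {a : ℕ} {b : ℝ} (hb : ∀ m : ℤ, b ≠ m) (n : ℕ) :
    ((n : ℝ) + a + b + 2) * jacobiNorm a b (n + 1) / 2
      = (n + 1) * jacobiNorm (a + 1) (b + 1) n := by
  have h := jacobiRho_succ (a := a) hb n n
  have hE : ValAt 1 ((1 - RatFunc.X : RatFunc ℝ) ^ (a + 1)) 0 := by
    have := ((ValAt.one 1).sub (ValAt.var 1)).pow (a + 1)
    rwa [sub_self, zero_pow (Nat.succ_ne_zero a)] at this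
  have h1 := (valAt_xp.inv two_ne_zero).mul ((hE.mul ((ValAt.poly 1 (jacobiMonic (n + 1) a b)).mul
    (ValAt.poly 1 (jacobiMonic (n + 1) a b)).regularAt.ratDeriv.valAt)).add
    ((ValAt.const 1 (lam a b .one ((n : ℝ) + 1))).mul (ValAt.poly 1 (jacobiRho a b (n + 1) (n + 1)))))
  rw [h] at h1
  have h2 := ((ValAt.const 1 (((n : ℝ) + 1) * ((n : ℝ) + 1))).mul
    (ValAt.poly 1 (jacobiRho (a + 1) (b + 1) n n))).unique h1
  have h3 : (n : ℝ) + 1 ≠ 0 := by positivity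
  apply mul_left_cancel₀ h3
  simp only [jacobiNorm, lam] at h2 ⊢
  linear_combination -h2

theorem jacobiNorm_zero_zero {b : ℝ} (hb : ∀ m : ℤ, b ≠ m) : jacobiNorm 0 b 0 = 1 / (b + 1) := by
  have hne : b + 1 ≠ 0 := fun h => hb (-1) (by push_cast; linarith)
  have e : ι (jacobiRho 0 b 0 0) = RatFunc.C (1 / (b + 1)) := by
    refine xp_ode_unique hb ?_
    have hc : (RatFunc.C (b + 1) * RatFunc.C (1 / (b + 1)) : RatFunc ℝ) = 1 := by
      rw [← map_mul, mul_one_div_cancel hne, map_one]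
    rw [jacobiRho_ode hb, jacobiMonic_zero (add_ne_int hb), ratDeriv_C, hc]
    simp
  have h := ValAt.poly 1 (jacobiRho 0 b 0 0)
  rw [e] at h
  exact h.unique (ValAt.const 1 _)

/-- The total weight is lowered in `a` by integrating by parts against `(1 - x)^(a + 1)`, whose
boundary term vanishes at `1`. -/
theorem jacobiNorm_zero_succ {b : ℝ} (hb : ∀ m : ℤ, b ≠ m) (a : ℕ) :
    ((a : ℝ) + b + 2) * jacobiNorm (a + 1) b 0 = 2 * (a + 1) * jacobiNorm a b 0 := by
  have e : RatFunc.C ((a : ℝ) + b + 2) * ι (jacobiRho (a + 1) b 0 0) =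
      (1 - RatFunc.X) ^ (a + 1) + RatFunc.C (2 * ((a : ℝ) + 1)) * ι (jacobiRho a b 0 0) := by
    refine xp_ode_unique hb ?_
    have h1 := jacobiRho_ode hb a 0 0
    have h2 := jacobiRho_ode hb (a + 1) 0 0
    rw [jacobiMonic_zero (add_ne_int hb)] at h1 h2
    rw [ratDeriv_add, ratDeriv_C_mul, ratDeriv_C_mul, ratDeriv_one_sub_X_pow]
    simp only [map_mul, map_add, map_natCast, map_one, ratC_two] at *
    push_cast
    linear_combination ((a : RatFunc ℝ) + RatFunc.C b + 2) * h2 - 2 * (a + 1) * h1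
  have h1 := (ValAt.const 1 ((a : ℝ) + b + 2)).mul (ValAt.poly 1 (jacobiRho (a + 1) b 0 0))
  rw [e] at h1
  have h2 := h1.unique ((((ValAt.one 1).sub (ValAt.var 1)).pow (a + 1)).add
    ((ValAt.const 1 (2 * ((a : ℝ) + 1))).mul (ValAt.poly 1 (jacobiRho a b 0 0))))
  rw [sub_self, zero_pow (Nat.succ_ne_zero a), zero_add] at h2
  exact h2

/-! ### Gamma function recurrences for the classical norms -/

theorem gamma_ne_zero {t : ℝ} (ht : ∀ m : ℤ, t ≠ m) : Real.Gamma t ≠ 0 :=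
  Real.Gamma_ne_zero fun m h => ht (-m) (by push_cast; exact h)

theorem nuC_ne_zero {b : ℝ} (hb : ∀ m : ℤ, b ≠ m) (n a : ℕ) : nuC n a b ≠ 0 := by
  have g : ∀ j : ℤ, Real.Gamma (b + j) ≠ 0 := fun j =>
    gamma_ne_zero fun m h => hb (m - j) (by push_cast; linarith)
  have g1 := g (a + n + 1)
  have g2 := g (n + 1)
  have g3 := g (a + 2 * n + 1)
  have g4 := g (a + 2 * n + 2)
  have p1 : Real.Gamma ((n : ℝ) + 1) ≠ 0 := (Real.Gamma_pos_of_pos (by positivity)).ne'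
  have p2 : Real.Gamma ((a : ℝ) + n + 1) ≠ 0 := (Real.Gamma_pos_of_pos (by positivity)).ne'
  push_cast at g1 g2 g3 g4
  rw [nuC, show (a : ℝ) + b + n + 1 = b + (a + n + 1) by ring,
    show b + (n : ℝ) + 1 = b + (n + 1) by ring, show (a : ℝ) + b + 2 * n + 1 = b + (a + 2 * n + 1) by
    ring, show (a : ℝ) + b + 2 * n + 2 = b + (a + 2 * n + 2) by ring]
  have := Real.rpow_pos_of_pos (two_pos (α := ℝ)) (1 + a + b + 2 * n)
  positivity

theorem nuC_succ {b : ℝ} (hb : ∀ m : ℤ, b ≠ m) (n a : ℕ) :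
    ((n : ℝ) + a + b + 2) * nuC ((n : ℝ) + 1) a b = (n + 1) * nuC n ((a + 1 : ℕ) : ℝ) (b + 1) := by
  have hne : (n : ℝ) + a + b + 2 ≠ 0 := fun h => hb (-n - a - 2) (by push_cast; linarith)
  have e1 := Real.Gamma_add_one (s := (n : ℝ) + 1) (by positivity)
  have e2 := Real.Gamma_add_one hne
  rw [nuC, nuC]
  push_cast
  rw [show (1 : ℝ) + a + b + 2 * (n + 1) = 1 + (a + 1) + (b + 1) + 2 * n by ring, e1,
    show (a : ℝ) + b + (n + 1) + 1 = n + a + b + 2 by ring,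
    show (a : ℝ) + 1 + (b + 1) + n + 1 = n + a + b + 2 + 1 by ring, e2,
    show (a : ℝ) + (n + 1) + 1 = a + 1 + n + 1 by ring,
    show b + ((n : ℝ) + 1) + 1 = b + 1 + n + 1 by ring,
    show (a : ℝ) + b + 2 * (n + 1) + 1 = a + 1 + (b + 1) + 2 * n + 1 by ring,
    show (a : ℝ) + b + 2 * (n + 1) + 2 = a + 1 + (b + 1) + 2 * n + 2 by ring]
  ring

theorem nuC_zero_zero {b : ℝ} (hb : ∀ m : ℤ, b ≠ m) :
    nuC 0 ((0 : ℕ) : ℝ) b = 2 ^ (b + 1) / (b + 1) := by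
  have hne : b + 1 ≠ 0 := fun h => hb (-1) (by push_cast; linarith)
  have e1 := Real.Gamma_add_one hne
  have g := gamma_ne_zero (add_one_ne_int hb)
  rw [nuC]
  push_cast
  rw [show (0 : ℝ) + b + 2 * 0 + 2 = b + 1 + 1 by ring, e1]
  simp only [zero_add, add_zero, mul_zero, Real.Gamma_one, one_mul, mul_one, add_comm (1 : ℝ) b]
  field_simp

theorem nuC_zero_succ {b : ℝ} (hb : ∀ m : ℤ, b ≠ m) (a : ℕ) :
    ((a : ℝ) + b + 2) * nuC 0 ((a + 1 : ℕ) : ℝ) b = 2 * (a + 1) * nuC 0 a b := by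
  have hne : (a : ℝ) + b + 2 ≠ 0 := fun h => hb (-a - 2) (by push_cast; linarith)
  have e1 := Real.Gamma_add_one (s := (a : ℝ) + 1) (by positivity)
  have e2 := Real.Gamma_add_one hne
  have g : ∀ j : ℤ, Real.Gamma (b + j) ≠ 0 := fun j =>
    gamma_ne_zero fun m h => hb (m - j) (by push_cast; linarith)
  have g1 := g (a + 1)
  have g2 := g (a + 2)
  push_cast at g1 g2
  rw [nuC, nuC]
  push_cast
  rw [show (1 : ℝ) + (a + 1) + b + 2 * 0 = (1 + a + b + 2 * 0) + 1 by ring,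
    Real.rpow_add_one two_ne_zero, show (a : ℝ) + 1 + 0 + 1 = a + 1 + 1 by ring, e1,
    show (a : ℝ) + 1 + b + 2 * 0 + 2 = a + b + 2 + 1 by ring, e2,
    show (a : ℝ) + 1 + b + 0 + 1 = b + (a + 2) by ring,
    show (a : ℝ) + 1 + b + 2 * 0 + 1 = b + (a + 2) by ring,
    show (a : ℝ) + b + 2 * 0 + 2 = b + (a + 2) by ring,
    show (a : ℝ) + b + 2 * 0 + 1 = b + (a + 1) by ring,
    show (a : ℝ) + b + 0 + 1 = b + (a + 1) by ring,
    show (a : ℝ) + 0 + 1 = a + 1 by ring, show (a : ℝ) + b + 2 = b + (a + 2) by ring] at *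
  have hne' : b + ((a : ℝ) + 2) ≠ 0 := by intro h; exact hne (by linarith)
  field_simp

/-- The norms of the monic Jacobi polynomials. -/
theorem jacobiNorm_eq {b : ℝ} (hb : ∀ m : ℤ, b ≠ m) (a n : ℕ) :
    2 ^ (b + 1) * jacobiNorm a b n = nuC n a b := by
  -- Differentiation trades one unit of `n` for one in each parameter. What remains is `n = 0`,
  -- where the recurrence in `a` leads down to `1/(b + 1)`.
  induction n generalizing a b with
  | zero =>
    rw [Nat.cast_zero]
    induction a with
    | zero => rw [jacobiNorm_zero_zero hb, nuC_zero_zero hb]; ring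
    | succ a ih =>
      have hne : (a : ℝ) + b + 2 ≠ 0 := fun h => hb (-a - 2) (by push_cast; linarith)
      apply mul_left_cancel₀ hne
      rw [nuC_zero_succ hb, ← ih, mul_left_comm, jacobiNorm_zero_succ hb]
      ring
  | succ n ih =>
    have hne : (n : ℝ) + a + b + 2 ≠ 0 := fun h => hb (-n - a - 2) (by push_cast; linarith)
    apply mul_left_cancel₀ hne
    push_cast
    rw [nuC_succ hb, ← ih (add_one_ne_int hb), Real.rpow_add_one two_ne_zero (b + 1)]
    linear_combination (2 * (2 : ℝ) ^ (b + 1)) * jacobiNorm_succ (a := a) hb n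

theorem jacobiNorm_ne_zero {b : ℝ} (hb : ∀ m : ℤ, b ≠ m) (a n : ℕ) : jacobiNorm a b n ≠ 0 := by
  intro h
  apply nuC_ne_zero hb n a
  rw [← jacobiNorm_eq hb, h, mul_zero]

/-! ### The classical operator as an initial state -/

section ExcState

variable {τ : ℝ[X]} {α : ℕ} {β : ℝ} {s : ℤ} {J : Set ℕ} {lab : ℤ → Lab}
    {π : ℕ → RatFunc ℝ} {c N : ℕ → ℝ} {r : ℕ → ℕ → RatFunc ℝ}

theorem LabelState.reindex {u : RatFunc ℝ} {α β : ℝ} {s : ℤ} {lab : ℤ → Lab}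
    (h : LabelState u α β (s + 1) lab) : LabelState u α β s (fun n => lab (n + 1)) := by
  constructor
  · intro n
    have := h.ok (n + 1)
    push_cast at this
    rwa [add_sub_add_right_eq_sub] at this
  · intro μ hμ
    refine h.empty μ fun n => ?_
    have := hμ (n - 1)
    push_cast at this ⊢
    rwa [sub_sub, add_comm (1 : ℝ)] at this

/-- After a transformation with seed `0` the index `n + 1` takes over the role of `n`. -/
theorem ExcState.reindex (h : ExcState τ α β (s + 1) J lab π c N r) :
    ExcState τ α β s {n | n + 1 ∈ J} (fun n => lab (n + 1)) (fun n => π (n + 1))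
      (fun n => c (n + 1)) (fun n => N (n + 1)) (fun n m => r (n + 1) (m + 1)) := by
  have e : ∀ n : ℕ, lam α β .one (((n + 1 : ℕ) : ℤ) - (s + 1 : ℤ)) = lam α β .one ((n : ℤ) - s) := by
    intro n; push_cast; rw [add_sub_add_right_eq_sub]
  refine ⟨h.hβ, h.tau_one, h.tau_neg_one, h.labels.reindex, ?_, ?_, ?_, ?_, ?_, ?_, ?_⟩
  · intro n hn
    simpa using h.lab_circ (n + 1) hn
  · intro n hn
    have := h.eig (n + 1) hn
    rwa [e] at this
  · intro n hn
    have := h.lead (n + 1) hn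
    rwa [Nat.cast_succ, add_sub_add_right_eq_sub] at this
  · intro n hn m hm
    exact h.ode (n + 1) hn (m + 1) hm
  · intro n hn m hm
    have := h.rval (n + 1) hn (m + 1) hm
    simpa using this
  · intro n hn
    exact h.norm_ne (n + 1) hn
  · intro n hn
    have := h.loc (n + 1) hn
    rwa [e] at this

end ExcState

theorem excState_zero {b : ℝ} (hb : ∀ m : ℤ, b ≠ m) :
    ExcState 1 0 b 0 Set.univ (baseLab 0) (fun n => ι (jacobiMonic n ((0 : ℕ) : ℝ) b)) (fun _ => 1)
      (jacobiNorm 0 b) (fun n m => ι (jacobiRho 0 b n m)) := by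
  have hab := add_ne_int (a := 0) hb
  have e : dlog (ι 1) = 0 := by rw [map_one, dlog_one]
  have hm : ∀ n : ℕ, dlog (ι (jacobiMonic n ((0 : ℕ) : ℝ) b)) ∈ Ric (opU 0 ((0 : ℕ) : ℝ) b)
      (lam ((0 : ℕ) : ℝ) b .one (((n : ℤ) : ℝ) - ((0 : ℤ) : ℝ))) := by
    intro n
    have := dlog_jacobiMonic_mem hab n
    simpa using this
  refine ⟨hb, by simp, by simp, by rw [e]; exact labelState_zero hb, ?_, ?_, ?_, ?_, ?_, ?_, ?_⟩
  · intro n _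
    simp [baseLab]
  · intro n _
    rw [e]; exact hm n
  · intro n _
    rw [sub_zero]; exact hasLead_jacobiMonic hab n
  · intro n _ m _
    exact jacobiRho_ode hb 0 n m
  · intro n _ m _
    split_ifs with hnm
    · subst hnm; exact ValAt.poly 1 _
    · have hl : lam ((0 : ℕ) : ℝ) b .one ((m : ℤ) : ℝ) - lam ((0 : ℕ) : ℝ) b .one ((n : ℤ) : ℝ)
          ≠ 0 := by
        refine sub_ne_zero.2 fun h => hnm ?_
        have := lam_one_inj (α := 0) hb (m := m) (n := n) (by simpa using h)
        exact_mod_cast this.symm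
      have h1 := hm n
      have h2 := hm m
      rw [Int.cast_zero, sub_zero] at h1 h2
      have hn0 := (hasLead_jacobiMonic hab n).ne_zero
      have hm0 := (hasLead_jacobiMonic hab m).ne_zero
      have hBA := darB_darA h1 (ι (jacobiMonic m ((0 : ℕ) : ℝ) b))
      rw [(apply_opU_iff hm0).2 h2, ← sub_mul, ← map_sub] at hBA
      -- Orthogonality: the Wronskian is a polynomial, so `(1 - x)` times it vanishes at `1`, and so
      -- does the inner product, as the eigenvalues differ.
      have h3 := darboux_ode rfl hBA.symm (jacobiRho_ode hb 0 n m)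
      rw [darA_self, zero_mul, mul_zero] at h3
      have h4 := eq_zero_of_xp_ode (fun k hk => hb (k - 2) (by push_cast; linarith)) h3
      have h5 := (mul_eq_zero.1 h4).resolve_left (inv_ne_zero X_add_one_ne_zero)
      have e2 : ι (jacobiMonic n ((0 : ℕ) : ℝ) b) * darA (dlog (ι (jacobiMonic n ((0 : ℕ) : ℝ) b)))
          (ι (jacobiMonic m ((0 : ℕ) : ℝ) b)) = ι (jacobiMonic n ((0 : ℕ) : ℝ) b
            * derivative (jacobiMonic m ((0 : ℕ) : ℝ) b) - derivative (jacobiMonic n ((0 : ℕ) : ℝ) b)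
              * jacobiMonic m ((0 : ℕ) : ℝ) b) := by
        rw [darA, dlog, ratDeriv_algebraMap, ratDeriv_algebraMap, map_sub, map_mul, map_mul]
        field_simp
      rw [e2, zero_add, pow_one] at h5
      have h6 := (((ValAt.one 1).sub (ValAt.var 1)).mul (ValAt.poly 1 (jacobiMonic n ((0 : ℕ) : ℝ) b
            * derivative (jacobiMonic m ((0 : ℕ) : ℝ) b) - derivative (jacobiMonic n ((0 : ℕ) : ℝ) b)
              * jacobiMonic m ((0 : ℕ) : ℝ) b))).add
        ((ValAt.const 1 (lam ((0 : ℕ) : ℝ) b .one ((m : ℤ) : ℝ)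
          - lam ((0 : ℕ) : ℝ) b .one ((n : ℤ) : ℝ))).mul (ValAt.poly 1 (jacobiRho 0 b n m)))
      rw [h5] at h6
      have h7 := h6.unique (ValAt.zero 1)
      rw [sub_self, zero_mul, zero_add] at h7
      have h8 := ValAt.poly 1 (jacobiRho 0 b n m)
      rwa [(mul_eq_zero.1 h7).resolve_left hl] at h8
  · intro n _
    exact jacobiNorm_ne_zero hb 0 n
  · intro n _
    rw [e]
    have := locAt_zero b (lam ((0 : ℕ) : ℝ) b .one (((n : ℤ) : ℝ) - ((0 : ℤ) : ℝ)))
    simpa using this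

theorem ExcState.congr {τ : ℝ[X]} {α : ℕ} {β : ℝ} {s : ℤ} {J J' : Set ℕ} {lab lab' : ℤ → Lab}
    {π π' : ℕ → RatFunc ℝ} {c c' N N' : ℕ → ℝ} {r r' : ℕ → ℕ → RatFunc ℝ}
    (h : ExcState τ α β s J lab π c N r) (hJ : J' ⊆ J) (hlab : ∀ n, lab' n = lab n)
    (hπ : ∀ n ∈ J', π' n = π n) (hc : ∀ n ∈ J', c' n = c n) (hN : ∀ n ∈ J', N' n = N n)
    (hr : ∀ n ∈ J', ∀ m ∈ J', r' n m = r n m) : ExcState τ α β s J' lab' π' c' N' r' := by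
  obtain rfl : lab' = lab := funext hlab
  refine ⟨h.hβ, h.tau_one, h.tau_neg_one, h.labels, fun n hn => h.lab_circ n (hJ hn), ?_, ?_, ?_, ?_,
    ?_, fun n hn => h.loc n (hJ hn)⟩
  · intro n hn
    rw [hπ n hn]; exact h.eig n (hJ hn)
  · intro n hn
    rw [hπ n hn, hc n hn]; exact h.lead n (hJ hn)
  · intro n hn m hm
    rw [hπ n hn, hπ m hm, hr n hn m hm]; exact h.ode n (hJ hn) m (hJ hm)
  · intro n hn m hm
    rw [hr n hn m hm]
    convert h.rval n (hJ hn) m (hJ hm) using 2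
    exact hN n hn
  · intro n hn
    rw [hN n hn]; exact h.norm_ne n (hJ hn)

/-- Each step takes the constant eigenfunction as seed, leaves `τ = 1`, shifts the indices by one
and divides `π (n + 1)'` by `n + 1`. The used seed becomes an `ast` label at `-1`, and earlier ones
move down by one. -/
theorem excState_base {b : ℝ} (hb : ∀ m : ℤ, b ≠ m) (a : ℕ) :
    ExcState 1 a b 0 Set.univ (baseLab a) (fun n => ι (jacobiMonic n a b)) (fun _ => 1)
      (jacobiNorm a b) (fun n m => ι (jacobiRho a b n m)) := by
  induction a generalizing b with
  | zero => exact excState_zero hb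
  | succ a ih =>
    obtain ⟨b, rfl⟩ : ∃ b', b = b' + 1 := ⟨b - 1, by ring⟩
    replace hb : ∀ m : ℤ, b ≠ m := fun m h => hb (m + 1) (by push_cast; linarith)
    have hab := add_ne_int (a := a) hb
    obtain ⟨τ', hτ', h⟩ := (ih hb).kStep (Set.mem_univ 0)
    have h0 : jacobiMonic 0 a b = 1 := jacobiMonic_zero hab
    have hτ1 : τ' = 1 := by
      apply RatFunc.algebraMap_injective ℝ
      rw [hτ', h0]; simp
    subst hτ1
    have hk : ∀ n ∈ {n : ℕ | n + 1 ∈ Set.univ \ ({0} : Set ℕ)}, ((n : ℝ) + 1)⁻¹ ≠ 0 := by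
      intro n _; positivity
    have hd : ∀ n : ℕ, darA (dlog (ι (jacobiMonic 0 a b))) (ι (jacobiMonic (n + 1) a b)) =
        RatFunc.C ((n : ℝ) + 1) * ι (jacobiMonic n ((a + 1 : ℕ) : ℝ) (b + 1)) := by
      intro n
      rw [h0, map_one, dlog_one, darA, zero_mul, sub_zero, derivative_jacobiMonic hb]
    refine ((h.reindex).rescale hk).congr (fun n _ => by simp) ?_ ?_ ?_ ?_ ?_
    · intro n
      rcases eq_or_ne n (-1) with rfl | hn
      · simp [baseLab]
      · have hn' : n + 1 ≠ ((0 : ℕ) : ℤ) := by push_cast; omega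
        simp only [Function.update_of_ne hn', baseLab]
        push_cast
        split_ifs <;> first | rfl | omega
    · intro n _
      have hne : (n : ℝ) + 1 ≠ 0 := by positivity
      simp only [hd]
      rw [← mul_assoc, ← map_mul, inv_mul_cancel₀ hne, map_one, one_mul]
    · intro n _
      have hne : (n : ℝ) + 1 ≠ 0 := by positivity
      push_cast
      field_simp
      ring
    · intro n _
      have hne : (n : ℝ) + 1 ≠ 0 := by positivity
      have := jacobiNorm_succ (a := a) hb n
      simp only [lam]
      push_cast
      field_simp
      linear_combination (-2 * ((n : ℝ) + 1)) * this
    · intro n _ m _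
      have hn : (n : ℝ) + 1 ≠ 0 := by positivity
      have hm : (m : ℝ) + 1 ≠ 0 := by positivity
      have e : lam a b .one (((m + 1 : ℕ) : ℤ) - (0 : ℤ)) - lam a b .one (((0 : ℕ) : ℤ) - (0 : ℤ)) =
          lam a b .one ((m : ℝ) + 1) := by
        simp only [lam]; push_cast; ring
      have h1 := jacobiRho_succ (a := a) hb n m
      rw [← mul_inv, e, hd, ← derivative_jacobiMonic hb, h1, ← mul_assoc, ← map_mul,
        inv_mul_cancel₀ (mul_ne_zero hn hm), map_one, one_mul]

/-! ### Determinants -/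

/-- Subtracting a combination of the other columns from column `0` clears it below the corner,
leaving a block triangular determinant. -/
theorem det_bordered_zero {q : ℕ} (M : Matrix (Fin (q + 1)) (Fin (q + 1)) (RatFunc ℝ))
    (x : Fin q → RatFunc ℝ) (h : ∀ i : Fin q, M i.succ 0 - ∑ k, x k * M i.succ k.succ = 0) :
    M.det = (M 0 0 - ∑ k, x k * M 0 k.succ) * (M.submatrix Fin.succ Fin.succ).det := by
  have h1 := Matrix.det_updateCol_sum M 0 (Fin.cons 1 fun k => -x k)
  simp only [Fin.cons_zero, one_smul] at h1
  have h3 : (fun i => ∑ k, (Fin.cons 1 fun k => -x k : Fin (q + 1) → RatFunc ℝ) k • M i k) =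
      fun i => M i 0 - ∑ k, x k * M i k.succ := by
    funext i
    simp [Fin.sum_univ_succ, sub_eq_add_neg]
  rw [← h1, Matrix.det_succ_column_zero, Fin.sum_univ_succ, Finset.sum_eq_zero, add_zero]
  · rw [h3]
    simp only [Matrix.updateCol_self, Fin.val_zero, pow_zero, one_mul]
    congr 2
  · intro i _
    rw [h3]
    simp [h i]

theorem det_bordered_last {p : ℕ} (M : Matrix (Fin (p + 1)) (Fin (p + 1)) (RatFunc ℝ))
    (x : Fin p → RatFunc ℝ)
    (h : ∀ j : Fin p, M (Fin.last p) j.castSucc + ∑ k, x k * M k.castSucc j.castSucc = 0) :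
    M.det = (M (Fin.last p) (Fin.last p) + ∑ k, x k * M k.castSucc (Fin.last p))
      * (M.submatrix Fin.castSucc Fin.castSucc).det := by
  have h1 := Matrix.det_updateRow_sum M (Fin.last p) (Fin.snoc x 1)
  simp only [Fin.snoc_last, one_smul] at h1
  have h3 : (∑ k, (Fin.snoc x 1 : Fin (p + 1) → RatFunc ℝ) k • M k) =
      fun j => M (Fin.last p) j + ∑ k, x k * M k.castSucc j := by
    funext j
    rw [Fin.sum_univ_castSucc]
    simp [Finset.sum_apply, add_comm]
  rw [← h1, Matrix.det_succ_row _ (Fin.last p), Fin.sum_univ_castSucc, Finset.sum_eq_zero, zero_add]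
  · rw [h3]
    simp only [Matrix.updateRow_self, Fin.val_last, ← two_mul, pow_mul, neg_one_sq, one_pow, one_mul]
    congr 2
    ext i j
    simp [Fin.succAbove_last]
  · intro j _
    rw [h3]
    simp [h j]

/-! ### Chains of transformations -/

section ExcState

variable {τ : ℝ[X]} {α : ℕ} {β : ℝ} {s : ℤ} {J : Set ℕ} {lab : ℤ → Lab}
    {π : ℕ → RatFunc ℝ} {c N : ℕ → ℝ} {r : ℕ → ℕ → RatFunc ℝ}

open Classical in
/-- A chain of confluent transformations. -/
theorem ExcState.lChain (h : ExcState τ α β s J lab π c N r) (q : ℕ) (l : Fin q → ℕ)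
    (hl : Function.Injective l) (hlJ : ∀ i, l i ∈ J) :
    ∃ (τ' : ℝ[X]) (π' : ℕ → RatFunc ℝ) (r' : ℕ → ℕ → RatFunc ℝ),
      ExcState τ' α (β + 2 * q) (s + q) (J \ Set.range l)
        (fun n => if ∃ i, (l i : ℤ) = n then .minus else lab n) π'
        (fun n => c n * ∏ i, ((n : ℝ) - l i) / (n + l i - 2 * s + α + β + 1))
        (fun n => N n / 4 ^ q) r' ∧
      (τ'.natDegree : ℤ) = τ.natDegree + ∑ i, (2 * (l i : ℤ) + α - 2 * s) - q * (q - 1) ∧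
      ι τ' * xp ^ (q * q) = ι τ * (Matrix.of fun i j => r (l i) (l j)).det * xp ^ q ∧
      (∀ n ∈ J \ Set.range l, ∃ x : Fin q → RatFunc ℝ,
        xp ^ q * π' n = π n - ∑ i, x i * π (l i) ∧
        ∀ m, xp ^ (2 * q) * r' n m = r n m - ∑ i, x i * r (l i) m) ∧
      ∀ n i, r' n (l i) = 0 := by
  have hx2 := X_add_one_ne_zero
  induction q with
  | zero =>
    refine ⟨τ, π, r, ?_, by simp, by simp, fun n _ => ⟨fun _ => 0, by simp, by simp⟩,
      fun _ i => i.elim0⟩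
    rw [Nat.cast_zero, mul_zero, add_zero, Nat.cast_zero, add_zero]
    exact h.congr Set.sdiff_subset (fun n => by simp) (fun _ _ => rfl) (fun n _ => by simp)
      (fun n _ => by simp) (fun _ _ _ _ => rfl)
  | succ q ih =>
    -- The tail is treated first and `l 0` last, so that the new seed borders the old matrix in row
    -- and column `0`.
    obtain ⟨τ', π', r', h1, hdeg, hτ, hx, h0⟩ := ih (fun i => l i.succ)
      (fun i j hij => Fin.succ_injective _ (hl hij)) (fun i => hlJ i.succ)
    have hmem : l 0 ∈ J \ Set.range fun i : Fin q => l i.succ := by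
      refine ⟨hlJ 0, ?_⟩
      rintro ⟨i, hi⟩
      exact Fin.succ_ne_zero i (hl hi)
    have hsub : J \ Set.range l ⊆ (J \ Set.range fun i : Fin q => l i.succ) \ {l 0} := by
      rintro n ⟨hn, hn'⟩
      refine ⟨⟨hn, ?_⟩, ?_⟩
      · rintro ⟨i, rfl⟩; exact hn' ⟨_, rfl⟩
      · rintro rfl; exact hn' ⟨_, rfl⟩
    obtain ⟨τ₂, hτ₂, h2⟩ := h1.lStep hmem
    have hN := h1.norm_ne _ hmem
    have hρv := h1.rval _ hmem _ hmem
    rw [if_pos rfl] at hρv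
    have hρ := hρv.ne_zero hN
    refine ⟨τ₂, fun n => xp⁻¹ * (π' n - π' (l 0) * (r' (l 0) n / r' (l 0) (l 0))),
      fun n m => xp⁻¹ ^ 2 * (r' n m - r' n (l 0) * r' (l 0) m / r' (l 0) (l 0)), ?_, ?_, ?_, ?_, ?_⟩
    · rw [show β + 2 * (q : ℝ) + 2 = β + 2 * ((q + 1 : ℕ) : ℝ) by push_cast; ring,
        show s + (q : ℤ) + 1 = s + ((q + 1 : ℕ) : ℤ) by push_cast; ring] at h2
      refine h2.congr hsub ?_ (fun _ _ => rfl) ?_ ?_ (fun _ _ _ _ => rfl)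
      · intro n
        rcases eq_or_ne n (l 0) with rfl | hn
        · rw [Function.update_self, if_pos ⟨0, rfl⟩]
        · rw [Function.update_of_ne hn]
          refine if_congr ?_ rfl rfl
          constructor
          · rintro ⟨i, hi⟩
            rcases Fin.eq_zero_or_eq_succ i with rfl | ⟨j, rfl⟩
            · exact absurd hi.symm hn
            · exact ⟨j, hi⟩
          · rintro ⟨i, hi⟩; exact ⟨_, hi⟩
      · intro n _
        rw [Fin.prod_univ_succ]
        push_cast
        rw [show (n : ℝ) + l 0 - 2 * (s + q) + α + (β + 2 * q) + 1 = n + l 0 - 2 * s + α + β + 1 by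
          ring]
        ring
      · intro n _
        rw [pow_succ, div_div]
    · obtain ⟨y, hy⟩ := h1.exists_hasLead_r hmem
      have hd := (hasLead_poly h2.tau_ne_zero).unique
        (hτ₂ ▸ (hasLead_poly h1.tau_ne_zero).mul hy)
      rw [hd.1, hdeg, Fin.sum_univ_succ]
      push_cast
      ring
    · obtain ⟨x, -, hxr⟩ := hx _ hmem
      have hsym : ∀ i j, r (l i) (l j) = r (l j) (l i) := fun i j => h.r_symm (hlJ i) (hlJ j)
      have hdet := det_bordered_zero (Matrix.of fun i j => r (l i) (l j)) x (fun i => by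
        have := hxr (l i.succ)
        rw [h0, mul_zero] at this
        simp only [Matrix.of_apply]
        rw [hsym, this]
        congr 1
        exact Finset.sum_congr rfl fun k _ => by rw [hsym])
      have e : r (l 0) (l 0) - ∑ k, x k * r (l 0) (l k.succ) = xp ^ (2 * q) * r' (l 0) (l 0) := by
        rw [hxr (l 0)]
        congr 1
        exact Finset.sum_congr rfl fun k _ => by rw [hsym]
      simp only [Matrix.of_apply] at hdet
      rw [e] at hdet
      have e2 : ((Matrix.of fun i j => r (l i) (l j)).submatrix Fin.succ Fin.succ) =
        Matrix.of fun i j : Fin q => r (l i.succ) (l j.succ) := rfl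
      rw [hdet, e2, hτ₂]
      -- The determinant gains `(1 + x)^(2q)` from the inner product of the transformed seed; summed
      -- over all steps this is `q² - q`.
      have e3 : (q + 1) * (q + 1) = q * q + (2 * q + 1) := by ring
      rw [e3, pow_add, pow_succ xp q]
      linear_combination (r' (l 0) (l 0) * xp ^ (2 * q + 1)) * hτ
    · intro n hn
      have hnJ := (hsub hn).1
      obtain ⟨x, hxπ, hxr⟩ := hx n hnJ
      obtain ⟨x₀, hxπ₀, hxr₀⟩ := hx _ hmem
      have hs := h1.r_symm hnJ hmem
      -- Substituting the expansion of the transformed seed into the new projection gives these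
      -- coefficients.
      refine ⟨Fin.cons (r' (l 0) n / r' (l 0) (l 0))
        fun i => x i - r' (l 0) n / r' (l 0) (l 0) * x₀ i, ?_, ?_⟩
      · rw [Fin.sum_univ_succ]
        simp only [Fin.cons_zero, Fin.cons_succ, sub_mul, Finset.sum_sub_distrib, mul_assoc,
          ← Finset.mul_sum]
        rw [pow_succ, mul_assoc, mul_inv_cancel_left₀ hx2]
        linear_combination hxπ - (r' (l 0) n / r' (l 0) (l 0)) * hxπ₀
      · intro m
        rw [Fin.sum_univ_succ]
        simp only [Fin.cons_zero, Fin.cons_succ, sub_mul, Finset.sum_sub_distrib, mul_assoc,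
          ← Finset.mul_sum]
        rw [mul_add, pow_add, mul_assoc, mul_one, inv_pow, mul_inv_cancel_left₀ (pow_ne_zero 2 hx2),
          hs]
        linear_combination hxr m - (r' (l 0) n / r' (l 0) (l 0)) * hxr₀ m
    · intro n i
      rcases Fin.eq_zero_or_eq_succ i with rfl | ⟨j, rfl⟩
      · simp only []
        rw [mul_div_assoc, div_self hρ]; ring
      · have e1 := h0 n j
        have e2 := h0 (l 0) j
        simp only [] at e1 e2 ⊢
        rw [e1, e2]; simp

/-- The Wronskian determinant of rational functions. -/
def ratWr {p : ℕ} (f : Fin p → RatFunc ℝ) : RatFunc ℝ :=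
  (Matrix.of fun i j : Fin p => ∂^[(i : ℕ)] (f j)).det

open Classical in
/-- A chain of Darboux transformations with regular seeds. -/
theorem ExcState.kChain (h : ExcState τ α β s J lab π c N r) (p : ℕ) (k : Fin p → ℕ)
    (hk : Function.Injective k) (hkJ : ∀ i, k i ∈ J) :
    ∃ (τ' : ℝ[X]) (π' : ℕ → RatFunc ℝ) (r' : ℕ → ℕ → RatFunc ℝ),
      ExcState τ' (α + p) (β + p) (s + p) (J \ Set.range k)
        (fun n => if ∃ i, (k i : ℤ) = n then .ast else lab n) π'
        (fun n => c n * ∏ i, ((n : ℝ) - k i))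
        (fun n => (∏ i, ((n : ℝ) - k i) * (n + k i - 2 * s + α + β + 1)) * N n / 2 ^ p) r' ∧
      (τ'.natDegree : ℤ) = τ.natDegree + ∑ i, ((k i : ℤ) - s) - p.choose 2 ∧
      ι τ' = ι τ * ratWr (fun i => π (k i)) ∧
      (∃ x : Fin p → RatFunc ℝ, ∀ n, π' n = ∂^[p] (π n) + ∑ i, x i * ∂^[(i : ℕ)] (π n)) ∧
      ∀ i, π' (k i) = 0 := by
  induction p with
  | zero =>
    refine ⟨τ, π, r, ?_, by simp, by simp [ratWr], ⟨fun _ => 0, by simp⟩, fun i => i.elim0⟩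
    rw [add_zero, Nat.cast_zero, add_zero, Nat.cast_zero, add_zero]
    exact h.congr Set.sdiff_subset (fun n => by simp) (fun _ _ => rfl) (fun n _ => by simp)
      (fun n _ => by simp) (fun _ _ _ _ => rfl)
  | succ p ih =>
    obtain ⟨τ', π', r', h1, hdeg, hτ, ⟨x, hx⟩, h0⟩ := ih (fun i => k i.castSucc)
      (fun i j hij => Fin.castSucc_injective _ (hk hij)) (fun i => hkJ i.castSucc)
    obtain ⟨w, hw⟩ : ∃ w, w = k (Fin.last p) := ⟨_, rfl⟩
    have hmem : w ∈ J \ Set.range fun i : Fin p => k i.castSucc := by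
      rw [hw]
      refine ⟨hkJ _, ?_⟩
      rintro ⟨i, hi⟩
      exact (Fin.castSucc_lt_last i).ne (hk hi)
    have hsub : J \ Set.range k ⊆ (J \ Set.range fun i : Fin p => k i.castSucc) \ {w} := by
      rintro n ⟨hn, hn'⟩
      refine ⟨⟨hn, ?_⟩, ?_⟩
      · rintro ⟨i, rfl⟩; exact hn' ⟨_, rfl⟩
      · rintro rfl; exact hn' ⟨_, hw.symm⟩
    obtain ⟨τ₂, hτ₂, h2⟩ := h1.kStep hmem
    refine ⟨τ₂, fun n => darA (dlog (π' w)) (π' n), fun n m => xp⁻¹ * ((1 - RatFunc.X) ^ (α + p + 1)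
      * (π' n * darA (dlog (π' w)) (π' m)) + RatFunc.C (lam (α + p : ℕ) (β + p) .one
        ((m : ℤ) - (s + p : ℤ)) - lam (α + p : ℕ) (β + p) .one ((w : ℤ) - (s + p : ℤ))) * r' n m),
      ?_, ?_, ?_, ?_, ?_⟩
    · rw [show β + (p : ℝ) + 1 = β + ((p + 1 : ℕ) : ℝ) by push_cast; ring,
        show s + (p : ℤ) + 1 = s + ((p + 1 : ℕ) : ℤ) by push_cast; ring] at h2
      refine h2.congr hsub ?_ (fun _ _ => rfl) ?_ ?_ (fun _ _ _ _ => rfl)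
      · intro n
        rcases eq_or_ne n w with rfl | hn
        · rw [Function.update_self, if_pos ⟨Fin.last p, by rw [hw]⟩]
        · rw [Function.update_of_ne hn]
          refine if_congr ?_ rfl rfl
          constructor
          · rintro ⟨i, hi⟩
            rcases Fin.eq_castSucc_or_eq_last i with ⟨j, rfl⟩ | rfl
            · exact ⟨j, hi⟩
            · exact absurd (by rw [← hi, hw]) hn
          · rintro ⟨i, hi⟩; exact ⟨_, hi⟩
      · intro n _
        rw [Fin.prod_univ_castSucc, hw]
        ring
      · intro n _
        have e : lam ((α + p : ℕ) : ℝ) (β + p) .one ((n : ℤ) - (s + p : ℤ)) -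
            lam ((α + p : ℕ) : ℝ) (β + p) .one ((w : ℤ) - (s + p : ℤ)) =
              ((n : ℝ) - w) * (n + w - 2 * s + α + β + 1) := by
          simp only [lam]; push_cast; ring
        push_cast at e ⊢
        rw [e, Fin.prod_univ_castSucc, ← hw, pow_succ]
        ring
    · have hd := (hasLead_poly h2.tau_ne_zero).unique
        (hτ₂ ▸ (hasLead_poly h1.tau_ne_zero).mul (h1.lead _ hmem))
      rw [hd.1, hdeg, Fin.sum_univ_castSucc, ← hw, Nat.choose_succ_succ' p 1, Nat.choose_one_right]
      push_cast
      ring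
    · have hdet := det_bordered_last
        (Matrix.of fun i j : Fin (p + 1) => ∂^[(i : ℕ)] (π (k j))) x (fun j => by
          have := hx (k j.castSucc)
          rw [h0] at this
          simpa using this.symm)
      simp only [Matrix.of_apply, Fin.val_last, Fin.val_castSucc] at hdet
      rw [← hx, ← hw] at hdet
      rw [ratWr, hdet, hτ₂, hτ]
      have e : (Matrix.of fun i j : Fin (p + 1) => ∂^[(i : ℕ)] (π (k j))).submatrix Fin.castSucc
        Fin.castSucc = Matrix.of fun i j : Fin p => ∂^[(i : ℕ)] (π (k j.castSucc)) := rfl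
      rw [e, ratWr]
      ring
    · have hit : ∀ (i : ℕ) (f : RatFunc ℝ), ∂ (∂^[i] f) = ∂^[i + 1] f := fun i f =>
        (Function.iterate_succ_apply' _ _ _).symm
      -- These are the coefficients of the composite of `D - w` with `D^p + ∑ x_i D^i`.
      refine ⟨fun i => (if hi : (i : ℕ) < p then ∂ (x ⟨i, hi⟩) - dlog (π' w) * x ⟨i, hi⟩
        else -dlog (π' w)) + (if hi : 0 < (i : ℕ) then x ⟨i - 1, by omega⟩ else 0), fun n => ?_⟩
      beta_reduce
      rw [darA, hx n, ratDeriv_add, ratDeriv_sum, hit]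
      simp only [ratDeriv_mul, hit, add_mul, Finset.sum_add_distrib]
      have e1 : ∑ i : Fin (p + 1), (if hi : (i : ℕ) < p then
          ∂ (x ⟨i, hi⟩) - dlog (π' w) * x ⟨i, hi⟩ else -dlog (π' w)) * ∂^[(i : ℕ)] (π n) =
          ∑ i : Fin p, (∂ (x i) - dlog (π' w) * x i) * ∂^[(i : ℕ)] (π n)
            - dlog (π' w) * ∂^[p] (π n) := by
        rw [Fin.sum_univ_castSucc]
        simp [sub_eq_add_neg]
      have e2 : ∑ i : Fin (p + 1), (if hi : 0 < (i : ℕ) then x ⟨i - 1, by omega⟩ else 0)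
          * ∂^[(i : ℕ)] (π n) = ∑ i : Fin p, x i * ∂^[(i : ℕ) + 1] (π n) := by
        rw [Fin.sum_univ_succ]
        simp
      rw [e1, e2]
      simp only [sub_mul, Finset.sum_sub_distrib, mul_assoc, ← Finset.mul_sum]
      ring
    · intro i
      rcases Fin.eq_castSucc_or_eq_last i with ⟨j, rfl⟩ | rfl
      · have := h0 j
        simp only [] at this ⊢
        rw [this, darA, ratDeriv_zero, mul_zero, sub_zero]
      · rw [← hw]; exact darA_self _

/-- The eigenfunctions after a chain of Darboux transformations as quotients of Wronskians. -/
theorem ratWr_snoc {p : ℕ} {f : Fin p → RatFunc ℝ} {g y : RatFunc ℝ} {x : Fin p → RatFunc ℝ}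
    (h : ∀ j, ∂^[p] (f j) + ∑ i, x i * ∂^[(i : ℕ)] (f j) = 0)
    (hy : y = ∂^[p] g + ∑ i, x i * ∂^[(i : ℕ)] g) :
    ratWr (Fin.snoc (α := fun _ => RatFunc ℝ) f g) = y * ratWr f := by
  have hdet := det_bordered_last
    (Matrix.of fun i j : Fin (p + 1) => ∂^[(i : ℕ)] (Fin.snoc (α := fun _ => RatFunc ℝ) f g j)) x
    (fun j => by simpa using h j)
  simp only [Matrix.of_apply, Fin.val_last, Fin.val_castSucc, Fin.snoc_last, ← hy] at hdet
  rw [ratWr, hdet, ratWr]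
  congr 2
  ext i j
  simp

end ExcState

/-! ### The state attached to `K` and `L` -/

theorem enum_injective (L : Finset ℕ) : Function.Injective (enum L) :=
  (L.orderEmbOfFin rfl).injective

theorem range_enum (L : Finset ℕ) : Set.range (enum L) = L := L.range_orderEmbOfFin rfl

theorem enum_mem (L : Finset ℕ) (i : Fin L.card) : enum L i ∈ L := L.orderEmbOfFin_mem rfl i

theorem exists_enum_iff (L : Finset ℕ) (p : ℕ → Prop) : (∃ i, p (enum L i)) ↔ ∃ l ∈ L, p l := by
  have h := range_enum L
  constructor
  · rintro ⟨i, hi⟩; exact ⟨_, enum_mem L i, hi⟩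
  · rintro ⟨l, hl, hp⟩
    rw [← Finset.mem_coe, ← h] at hl
    obtain ⟨i, rfl⟩ := hl
    exact ⟨i, hp⟩

theorem prod_enum {M : Type*} [CommMonoid M] (L : Finset ℕ) (f : ℕ → M) :
    ∏ i, f (enum L i) = ∏ l ∈ L, f l := by
  have h := L.map_orderEmbOfFin_univ rfl
  conv_rhs => rw [← h, Finset.prod_map]
  rfl

theorem sum_enum (L : Finset ℕ) (f : ℕ → ℤ) : ∑ i, f (enum L i) = ∑ l ∈ L, f l := by
  have h := L.map_orderEmbOfFin_univ rfl
  conv_rhs => rw [← h, Finset.sum_map]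
  rfl

/-- The matrix `R` without its quasi-rational factor. -/
def polyR (L : Finset ℕ) (a : ℕ) (b : ℝ) : Matrix (Fin L.card) (Fin L.card) (RatFunc ℝ) :=
  Matrix.of fun i j => ι (jacobiRho a b (enum L i) (enum L j))

/-- The matrix `A(n)` without its quasi-rational factors. -/
def polyA (L : Finset ℕ) (a : ℕ) (b : ℝ) (n : ℕ) :
    Matrix (Fin (L.card + 1)) (Fin (L.card + 1)) (RatFunc ℝ) :=
  Matrix.of fun i j => Fin.cases (ι (jacobiMonic ((Fin.cons n (enum L) : Fin _ → ℕ) j) a b))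
    (fun i' => ι (jacobiRho a b (enum L i') ((Fin.cons n (enum L) : Fin _ → ℕ) j))) i

theorem chiHat_ne_zero {L : Finset ℕ} {a : ℕ} {b : ℝ} (hb : ∀ m : ℤ, b ≠ m) {n : ℕ} (hn : n ∉ L) :
    chiHat L a b n ≠ 0 := by
  refine Finset.prod_ne_zero_iff.2 fun k hk => div_ne_zero ?_ ?_
  · intro h; exact hb (-n - k - a - 1) (by push_cast; linarith)
  · intro h
    have : (n : ℝ) = k := by linarith
    exact hn (by rw [Nat.cast_injective this]; exact hk)

theorem chi_ne_zero {K : Finset ℕ} {n : ℕ} (hn : n ∉ K) : chi K n ≠ 0 := by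
  refine Finset.prod_ne_zero_iff.2 fun k hk => inv_ne_zero fun h => ?_
  have : (n : ℝ) = k := by linarith
  exact hn (by rw [Nat.cast_injective this]; exact hk)

open Classical in
/-- The labels of the operator attached to `K` and `L`. -/
def labA (K L : Finset ℕ) (a : ℕ) (n : ℤ) : Lab :=
  if ∃ k ∈ K, (k : ℤ) = n then .ast else if ∃ l ∈ L, (l : ℤ) = n then .minus else baseLab a n

theorem choose_two_add (p q : ℕ) : ((p + q).choose 2 : ℤ) = p.choose 2 + p * q + q.choose 2 := by
  have h : ∀ n : ℕ, ((n + 1).choose 2 : ℤ) = n + n.choose 2 := by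
    intro n
    rw [Nat.choose_succ_succ' n 1, Nat.choose_one_right]; push_cast; ring
  induction q with
  | zero => simp
  | succ q ih => rw [← add_assoc, h, h, ih]; push_cast; ring

theorem two_mul_choose_two (q : ℕ) : 2 * (q.choose 2 : ℤ) = q * (q - 1) := by
  induction q with
  | zero => simp
  | succ q ih =>
    rw [Nat.choose_succ_succ' q 1, Nat.choose_one_right]; push_cast; linarith

theorem jacobiRho_symm (a : ℕ) (b : ℝ) (i j : ℕ) : jacobiRho a b i j = jacobiRho a b j i := by
  rw [jacobiRho, jacobiRho, mul_comm (jacobiMonic i a b)]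

/-- The hypothesis says that the projected function has zero inner product with every seed, so one
column operation evaluates the bordered determinant. -/
theorem det_polyA_eq {L : Finset ℕ} {a : ℕ} {b : ℝ} {n : ℕ} {x : Fin L.card → RatFunc ℝ}
    (h : ∀ i, ι (jacobiRho a b n (enum L i))
      - ∑ k, x k * ι (jacobiRho a b (enum L k) (enum L i)) = 0) :
    (polyA L a b n).det = (ι (jacobiMonic n a b) - ∑ k, x k * ι (jacobiMonic (enum L k) a b))
      * (polyR L a b).det := by
  have h1 := det_bordered_zero (polyA L a b n) x fun i => by
    have := h i
    simp only [jacobiRho_symm a b _ (enum L i)] at this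
    exact this
  exact h1

/-- The confluent chain precedes the regular one. Between them `χ̂(·; L)` restores monic
eigenfunctions, and afterwards `χ(·; K)` does; the squares of these factors, with the norm factors
of the steps, produce `κ` and the powers of two. -/
theorem exists_state {b : ℝ} (hb : ∀ m : ℤ, b ≠ m) (a : ℕ) {K L : Finset ℕ} (hKL : Disjoint K L) :
    ∃ (τ₁ τ : ℝ[X]) (π₁ π₂ : ℕ → RatFunc ℝ) (r : ℕ → ℕ → RatFunc ℝ),
      ExcState τ (a + K.card) (b + 2 * L.card + K.card) (L.card + K.card) {n | n ∉ K ∧ n ∉ L}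
        (labA K L a) (fun n => RatFunc.C (chi K n) * π₂ n) (fun _ => 1)
        (fun n => kappaA K L a b n * jacobiNorm a b n / 4 ^ L.card / 2 ^ K.card) r ∧
      (τ.natDegree : ℤ) = 2 * (∑ l ∈ L, (l : ℤ)) + (∑ k ∈ K, (k : ℤ))
        - (K.card + L.card).choose 2 - L.card.choose 2 + L.card * a ∧
      (polyR L a b).det ≠ 0 ∧
      ι τ₁ * xp ^ (L.card * L.card) = (polyR L a b).det * xp ^ L.card ∧
      (∀ n ∉ L, (polyA L a b n).det = xp ^ L.card * π₁ n * (polyR L a b).det) ∧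
      ι τ = ι τ₁ * ratWr (fun i => RatFunc.C (chiHat L a b (enum K i)) * π₁ (enum K i)) ∧
      ∀ n : ℕ, ratWr (Fin.snoc (α := fun _ => RatFunc ℝ)
        (fun i => RatFunc.C (chiHat L a b (enum K i)) * π₁ (enum K i))
        (RatFunc.C (chiHat L a b n) * π₁ n)) =
          π₂ n * ratWr (fun i => RatFunc.C (chiHat L a b (enum K i)) * π₁ (enum K i)) := by
  have hx2 := X_add_one_ne_zero
  have h0 := excState_base hb a
  obtain ⟨τ₁, π₁, r₁, h1, hd1, ht1, hx1, hz1⟩ :=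
    h0.lChain L.card (enum L) (enum_injective L) (fun _ => Set.mem_univ _)
  have hmem1 : ∀ {n : ℕ}, n ∈ Set.univ \ Set.range (enum L) ↔ n ∉ L := by
    intro n; rw [range_enum]; simp
  have h2 := h1.rescale (k := fun n => chiHat L a b n) fun n hn => chiHat_ne_zero hb (hmem1.1 hn)
  have hkJ : ∀ i, enum K i ∈ Set.univ \ Set.range (enum L) := fun i =>
    hmem1.2 (Finset.disjoint_left.1 hKL (enum_mem K i))
  obtain ⟨τ, π₂, r₂, h3, hd3, ht3, ⟨y, hy⟩, hz3⟩ := h2.kChain K.card (enum K) (enum_injective K) hkJ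
  have hmem3 : ∀ {n : ℕ}, n ∈ (Set.univ \ Set.range (enum L)) \ Set.range (enum K) ↔
      n ∉ K ∧ n ∉ L := by
    intro n
    rw [Set.mem_sdiff, hmem1, range_enum, Finset.mem_coe, and_comm]
  have h4 := h3.rescale (k := fun n => chi K n) fun n hn => chi_ne_zero (hmem3.1 hn).1
  have hτ1 : ι τ₁ * xp ^ (L.card * L.card) = (polyR L a b).det * xp ^ L.card := by
    rw [ht1, map_one, one_mul]; rfl
  refine ⟨τ₁, τ, π₁, π₂, fun n m => RatFunc.C (chi K n * chi K m) * r₂ n m, ?_, ?_, ?_, hτ1, ?_, ht3,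
    fun n => ratWr_snoc (x := y) (fun j => by rw [← hy, hz3]) (hy n)⟩
  · rw [zero_add] at h4
    refine h4.congr (fun n hn => hmem3.2 hn) ?_ (fun _ _ => rfl) ?_ ?_ (fun _ _ _ _ => rfl)
    · intro n
      simp only [exists_enum_iff K fun k => (k : ℤ) = n, exists_enum_iff L fun k => (k : ℤ) = n, labA]
    · intro n hn
      have e1 := prod_enum L fun l : ℕ => ((n : ℝ) - l) / (n + l - 2 * (0 : ℤ) + a + b + 1)
      have e2 := prod_enum K fun k : ℕ => (n : ℝ) - k
      rw [e1, e2, one_mul]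
      have e3 : chiHat L a b n * ∏ l ∈ L, ((n : ℝ) - l) / (n + l - 2 * (0 : ℤ) + a + b + 1) = 1 := by
        rw [chiHat, ← Finset.prod_mul_distrib]
        refine Finset.prod_eq_one fun l hl => ?_
        have n1 : (n : ℝ) - l ≠ 0 := fun h => hn.2 (by
          rw [Nat.cast_injective (show (n : ℝ) = l by linarith)]; exact hl)
        have n2 : (n : ℝ) + l + a + b + 1 ≠ 0 := fun h => hb (-n - l - a - 1) (by
          push_cast; linarith)
        rw [show (n : ℝ) - (-(l : ℝ) - a - b - 1) = n + l + a + b + 1 by ring, Int.cast_zero,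
          mul_zero, sub_zero]
        field_simp
      have e4 : chi K n * ∏ k ∈ K, ((n : ℝ) - k) = 1 := by
        rw [chi, ← Finset.prod_mul_distrib]
        refine Finset.prod_eq_one fun k hk => inv_mul_cancel₀ fun h => hn.1 ?_
        rw [Nat.cast_injective (show (n : ℝ) = k by linarith)]; exact hk
      rw [e3, one_mul, e4]
    · intro n hn
      have e2 := prod_enum K fun k : ℕ => ((n : ℝ) - k)
        * (n + k - 2 * (L.card : ℤ) + a + (b + 2 * L.card) + 1)
      rw [e2, kappaA]
      -- One factor of each `n - k` cancels against the square of `χ`; the shift by `-2q` in the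
      -- first chain is compensated by `β = b + 2q`.
      have e3 : chiHat K a b n = chi K n ^ 2 * ∏ k ∈ K, ((n : ℝ) - k)
          * (n + k - 2 * (L.card : ℤ) + a + (b + 2 * L.card) + 1) := by
        rw [chi, chiHat, ← Finset.prod_pow, ← Finset.prod_mul_distrib]
        refine Finset.prod_congr rfl fun k hk => ?_
        have n1 : (n : ℝ) - k ≠ 0 := fun h => hn.1 (by
          rw [Nat.cast_injective (show (n : ℝ) = k by linarith)]; exact hk)
        push_cast
        field_simp
        ring
      rw [e3]
      ring
  · have e1 := sum_enum L fun l => 2 * (l : ℤ) + a - 2 * 0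
    have e2 := sum_enum K fun k => (k : ℤ) - (0 + L.card)
    rw [hd3, hd1, e1, e2, natDegree_one, choose_two_add]
    have e3 := two_mul_choose_two L.card
    simp only [Finset.sum_sub_distrib, Finset.sum_add_distrib, Finset.sum_const, ← Finset.mul_sum]
    simp only [nsmul_eq_mul]
    push_cast
    linarith
  · intro hR
    rw [hR, zero_mul] at hτ1
    exact mul_ne_zero h1.iota_tau_ne_zero (pow_ne_zero _ hx2) hτ1
  · intro n hn
    obtain ⟨x, hxπ, hxr⟩ := hx1 n (hmem1.2 hn)
    rw [hxπ]
    exact det_polyA_eq fun i => by rw [← hxr (enum L i), hz1, mul_zero]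

/-! ### The functions of the construction on the interval `(-1, 1)` -/

theorem agreesWith_iff {f : ℝ → ℝ} {g : RatFunc ℝ} : AgreesWith f g ↔
    ∀ᶠ x in Filter.cofinite, x ∈ Set.Ioo (-1 : ℝ) 1 → f x = evR x g := by
  rw [Filter.eventually_cofinite, AgreesWith]
  simp only [Classical.not_imp, ne_eq]

theorem cofinite_regularAt (f : RatFunc ℝ) : ∀ᶠ x in Filter.cofinite, RegularAt f x := by
  rw [Filter.eventually_cofinite]
  refine (Polynomial.finite_setOfPred_isRoot f.denom_ne_zero).subset fun x hx => ?_
  simpa [RegularAt] using hx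

theorem cofinite_evR_ne_zero {f : RatFunc ℝ} (hf : f ≠ 0) :
    ∀ᶠ x in Filter.cofinite, evR x f ≠ 0 := by
  have h : ∀ᶠ x in Filter.cofinite, f.num.eval x ≠ 0 := by
    rw [Filter.eventually_cofinite]
    refine (Polynomial.finite_setOfPred_isRoot (RatFunc.num_ne_zero hf)).subset fun x hx => ?_
    simpa using hx
  filter_upwards [h, cofinite_regularAt f] with x hx hr
  have : evR x f = f.num.eval x / f.denom.eval x := by simp [RatFunc.eval, eval₂_id]
  rw [this]
  exact div_ne_zero hx hr

theorem ValAt.sum {κ : Type*} {c : ℝ} (s : Finset κ) {f : κ → RatFunc ℝ} {y : κ → ℝ}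
    (h : ∀ i, ValAt c (f i) (y i)) : ValAt c (∑ i ∈ s, f i) (∑ i ∈ s, y i) := by
  classical
  induction s using Finset.induction_on with
  | empty => simpa using ValAt.zero c
  | insert i s hi ih => rw [Finset.sum_insert hi, Finset.sum_insert hi]; exact (h i).add ih

theorem ValAt.prod {κ : Type*} {c : ℝ} (s : Finset κ) {f : κ → RatFunc ℝ} {y : κ → ℝ}
    (h : ∀ i, ValAt c (f i) (y i)) : ValAt c (∏ i ∈ s, f i) (∏ i ∈ s, y i) := by
  classical
  induction s using Finset.induction_on with
  | empty => simpa using ValAt.one c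
  | insert i s hi ih => rw [Finset.prod_insert hi, Finset.prod_insert hi]; exact (h i).mul ih

theorem ValAt.det {n : ℕ} {c : ℝ} {M : Matrix (Fin n) (Fin n) (RatFunc ℝ)}
    {N : Matrix (Fin n) (Fin n) ℝ} (h : ∀ i j, ValAt c (M i j) (N i j)) :
    ValAt c M.det N.det := by
  rw [Matrix.det_apply', Matrix.det_apply']
  refine ValAt.sum _ fun σ => ValAt.mul ?_ (ValAt.prod _ fun i => h _ _)
  simpa using ValAt.const c ((Equiv.Perm.sign σ : ℤ) : ℝ)

theorem hasDerivAt_evR {f : RatFunc ℝ} {c : ℝ} (h : RegularAt f c) :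
    HasDerivAt (fun x => evR x f) (evR c (∂ f)) c := by
  have e : (fun x => evR x f) = fun x => f.num.eval x / f.denom.eval x := by
    funext x; simp [RatFunc.eval, eval₂_id]
  have h1 := (f.num.hasDerivAt c).div (f.denom.hasDerivAt c) h
  rw [e]
  refine h1.congr_deriv ?_
  have v : ValAt c (∂ f) ((eval c (derivative f.num) * eval c f.denom
      - eval c f.num * eval c (derivative f.denom)) / eval c f.denom ^ 2) :=
    (((ValAt.poly c _).mul (ValAt.poly c _)).sub ((ValAt.poly c _).mul (ValAt.poly c _))).div
      ((ValAt.poly c _).pow 2) (pow_ne_zero 2 h)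
  exact v.eval_eq.symm

/-- A finite exceptional set is closed, so agreement holds near every other point of the interval
and passes to derivatives. -/
theorem AgreesWith.deriv {f : ℝ → ℝ} {g : RatFunc ℝ} (h : AgreesWith f g) :
    AgreesWith (deriv f) (∂ g) := by
  rw [agreesWith_iff]
  have h1 : {x : ℝ | x ∈ Set.Ioo (-1 : ℝ) 1 ∧ f x ≠ evR x g}.Finite := h
  have h2 := h1.eventually_cofinite_notMem
  filter_upwards [h2, cofinite_regularAt g] with x hx hr hI
  have ho : ∀ᶠ y in 𝓝 x, f y = evR y g := by
    filter_upwards [h1.isClosed.isOpen_compl.mem_nhds hx, isOpen_Ioo.mem_nhds hI] with y hy hyI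
    by_contra hne
    exact hy ⟨hyI, hne⟩
  rw [Filter.EventuallyEq.deriv_eq ho, (hasDerivAt_evR hr).deriv]

theorem AgreesWith.iteratedDeriv {f : ℝ → ℝ} {g : RatFunc ℝ} (h : AgreesWith f g) (k : ℕ) :
    AgreesWith (iteratedDeriv k f) (∂^[k] g) := by
  induction k with
  | zero => simpa using h
  | succ k ih =>
    rw [iteratedDeriv_succ, Function.iterate_succ_apply']
    exact ih.deriv

theorem AgreesWith.det {n : ℕ} {M : Matrix (Fin n) (Fin n) (RatFunc ℝ)}
    {N : Fin n → Fin n → ℝ → ℝ} (h : ∀ i j, AgreesWith (N i j) (M i j)) :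
    AgreesWith (fun x => (Matrix.of fun i j => N i j x).det) M.det := by
  simp only [agreesWith_iff] at h ⊢
  have h1 : ∀ᶠ x in Filter.cofinite, ∀ i j, x ∈ Set.Ioo (-1 : ℝ) 1 → N i j x = evR x (M i j) := by
    exact Filter.eventually_all.2 fun i => Filter.eventually_all.2 fun j => h i j
  have h2 : ∀ᶠ x in Filter.cofinite, ∀ i j, RegularAt (M i j) x := by
    exact Filter.eventually_all.2 fun i => Filter.eventually_all.2 fun j => cofinite_regularAt _
  filter_upwards [h1, h2] with x hx hr hI
  refine (ValAt.det fun i j => ?_).eval_eq.symm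
  rw [Matrix.of_apply, hx i j hI]
  exact (hr i j).valAt

theorem agreesWith_wronskianDet {n : ℕ} {f : Fin n → ℝ → ℝ} {g : Fin n → RatFunc ℝ}
    (h : ∀ i, AgreesWith (f i) (g i)) : AgreesWith (wronskianDet f) (ratWr g) :=
  AgreesWith.det fun i j => (h j).iteratedDeriv i

theorem AgreesWith.mul {f₁ f₂ : ℝ → ℝ} {g₁ g₂ : RatFunc ℝ} (h₁ : AgreesWith f₁ g₁)
    (h₂ : AgreesWith f₂ g₂) : AgreesWith (fun x => f₁ x * f₂ x) (g₁ * g₂) := by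
  rw [agreesWith_iff] at *
  filter_upwards [h₁, h₂, cofinite_regularAt g₁, cofinite_regularAt g₂] with x h1 h2 r1 r2 hI
  rw [h1 hI, h2 hI, (r1.valAt.mul r2.valAt).eval_eq]

theorem AgreesWith.div {f₁ f₂ : ℝ → ℝ} {g₁ g₂ : RatFunc ℝ} (h₁ : AgreesWith f₁ g₁)
    (h₂ : AgreesWith f₂ g₂) (h0 : g₂ ≠ 0) : AgreesWith (fun x => f₁ x / f₂ x) (g₁ / g₂) := by
  rw [agreesWith_iff] at *
  filter_upwards [h₁, h₂, cofinite_regularAt g₁, cofinite_regularAt g₂, cofinite_evR_ne_zero h0]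
    with x h1 h2 r1 r2 hne hI
  rw [h1 hI, h2 hI, (r1.valAt.div r2.valAt hne).eval_eq]

theorem agreesWith_const (c : ℝ) : AgreesWith (fun _ => c) (RatFunc.C c) := by
  rw [agreesWith_iff]
  exact Filter.Eventually.of_forall fun x _ => (ValAt.const x c).eval_eq.symm

theorem valAt_polyR (L : Finset ℕ) (a : ℕ) (b x : ℝ) : ValAt x (polyR L a b).det
    (Matrix.of fun i j => (jacobiRho a b (enum L i) (enum L j)).eval x).det :=
  ValAt.det fun _ _ => ValAt.poly x _

/-- Each row contributes one factor `(1 + x)^(b + 1)`. -/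
theorem det_matR {L : Finset ℕ} {a : ℕ} {b x : ℝ} (hx : -1 < x) :
    (matR L a b x).det = ((1 + x) ^ (b + 1)) ^ L.card * evR x (polyR L a b).det := by
  rw [(valAt_polyR L a b x).eval_eq]
  have h := Matrix.det_mul_column (fun _ : Fin L.card => (1 + x) ^ (b + 1))
    (Matrix.of fun i j => (jacobiRho a b (enum L i) (enum L j)).eval x)
  rw [Finset.prod_const, Finset.card_univ, Fintype.card_fin] at h
  rw [← h]
  congr 1
  ext i j
  exact rho_eq a b _ _ hx

theorem det_matA {L : Finset ℕ} {a n : ℕ} {b x : ℝ} (hx : -1 < x) :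
    (matA L a b n x).det = ((1 + x) ^ (b + 1)) ^ L.card * evR x (polyA L a b n).det := by
  let N : Matrix (Fin (L.card + 1)) (Fin (L.card + 1)) ℝ := Matrix.of fun i j =>
    Fin.cases ((jacobiMonic ((Fin.cons n (enum L) : Fin _ → ℕ) j) a b).eval x)
      (fun i' => (jacobiRho a b (enum L i') ((Fin.cons n (enum L) : Fin _ → ℕ) j)).eval x) i
  have hv : ValAt x (polyA L a b n).det N.det := by
    refine ValAt.det fun i j => ?_
    induction i using Fin.cases with
    | zero => exact ValAt.poly x _
    | succ i => exact ValAt.poly x _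
  have h := Matrix.det_mul_column
    (Fin.cons 1 (fun _ => (1 + x) ^ (b + 1)) : Fin (L.card + 1) → ℝ) N
  rw [Fin.prod_univ_succ] at h
  simp only [Fin.cons_zero, Fin.cons_succ, one_mul, Finset.prod_const, Finset.card_univ,
    Fintype.card_fin] at h
  rw [hv.eval_eq, ← h]
  congr 1
  ext i j
  induction i using Fin.cases with
  | zero => exact (one_mul _).symm
  | succ i => exact rho_eq a b _ _ hx

theorem agreesWith_tauHat {L : Finset ℕ} {a : ℕ} {b : ℝ} {τ₁ : ℝ[X]}
    (h : ι τ₁ * xp ^ (L.card * L.card) = (polyR L a b).det * xp ^ L.card) :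
    AgreesWith (tauHat L a b) (ι τ₁) := by
  rw [agreesWith_iff]
  refine Filter.Eventually.of_forall fun x hx => ?_
  have hx0 : (0 : ℝ) < 1 + x := by linarith [hx.1]
  have hv : ValAt x xp (1 + x) := by simpa [add_comm] using (ValAt.var x).add (ValAt.one x)
  have h1 := ((ValAt.poly x τ₁).mul (hv.pow (L.card * L.card))).eval_eq
  rw [h, ((valAt_polyR L a b x).regularAt.valAt.mul (hv.pow L.card)).eval_eq] at h1
  rw [tauHat, det_matR hx.1, (ValAt.poly x τ₁).eval_eq]
  -- The exponents balance: `-q (q + b) + q (b + 1) + q² = q`.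
  have h2 : (1 + x) ^ (-((L.card : ℝ) * (L.card + b))) * ((1 + x) ^ (b + 1)) ^ L.card
      * (1 + x) ^ (L.card * L.card) = (1 + x) ^ L.card := by
    rw [← Real.rpow_mul_natCast hx0.le, ← Real.rpow_natCast _ (L.card * L.card),
      ← Real.rpow_natCast _ L.card, ← Real.rpow_add hx0, ← Real.rpow_add hx0]
    congr 1
    push_cast
    ring
  refine mul_right_cancel₀ (pow_ne_zero (L.card * L.card) hx0.ne') ?_
  rw [← h1, ← h2]
  ring

/-- The polynomial row of the augmented matrix carries no power of `1 + x`, so the powers from the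
other `q` rows cancel in the quotient. -/
theorem agreesWith_piHat {L : Finset ℕ} {a n : ℕ} {b : ℝ}
    (hR : (polyR L a b).det ≠ 0) {f : RatFunc ℝ}
    (h : (polyA L a b n).det = xp ^ L.card * f * (polyR L a b).det) {i : ℤ}
    (hi : i + L.card = n) :
    AgreesWith (piHat L a b i) (RatFunc.C (chiHat L a b n) * f) := by
  rw [agreesWith_iff]
  filter_upwards [cofinite_regularAt f, cofinite_evR_ne_zero hR] with x hf hne hx
  have hx0 : (0 : ℝ) < 1 + x := by linarith [hx.1]
  have hv : ValAt x xp (1 + x) := by simpa [add_comm] using (ValAt.var x).add (ValAt.one x)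
  have hi' : (i : ℝ) + L.card = n := by exact_mod_cast hi
  have hr := (Real.rpow_pos_of_pos hx0 (b + 1)).ne'
  rw [piHat, hi, hi', Int.toNat_natCast, det_matR hx.1, det_matA hx.1, h,
    (((hv.pow L.card).mul hf.valAt).mul (valAt_polyR L a b x).regularAt.valAt).eval_eq,
    ((ValAt.const x _).mul hf.valAt).eval_eq]
  field_simp

theorem agreesWith_piA {K L : Finset ℕ} {a n : ℕ} {b : ℝ} {g : Fin K.card → RatFunc ℝ}
    {f y : RatFunc ℝ} (hg : ∀ j, AgreesWith (seeds K L a b j) (g j)) {i : ℤ}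
    (hi : i + K.card + L.card = n) (hf : AgreesWith (piHat L a b (i + K.card)) f)
    (h0 : ratWr g ≠ 0) (h : ratWr (Fin.snoc (α := fun _ => RatFunc ℝ) g f) = y * ratWr g) :
    AgreesWith (piA K L a b i) (RatFunc.C (chi K n) * y) := by
  have hi' : (i : ℝ) + K.card + L.card = n := by exact_mod_cast hi
  have h1 : AgreesWith (wronskianDet (Fin.snoc (α := fun _ => ℝ → ℝ) (seeds K L a b)
      (piHat L a b (i + K.card)))) (y * ratWr g) := by
    rw [← h]
    refine agreesWith_wronskianDet fun j => ?_
    induction j using Fin.lastCases with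
    | last => simpa using hf
    | cast j => simpa using hg j
  have h2 := (agreesWith_const (chi K n)).mul (h1.div (agreesWith_wronskianDet hg) h0)
  rw [mul_div_cancel_right₀ _ h0, ← hi'] at h2
  rw [← hi']
  exact h2

/-! ### Spectral diagrams -/

theorem IsInt.regularAt_neg_one {u w : RatFunc ℝ} {α β μ : ℝ} (hβ : ∀ m : ℤ, β ≠ m)
    (hu : RegularAt u (-1)) (hw : IsInt w) (h : w ∈ Ric (opU u α β) μ) : RegularAt w (-1) := by
  obtain ⟨f, hf, rfl⟩ := hw
  obtain ⟨y, hy, hv⟩ := exists_valAt_neg_one hβ hu hf h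
  exact hv.dlog_regularAt hy

theorem valAt_xp_neg_one : ValAt (-1) xp 0 := by
  simpa using (ValAt.var (-1)).add (ValAt.one (-1))

/-- The residue at `-1` is an integer minus `β`, hence not zero. -/
theorem IsTwisted.not_regularAt_neg_one {w : RatFunc ℝ} {β : ℝ} (hβ : ∀ m : ℤ, β ≠ m)
    (hw : IsTwisted β w) : ¬ RegularAt w (-1) := by
  intro hr
  obtain ⟨f, hf, h⟩ := hw
  obtain ⟨k, g, y, hy, hg, rfl⟩ := exists_order_neg_one hf
  have h2 := X_add_one_ne_zero
  rw [dlog_mul (zpow_ne_zero k h2) (hg.ne_zero hy), dlog_zpow, dlog_xp] at h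
  have e : xp * w = RatFunc.C ((k : ℝ) - β) + xp * dlog g := by
    rw [h, map_sub, map_intCast]
    field_simp
    ring
  have v1 := valAt_xp_neg_one.mul hr.valAt
  rw [e] at v1
  have v2 := (ValAt.const (-1) ((k : ℝ) - β)).add
    (valAt_xp_neg_one.mul (hg.dlog_regularAt hy).valAt)
  have := v1.unique v2
  exact hβ k (by linarith)

/-- The label as defined by the types of the eigenfunctions. -/
def Lab.toLabel : Lab → Label
  | .circ => .circ
  | .ast => .asterisk
  | .minus => .minus

/-- The types that a label stands for. -/
def Label.types : Label → AsympType → Bool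
  | .circ, .one => true
  | .times, .two => true
  | .plus, .three => true
  | .minus, .four => true
  | .asterisk, .two => true
  | .asterisk, .three => true
  | .div, .three => true
  | .div, .four => true
  | .circtimes, .one => true
  | .circtimes, .two => true
  | .bullet, .two => true
  | .bullet, .three => true
  | .bullet, .four => true
  | _, _ => false

theorem Label.types_injective : Function.Injective Label.types := by
  intro l l' h
  have h1 := congrFun h .one
  have h2 := congrFun h .two
  have h3 := congrFun h .three
  have h4 := congrFun h .four
  cases l <;> cases l' <;> first
    | rfl
    | exact absurd h1 (by decide)
    | exact absurd h2 (by decide)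
    | exact absurd h3 (by decide)
    | exact absurd h4 (by decide)

theorem HasType.unique {w : RatFunc ℝ} {t t' : AsympType} (h : HasType w t) (h' : HasType w t') :
    t = t' := by
  cases t <;> cases t' <;> first
    | rfl
    | exact absurd h'.1 h.1
    | exact absurd h.1 h'.1
    | exact absurd h'.2 h.2
    | exact absurd h.2 h'.2

/-- A label is recovered from the set of types that occur; this is what makes labels unique. -/
theorem HasLabel.exists_type_iff {S : Set (RatFunc ℝ)} {l : Label} (h : HasLabel S l)
    (t : AsympType) : (∃ w ∈ S, HasType w t) ↔ l.types t = true := by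
  have single : ∀ {w : RatFunc ℝ} {t'}, S = {w} → HasType w t' →
      ((∃ w ∈ S, HasType w t) ↔ t = t') := by
    rintro w t' rfl hw
    constructor
    · rintro ⟨v, rfl, hv⟩; exact hv.unique hw
    · rintro rfl; exact ⟨w, rfl, hw⟩
  have double : ∀ {v w : RatFunc ℝ} {t' t''}, S = {v, w} → HasType v t' → HasType w t'' →
      ((∃ w ∈ S, HasType w t) ↔ t = t' ∨ t = t'') := by
    rintro v w t' t'' rfl hv hw
    constructor
    · rintro ⟨x, rfl | rfl, hx⟩
      · exact Or.inl (hx.unique hv)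
      · exact Or.inr (hx.unique hw)
    · rintro (rfl | rfl)
      · exact ⟨v, by simp, hv⟩
      · exact ⟨w, by simp, hw⟩
  cases l with
  | circ => obtain ⟨w, h, hw⟩ := h; rw [single h hw]; cases t <;> simp [Label.types]
  | times => obtain ⟨w, h, hw⟩ := h; rw [single h hw]; cases t <;> simp [Label.types]
  | plus => obtain ⟨w, h, hw⟩ := h; rw [single h hw]; cases t <;> simp [Label.types]
  | minus => obtain ⟨w, h, hw⟩ := h; rw [single h hw]; cases t <;> simp [Label.types]
  | asterisk => obtain ⟨v, w, -, h, hv, hw⟩ := h; rw [double h hv hw]; cases t <;> simp [Label.types]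
  | div => obtain ⟨v, w, -, h, hv, hw⟩ := h; rw [double h hv hw]; cases t <;> simp [Label.types]
  | circtimes => obtain ⟨v, w, -, h, hv, hw⟩ := h; rw [double h hv hw]; cases t <;> simp [Label.types]
  | bullet =>
    obtain ⟨-, h2, h3, h4, h1⟩ := h
    cases t
    · simpa [Label.types] using h1
    · simpa [Label.types] using h2
    · simpa [Label.types] using h3
    · simpa [Label.types] using h4

theorem HasLabel.unique {S : Set (RatFunc ℝ)} {l l' : Label} (h : HasLabel S l)
    (h' : HasLabel S l') : l = l' :=
  Label.types_injective <| funext fun t =>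
    Bool.eq_iff_iff.2 <| (h.exists_type_iff t).symm.trans (h'.exists_type_iff t)

theorem LabOK.hasLabel {u : RatFunc ℝ} {α β μ : ℝ} (hβ : ∀ m : ℤ, β ≠ m)
    (hu : RegularAt u (-1)) {l : Lab} (h : LabOK β (Ric (opU u α β) μ) l) :
    HasLabel (Ric (opU u α β) μ) l.toLabel := by
  have hreg : ∀ {w}, IsInt w → w ∈ Ric (opU u α β) μ → RegularAt w (-1) := fun hw h =>
    hw.regularAt_neg_one hβ hu h
  cases l with
  | circ =>
    obtain ⟨w, hS, hw, hr⟩ := h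
    exact ⟨w, hS, hr, hreg hw (hS ▸ rfl)⟩
  | ast =>
    obtain ⟨v, w, hS, ⟨hv, hvr⟩, hw, hwr⟩ := h
    refine ⟨v, w, ?_, hS, ⟨hvr, hv.not_regularAt_neg_one hβ⟩, hwr, hreg hw (hS ▸ by simp)⟩
    rintro rfl
    exact hw.not_isTwisted hβ hv
  | minus =>
    obtain ⟨w, hS, hw, hr⟩ := h
    exact ⟨w, hS, hr, hw.not_regularAt_neg_one hβ⟩

theorem LabOK.isInt_or_isTwisted {β : ℝ} {S : Set (RatFunc ℝ)} {l : Lab} (h : LabOK β S l)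
    {w : RatFunc ℝ} (hw : w ∈ S) : IsInt w ∨ IsTwisted β w := by
  cases l with
  | circ => obtain ⟨v, rfl, hv, -⟩ := h; rw [Set.mem_singleton_iff.1 hw]; exact Or.inl hv
  | ast =>
    obtain ⟨v, v', rfl, ⟨hv, -⟩, hv', -⟩ := h
    rcases hw with rfl | rfl
    · exact Or.inr hv
    · exact Or.inl hv'
  | minus => obtain ⟨v, rfl, hv, -⟩ := h; rw [Set.mem_singleton_iff.1 hw]; exact Or.inr hv

/-- The index of the eigenfunctions of type `t` with eigenvalue `λ₁(n - s)`. -/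
def typeIndex (α s : ℤ) : AsympType → ℤ → ℤ
  | .one, n => n - s
  | .two, n => s - n - 1
  | .three, n => n - s + α
  | .four, n => s - n - α - 1

theorem lam_typeIndex (α s : ℤ) (β : ℝ) (t : AsympType) (n : ℤ) :
    lam α β t (typeIndex α s t n) = lam α β .one ((n : ℝ) - s) := by
  cases t <;> simp only [lam, typeIndex] <;> push_cast <;> ring

/-- Of the two degrees that the eigenvalue allows, integrality selects `n`. -/
theorem IsInt.degree {u w : RatFunc ℝ} {M β : ℝ} {α n : ℤ} (hβ : ∀ m : ℤ, β ≠ m)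
    (hu : AtInf (RatFunc.X * u) M) (hw : IsInt w)
    (h : w ∈ Ric (opU u α β) (lam α β .one n)) : AtInf (RatFunc.X * w) n := by
  obtain ⟨f, hf, rfl⟩ := hw
  have h1 := (hasLead_self hf).atInf_X_mul_dlog
  have h2 := degree_of_mem_Ric hu h1 h
  have h3 := int_root_unique (s := α + β + 1) (m := f.intDegree) (n := n)
    (fun k hk => hβ (k - α - 1) (by push_cast; linarith)) rfl rfl
    (by simp only [lam] at h2; linear_combination h2)
  rwa [h3] at h1

theorem IsTwisted.degree {u w : RatFunc ℝ} {M β : ℝ} {α n : ℤ} (hβ : ∀ m : ℤ, β ≠ m)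
    (hu : AtInf (RatFunc.X * u) M) (hw : IsTwisted β w)
    (h : w ∈ Ric (opU u α β) (lam α β .one n)) :
    AtInf (RatFunc.X * w) (-n - α - 1 - β) := by
  obtain ⟨f, hf, rfl⟩ := hw
  have h1 := (hasLead_self hf).atInf_X_mul_dlog.sub
    ((AtInf.const β).mul hasLead_xp.atInf_X_mul_dlog)
  have e : RatFunc.X * (dlog f - RatFunc.C β / xp) =
      RatFunc.X * dlog f - RatFunc.C β * (RatFunc.X * dlog xp) := by
    rw [dlog_xp]; ring
  rw [← e] at h1
  have h2 := degree_of_mem_Ric hu h1 h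
  have h3 := int_root_unique (s := α + β + 1) (m := -f.intDegree - α - 1) (n := n)
    (fun k hk => hβ (k - α - 1) (by push_cast; linarith)) rfl rfl
    (by simp only [lam] at h2; push_cast at h2 ⊢; linear_combination h2)
  convert h1 using 1
  rw [← h3]; push_cast; ring

section ExcState

variable {τ : ℝ[X]} {α : ℕ} {β : ℝ} {s : ℤ} {J : Set ℕ} {lab : ℤ → Lab}
    {π : ℕ → RatFunc ℝ} {c N : ℕ → ℝ} {r : ℕ → ℕ → RatFunc ℝ}

theorem ExcState.hasLabel (h : ExcState τ α β s J lab π c N r) (n : ℤ) :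
    HasLabel (Ric (opU (dlog (ι τ)) α β) (lam α β .one (n - s))) (lab n).toLabel :=
  (h.labels.ok n).hasLabel h.hβ h.regularAt_neg_one

theorem ExcState.exists_index (h : ExcState τ α β s J lab π c N r) {w : RatFunc ℝ} {μ : ℝ}
    (hw : w ∈ Ric (opU (dlog (ι τ)) α β) μ) : ∃ n : ℤ, μ = lam α β .one (n - s) := by
  by_contra! hμ
  rw [h.labels.empty μ hμ] at hw
  exact hw

theorem ExcState.nonempty_Ric (h : ExcState τ α β s J lab π c N r) (n : ℤ) :
    (Ric (opU (dlog (ι τ)) α β) (lam α β .one (n - s))).Nonempty := by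
  have h1 := h.labels.ok n
  cases hl : lab n <;> rw [hl] at h1
  · obtain ⟨w, hw, -⟩ := h1; rw [hw]; exact Set.singleton_nonempty w
  · obtain ⟨v, w, hw, -⟩ := h1; rw [hw]; exact Set.insert_nonempty _ _
  · obtain ⟨w, hw, -⟩ := h1; rw [hw]; exact Set.singleton_nonempty w

theorem ExcState.qrSpectrum_eq (h : ExcState τ α β s J lab π c N r) :
    qrSpectrum (opU (dlog (ι τ)) α β) = {μ | ∃ n : ℤ, μ = lam α β .one (n - s)} := by
  ext μ
  constructor
  · rintro ⟨w, hw⟩; exact h.exists_index hw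
  · rintro ⟨n, rfl⟩; exact h.nonempty_Ric n

theorem ExcState.spectralDiagram_eq (h : ExcState τ α β s J lab π c N r) :
    spectralDiagram (opU (dlog (ι τ)) α β) =
      {x | ∃ n : ℤ, x.1 = lam α β .one (n - s) ∧ x.2 = (lab n).toLabel} := by
  ext ⟨μ, l⟩
  constructor
  · rintro ⟨⟨w, hw⟩, hl⟩
    obtain ⟨n, hn⟩ := h.exists_index hw
    dsimp only at hn hl
    exact ⟨n, hn, by rw [hn] at hl; exact hl.unique (h.hasLabel n)⟩
  · rintro ⟨n, hn, hl⟩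
    dsimp only at hn hl
    subst hn hl
    exact ⟨h.nonempty_Ric n, h.hasLabel n⟩

theorem ExcState.lam_injective (h : ExcState τ α β s J lab π c N r) {m n : ℤ}
    (e : lam α β .one ((m : ℝ) - s) = lam α β .one (n - s)) : m = n := by
  have := lam_one_inj (α := α) h.hβ (m := m - s) (n := n - s) (by push_cast; exact e)
  omega

theorem ExcState.existsUnique_label (h : ExcState τ α β s J lab π c N r) (n : ℤ) :
    ∃! l : Label, (lam α β .one ((n : ℝ) - s), l) ∈ spectralDiagram (opU (dlog (ι τ)) α β) := by
  rw [h.spectralDiagram_eq]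
  refine ⟨(lab n).toLabel, ⟨n, rfl, rfl⟩, ?_⟩
  rintro l ⟨m, hm, hl⟩
  dsimp only at hm hl
  rw [hl, h.lam_injective hm]

theorem ExcState.hasQRDegree (h : ExcState τ α β s J lab π c N r) {n : ℤ} {w : RatFunc ℝ}
    {t : AsympType} (hw : w ∈ Ric (opU (dlog (ι τ)) α β) (lam α β .one (n - s)))
    (ht : HasType w t) : HasQRDegree w (typeIndex α s t n + degMu α β t) := by
  have hw' : w ∈ Ric (opU (dlog (ι τ)) ((α : ℤ) : ℝ) β) (lam ((α : ℤ) : ℝ) β .one (n - s : ℤ)) := by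
    push_cast; exact hw
  have key : IsInt w ∧ RegularAt w (-1) ∨ IsTwisted β w ∧ ¬ RegularAt w (-1) :=
    ((h.labels.ok n).isInt_or_isTwisted hw).imp
      (fun h1 => ⟨h1, h1.regularAt_neg_one h.hβ h.regularAt_neg_one hw⟩)
      (fun h1 => ⟨h1, h1.not_regularAt_neg_one h.hβ⟩)
  rcases key with ⟨h1, h2⟩ | ⟨h1, h2⟩
  · have h3 := hasQRDegree_of_atInf (h1.degree h.hβ h.atInf_u hw')
    cases t
    · convert h3 using 1; simp [typeIndex, degMu]
    · exact absurd h2 ht.2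
    · convert h3 using 1; simp [typeIndex, degMu]
    · exact absurd h2 ht.2
  · have h3 := hasQRDegree_of_atInf (h1.degree h.hβ h.atInf_u hw')
    cases t
    · exact absurd ht.2 h2
    · convert h3 using 1; simp only [typeIndex, degMu]; push_cast; ring
    · exact absurd ht.2 h2
    · convert h3 using 1; simp only [typeIndex, degMu]; push_cast; ring

theorem ExcState.indexSet_eq (h : ExcState τ α β s J lab π c N r) (t : AsympType) :
    indexSet (opU (dlog (ι τ)) α β) α β t =
      {k | ∃ n : ℤ, (lab n).toLabel.types t = true ∧ k = (typeIndex α s t n : ℝ)} := by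
  ext k
  constructor
  · rintro ⟨μ, w, hw, ht, hd⟩
    obtain ⟨n, rfl⟩ := h.exists_index hw
    refine ⟨n, ((h.hasLabel n).exists_type_iff t).1 ⟨w, hw, ht⟩, ?_⟩
    have := hd.unique (h.hasQRDegree hw ht)
    linarith
  · rintro ⟨n, hn, rfl⟩
    obtain ⟨w, hw, ht⟩ := ((h.hasLabel n).exists_type_iff t).2 hn
    exact ⟨_, w, hw, ht, h.hasQRDegree hw ht⟩

/-- As `α` is an integer, the second family of eigenvalues is contained in the first. -/
theorem ExcState.sigmaQ_eq (_h : ExcState τ α β s J lab π c N r) :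
    sigmaQ α β = {μ | ∃ n : ℤ, μ = lam α β .one (n - s)} := by
  ext μ
  constructor
  · rintro (⟨n, rfl⟩ | ⟨n, rfl⟩)
    · exact ⟨n + s, by push_cast; rw [add_sub_cancel_right]⟩
    · exact ⟨n - α + s, by push_cast; rw [add_sub_cancel_right]⟩
  · rintro ⟨n, rfl⟩
    exact Or.inl ⟨n - s, by push_cast; rfl⟩

/-- The products `τ π n` are eigenpolynomials of degree `deg τ + n - s`. Missing degrees are those
too small to be of this form and those coming from the finitely many excluded `n`. -/
theorem ExcState.isExceptionalRationalGauge (h : ExcState τ α β s J lab π c N r)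
    (hJ : {n | n ∉ J}.Finite) : IsExceptionalRationalGauge τ α β := by
  refine ⟨h.tau_one, h.tau_neg_one, rfl, ?_⟩
  refine ((Finset.range (τ.natDegree + s.natAbs + 1)).finite_toSet.union
    (hJ.image fun n : ℕ => ((τ.natDegree : ℤ) + (n : ℤ) - s).toNat)).subset fun d hd => ?_
  by_contra hcon
  simp only [Set.mem_union, Finset.mem_coe, Finset.mem_range, not_or, Set.mem_image,
    not_exists, not_and, Set.mem_ofPred_eq] at hcon
  obtain ⟨h1, h2⟩ := hcon
  obtain ⟨n, hn⟩ : ∃ n : ℕ, (d : ℤ) = τ.natDegree + n - s :=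
    ⟨((d : ℤ) - τ.natDegree + s).toNat, by omega⟩
  have hnJ : n ∈ J := by
    by_contra hnJ
    exact h2 n hnJ (by omega)
  obtain ⟨y, hy, hv⟩ := h.exists_valAt hnJ
  obtain ⟨z, hz, hv'⟩ := h.exists_valAt_neg hnJ
  have hπ := h.pi_ne_zero hnJ
  obtain ⟨P, hP, -, -⟩ := exists_poly_tau_mul h.tau_ne_zero hπ (h.eig n hnJ) hv hv'
  have hP0 : P ≠ 0 := by
    rintro rfl
    rw [map_zero] at hP
    exact mul_ne_zero h.iota_tau_ne_zero hπ hP.symm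
  refine hd ⟨P, ⟨hP0, lam α β .one ((n : ℤ) - s), ?_⟩, ?_⟩
  · have h3 := (Tng τ α β).gauge_apply (ι τ) (π n) h.iota_tau_ne_zero
    have h4 := (apply_opU_iff hπ).2 (h.eig n hnJ)
    rw [← Trg_eq_opU h.tau_ne_zero, Trg, h3, ← hP] at h4
    have := h.iota_tau_ne_zero
    field_simp at h4
    rw [h4, hP]
    ring
  · have h5 := (hasLead_poly h.tau_ne_zero).mul (h.lead n hnJ)
    rw [← hP] at h5
    have h6 := ((hasLead_poly hP0).unique h5).1
    omega

theorem ExcState.isQuasiPolynomialEigenfunction (h : ExcState τ α β s J lab π c N r) {n : ℕ}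
    (hn : n ∈ J) : IsQuasiPolynomialEigenfunction (opU (dlog (ι τ)) α β) (π n)
      (lam α β .one ((n : ℤ) - s)) := by
  have key : ∀ {x y : ℝ}, y ≠ 0 → ValAt x (π n) y →
      (π n).num.eval x ≠ 0 ∧ (π n).denom.eval x ≠ 0 := by
    intro x y hy hv
    refine ⟨fun h0 => hy ?_, hv.regularAt⟩
    rw [← hv.eval_eq, RatFunc.eval, eval₂_id, h0, zero_div]
  obtain ⟨y, hy, hv⟩ := h.exists_valAt hn
  obtain ⟨z, hz, hv'⟩ := h.exists_valAt_neg hn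
  have h1 := key hy hv
  have h2 := key hz hv'
  exact ⟨(apply_opU_iff (h.pi_ne_zero hn)).2 (h.eig n hn), h1.1, h1.2, h2.1, h2.2⟩

/-- Regularity and non-vanishing at `± 1` mean type `1`, which occurs only under the label `circ`,
where the Riccati solution is unique. -/
theorem ExcState.eigenfunction_cases (h : ExcState τ α β s J lab π c N r)
    (hJ : ∀ n : ℤ, lab n = .circ → ∃ m ∈ J, (m : ℤ) = n) {f : RatFunc ℝ} {μ : ℝ}
    (hf : IsQuasiPolynomialEigenfunction (opU (dlog (ι τ)) α β) f μ) :
    ∃ n ∈ J, ∃ k : ℝ, k ≠ 0 ∧ μ = lam α β .one ((n : ℤ) - s) ∧ f = RatFunc.C k * π n := by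
  obtain ⟨h1, h2, h3, h4, h5⟩ := hf
  have hf0 : f ≠ 0 := by rintro rfl; simp at h2
  have hR := (apply_opU_iff hf0).1 h1
  obtain ⟨n, rfl⟩ := h.exists_index hR
  have hreg : ∀ {x : ℝ}, f.num.eval x ≠ 0 → f.denom.eval x ≠ 0 → RegularAt (dlog f) x :=
    fun {x} hx hx' => ValAt.dlog_regularAt (y := f.num.eval x / f.denom.eval x)
      ⟨f.num, f.denom, (RatFunc.num_div_denom f).symm, hx', rfl⟩ (div_ne_zero hx hx')
  have ht : HasType (dlog f) .one := ⟨hreg h2 h3, hreg h4 h5⟩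
  have h6 := ((h.hasLabel n).exists_type_iff .one).1 ⟨_, hR, ht⟩
  have hl : lab n = .circ := by
    cases hl : lab n <;> rw [hl] at h6 <;> first | rfl | cases h6
  obtain ⟨m, hm, rfl⟩ := hJ n hl
  have h7 := h.labels.ok m
  rw [hl] at h7
  obtain ⟨w, hw, -⟩ := h7
  have h8 := h.eig m hm
  rw [hw] at hR h8
  obtain ⟨k, hk, e⟩ := eq_C_mul_of_dlog_eq hf0 (h.pi_ne_zero hm) (hR.trans h8.symm)
  exact ⟨m, hm, k, hk, rfl, e⟩

end ExcState

/-! ### The diagram attached to `K` and `L` -/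

theorem labA_eq_circ_iff {K L : Finset ℕ} {a : ℕ} {n : ℤ} :
    labA K L a n = .circ ↔ ∃ m : ℕ, (m ∉ K ∧ m ∉ L) ∧ (m : ℤ) = n := by
  rw [labA, baseLab]
  constructor
  · intro h
    split_ifs at h with h1 h2 h3 h4
    obtain ⟨m, rfl⟩ := Int.eq_ofNat_of_zero_le h3
    exact ⟨m, ⟨fun hm => h1 ⟨m, hm, rfl⟩, fun hm => h2 ⟨m, hm, rfl⟩⟩, rfl⟩
  · rintro ⟨m, ⟨hK, hL⟩, rfl⟩
    rw [if_neg, if_neg, if_pos (Int.natCast_nonneg m)]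
    · rintro ⟨l, hl, e⟩; exact hL (by rwa [← Int.ofNat.inj e])
    · rintro ⟨l, hl, e⟩; exact hK (by rwa [← Int.ofNat.inj e])

theorem labA_eq_ast_iff {K L : Finset ℕ} {a : ℕ} {n : ℤ} :
    labA K L a n = .ast ↔ (∃ k ∈ K, (k : ℤ) = n) ∨ (-(a : ℤ) ≤ n ∧ n < 0) := by
  rw [labA, baseLab]
  constructor
  · intro h
    split_ifs at h with h1 h2 h3 h4
    · exact Or.inl h1
    · exact Or.inr ⟨h4, not_le.1 h3⟩
  · rintro (h | ⟨h1, h2⟩)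
    · rw [if_pos h]
    · rw [if_neg, if_neg, if_neg (not_le.2 h2), if_pos h1]
      · rintro ⟨l, -, rfl⟩; omega
      · rintro ⟨l, -, rfl⟩; omega

theorem labA_eq_minus_iff {K L : Finset ℕ} (hKL : Disjoint K L) {a : ℕ} {n : ℤ} :
    labA K L a n = .minus ↔ (∃ l ∈ L, (l : ℤ) = n) ∨ n < -(a : ℤ) := by
  rw [labA, baseLab]
  constructor
  · intro h
    split_ifs at h with h1 h2 h3 h4
    · exact Or.inl h2
    · exact Or.inr (not_le.1 h4)
  · rintro (h | h)
    · rw [if_neg, if_pos h]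
      rintro ⟨k, hk, rfl⟩
      obtain ⟨l, hl, e⟩ := h
      exact Finset.disjoint_left.1 hKL hk (by rwa [← Int.ofNat.inj e])
    · rw [if_neg, if_neg, if_neg (by omega), if_neg (not_le.2 h)]
      · rintro ⟨l, -, rfl⟩; omega
      · rintro ⟨l, -, rfl⟩; omega

theorem Lab.types_toLabel_iff (l : Lab) (t : AsympType) : l.toLabel.types t = true ↔
    l = match t with | .one => Lab.circ | .two => .ast | .three => .ast | .four => .minus := by
  cases l <;> cases t <;> simp [Lab.toLabel, Label.types]

theorem mem_indexA_iff {K L : Finset ℕ} (hKL : Disjoint K L) {a : ℕ} (t : AsympType) (i : ℤ) :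
    i ∈ indexA K L a t ↔ ∃ n : ℤ, (labA K L a n).toLabel.types t = true ∧
      i = typeIndex (a + K.card : ℕ) (L.card + K.card) t n := by
  simp only [Lab.types_toLabel_iff]
  cases t
  · simp only [labA_eq_circ_iff, typeIndex, indexA, Set.mem_ofPred_eq]
    constructor
    · rintro ⟨n, h1, h2, h3⟩
      exact ⟨n, ⟨n, ⟨h1, h2⟩, rfl⟩, by omega⟩
    · rintro ⟨_, ⟨n, ⟨h1, h2⟩, rfl⟩, h3⟩
      exact ⟨n, h1, h2, by omega⟩
  · simp only [labA_eq_ast_iff, typeIndex, indexA, Set.mem_ofPred_eq]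
    constructor
    · rintro (⟨n, h1, h2⟩ | ⟨k, hk, h⟩)
      · exact ⟨-n - 1, Or.inr (by omega), by omega⟩
      · exact ⟨k, Or.inl ⟨k, hk, rfl⟩, by omega⟩
    · rintro ⟨n, ⟨k, hk, rfl⟩ | h, h'⟩
      · exact Or.inr ⟨k, hk, by omega⟩
      · exact Or.inl ⟨(-n - 1).toNat, by omega, by omega⟩
  · simp only [labA_eq_ast_iff, typeIndex, indexA, Set.mem_ofPred_eq]
    constructor
    · rintro (⟨n, h1, h2⟩ | ⟨k, hk, h⟩)
      · exact ⟨n - a, Or.inr (by omega), by push_cast; omega⟩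
      · exact ⟨k, Or.inl ⟨k, hk, rfl⟩, by push_cast; omega⟩
    · rintro ⟨n, ⟨k, hk, rfl⟩ | h, h'⟩
      · exact Or.inr ⟨k, hk, by push_cast at h'; omega⟩
      · exact Or.inl ⟨(n + a).toNat, by omega, by push_cast at h'; omega⟩
  · simp only [labA_eq_minus_iff hKL, typeIndex, indexA, Set.mem_ofPred_eq]
    constructor
    · rintro (⟨n, h⟩ | ⟨l, hl, h⟩)
      · exact ⟨-n - a - 1, Or.inr (by omega), by push_cast; omega⟩
      · exact ⟨l, Or.inl ⟨l, hl, rfl⟩, by push_cast; omega⟩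
    · rintro ⟨n, ⟨l, hl, rfl⟩ | h, h'⟩
      · exact Or.inr ⟨l, hl, by push_cast at h'; omega⟩
      · exact Or.inl ⟨(-n - a - 1).toNat, by push_cast at h'; omega⟩

theorem mem_sigmaA_iff {K L : Finset ℕ} (hKL : Disjoint K L) {a : ℕ} {β : ℝ} (t : AsympType)
    (μ : ℝ) : μ ∈ sigmaA K L a (a + K.card : ℕ) β t ↔
      ∃ n : ℤ, (labA K L a n).toLabel.types t = true ∧
        μ = lam (a + K.card : ℕ) β .one (n - (L.card + K.card : ℤ)) := by
  constructor
  · rintro ⟨i, hi, rfl⟩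
    obtain ⟨n, hn, rfl⟩ := (mem_indexA_iff hKL t i).1 hi
    have := lam_typeIndex (a + K.card : ℕ) (L.card + K.card) β t n
    exact ⟨n, hn, by exact_mod_cast this⟩
  · rintro ⟨n, hn, rfl⟩
    refine ⟨_, (mem_indexA_iff hKL t _).2 ⟨n, hn, rfl⟩, ?_⟩
    have := lam_typeIndex (a + K.card : ℕ) (L.card + K.card) β t n
    exact_mod_cast this.symm

theorem diagramA_eq {K L : Finset ℕ} (hKL : Disjoint K L) {a : ℕ} {β : ℝ} :
    diagramA K L a (a + K.card : ℕ) β = {x | ∃ n : ℤ,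
      x.1 = lam (a + K.card : ℕ) β .one (n - (L.card + K.card : ℤ)) ∧
        x.2 = (labA K L a n).toLabel} := by
  ext ⟨μ, l⟩
  simp only [diagramA, mem_sigmaA_iff hKL, Lab.types_toLabel_iff, Set.mem_ofPred_eq]
  constructor
  · rintro (⟨⟨n, h1, h2⟩, rfl⟩ | ⟨⟨n, h1, h2⟩, rfl⟩ | ⟨⟨n, h1, h2⟩, rfl⟩)
    · exact ⟨n, h2, by rw [h1]; rfl⟩
    · exact ⟨n, h2, by rw [h1]; rfl⟩
    · exact ⟨n, h2, by rw [h1]; rfl⟩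
  · rintro ⟨n, h1, rfl⟩
    cases h : labA K L a n
    · exact Or.inl ⟨⟨n, h, h1⟩, rfl⟩
    · exact Or.inr (Or.inl ⟨⟨n, h, h1⟩, rfl⟩)
    · exact Or.inr (Or.inr ⟨⟨n, h, h1⟩, rfl⟩)

/-! ### Norms -/

theorem ValAt.exists_eq_one_sub_mul {f : RatFunc ℝ} (h : ValAt 1 f 0) :
    ∃ g, RegularAt g 1 ∧ f = (1 - RatFunc.X) * g := by
  obtain ⟨A, B, rfl, hB, h0⟩ := h
  have hA : A.eval 1 = 0 := by
    rcases div_eq_zero_iff.1 h0.symm with h | h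
    · exact h
    · exact absurd h hB
  obtain ⟨E, rfl⟩ := dvd_iff_isRoot.2 hA
  refine ⟨-(ι E) / ι B, ((ValAt.poly 1 E).neg.div (ValAt.poly 1 B) hB).regularAt, ?_⟩
  rw [map_mul, map_sub, RatFunc.algebraMap_X, RatFunc.algebraMap_C, map_one]
  ring

theorem valAt_one_sub_X (x : ℝ) : ValAt x (1 - RatFunc.X) (1 - x) :=
  (ValAt.one x).sub (ValAt.var x)

/-- The divisibility of the incomplete scalar products by `(1 - x) ^ (α + 1)`. -/
theorem exists_eq_one_sub_pow_mul {e F : RatFunc ℝ} {k : ℝ} {α : ℕ} (he : ValAt 1 e 0)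
    (hF : RegularAt F 1)
    (h : xp * ∂ e + RatFunc.C k * e = (1 - RatFunc.X) ^ α * F) :
    ∃ g, RegularAt g 1 ∧ e = (1 - RatFunc.X) ^ (α + 1) * g := by
  have key : ∀ j : ℕ, j ≤ α → ∃ g, RegularAt g 1 ∧ e = (1 - RatFunc.X) ^ (j + 1) * g := by
    intro j hj
    induction j with
    | zero => simpa using he.exists_eq_one_sub_mul
    | succ j ih =>
      obtain ⟨g, hg, rfl⟩ := ih (by omega)
      -- Dividing the equation by `(1 - x)^j` leaves `-(j + 1)(1 + x) g` equal to a multiple of `1 -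
      -- x`; hence `g` vanishes at `1` and another factor splits off.
      have h1 : -((j + 1 : ℕ) : RatFunc ℝ) * (xp * g) = (1 - RatFunc.X) *
          ((1 - RatFunc.X) ^ (α - (j + 1)) * F - xp * ∂ g - RatFunc.C k * g) := by
        obtain ⟨m, rfl⟩ : ∃ m, α = j + 1 + m := ⟨α - (j + 1), by omega⟩
        rw [ratDeriv_mul, ratDeriv_one_sub_X_pow] at h
        rw [Nat.add_sub_cancel_left]
        refine mul_left_cancel₀ (pow_ne_zero j one_sub_X_ne_zero) ?_
        linear_combination h
      have h2 : ValAt 1 (-((j + 1 : ℕ) : RatFunc ℝ) * (xp * g)) 0 := by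
        rw [h1]
        have h3 := (valAt_one_sub_X 1).mul ((((((valAt_one_sub_X 1).pow (α - (j + 1))).mul
          hF.valAt).regularAt.sub (valAt_xp.mul hg.ratDeriv.valAt).regularAt).sub
          ((regularAt_C 1 k).mul hg)).valAt)
        simpa using h3
      have h4 : ValAt 1 (-((j + 1 : ℕ) : RatFunc ℝ) * (xp * g)) (-((j + 1 : ℕ) : ℝ) * (2 * evR 1 g)) := by
        have h5 := (ValAt.const 1 (-((j + 1 : ℕ) : ℝ))).mul (valAt_xp.mul hg.valAt)
        simpa using h5
      have h6 : evR 1 g = 0 := by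
        have h7 := h2.unique h4
        have h8 : ((j + 1 : ℕ) : ℝ) ≠ 0 := by positivity
        have : ((j + 1 : ℕ) : ℝ) * evR 1 g = 0 := by linarith
        exact (mul_eq_zero.1 this).resolve_left h8
      obtain ⟨g', hg', rfl⟩ := (h6 ▸ hg.valAt : ValAt 1 g 0).exists_eq_one_sub_mul
      exact ⟨g', hg', by ring⟩
  exact key α le_rfl

theorem hasQRAntideriv_of_ode {F g : RatFunc ℝ} {α β : ℝ} (h1 : RegularAt g 1)
    (h2 : RegularAt g (-1))
    (h : F = (1 - RatFunc.X) * xp * ∂ g - RatFunc.C (α + 1) * xp * g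
      + RatFunc.C (β + 1) * (1 - RatFunc.X) * g) : HasQRAntideriv F α β := by
  refine ⟨g, h1, h2, ?_⟩
  have hfin : ∀ᶠ x in Filter.cofinite, x ∈ Set.Ioo (-1 : ℝ) 1 → HasDerivAt
      (fun t : ℝ => evR t g * (1 - t) ^ (α + 1) * (1 + t) ^ (β + 1))
        (evR x F * (1 - x) ^ α * (1 + x) ^ β) x := by
    filter_upwards [cofinite_regularAt g] with x hx hI
    have hm : 0 < 1 - x := by linarith [hI.2]
    have hp : 0 < 1 + x := by linarith [hI.1]
    have d1 : HasDerivAt (fun t : ℝ => 1 - t) (-1) x := (hasDerivAt_id x).const_sub 1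
    have d2 : HasDerivAt (fun t : ℝ => 1 + t) 1 x := (hasDerivAt_id x).const_add 1
    have d3 := ((hasDerivAt_evR hx).mul (d1.rpow_const (p := α + 1) (Or.inl hm.ne'))).mul
      (d2.rpow_const (p := β + 1) (Or.inl hp.ne'))
    refine d3.congr_deriv ?_
    have hv : ValAt x xp (1 + x) := by simpa [add_comm] using (ValAt.var x).add (ValAt.one x)
    have e := (((((valAt_one_sub_X x).mul hv).mul hx.ratDeriv.valAt).sub
      (((ValAt.const x (α + 1)).mul hv).mul hx.valAt)).add
      (((ValAt.const x (β + 1)).mul (valAt_one_sub_X x)).mul hx.valAt)).eval_eq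
    rw [← h] at e
    simp only [Pi.mul_apply]
    rw [e, add_sub_cancel_right, add_sub_cancel_right, Real.rpow_add_one hm.ne',
      Real.rpow_add_one hp.ne']
    ring
  rw [Filter.eventually_cofinite] at hfin
  simpa only [Classical.not_imp] using hfin

section ExcState

variable {τ : ℝ[X]} {α : ℕ} {β : ℝ} {s : ℤ} {J : Set ℕ} {lab : ℤ → Lab}
    {π : ℕ → RatFunc ℝ} {c N : ℕ → ℝ} {r : ℕ → ℕ → RatFunc ℝ}

/-- The constant is chosen so that the inner product minus a multiple of the anti-derivative of the
weight vanishes at `1`. The equation then improves this to divisibility by `(1 - x)^(α + 1)`. -/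
theorem ExcState.hasQRAntideriv (h : ExcState τ α β s J lab π c N r) {n m : ℕ} (hn : n ∈ J)
    (hm : m ∈ J) : HasQRAntideriv
      (π n * π m - RatFunc.C (if n = m then N n / jacobiNorm α β 0 else 0)) α β := by
  set k : ℝ := if n = m then N n / jacobiNorm α β 0 else 0 with hk
  set e := r n m - RatFunc.C k * ι (jacobiRho α β 0 0) with he
  have hJ := jacobiNorm_ne_zero h.hβ α 0
  have he0 : ValAt 1 e 0 := by
    have h1 := (h.rval n hn m hm).sub ((ValAt.const 1 k).mul (ValAt.poly 1 (jacobiRho α β 0 0)))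
    convert h1 using 1
    have h2 : (jacobiRho α β 0 0).eval 1 = jacobiNorm α β 0 := rfl
    rw [h2, hk]
    split_ifs
    · rw [div_mul_cancel₀ _ hJ, sub_self]
    · ring
  have hode : xp * ∂ e + RatFunc.C (β + 1) * e =
      (1 - RatFunc.X) ^ α * (π n * π m - RatFunc.C k) := by
    have h1 := jacobiRho_ode h.hβ α 0 0
    rw [jacobiMonic_zero (add_ne_int h.hβ), map_one] at h1
    rw [he, ratDeriv_sub, ratDeriv_C_mul]
    linear_combination h.ode n hn m hm - RatFunc.C k * h1
  obtain ⟨y, -, hy⟩ := h.exists_valAt hn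
  obtain ⟨z, -, hz⟩ := h.exists_valAt hm
  obtain ⟨y', -, hy'⟩ := h.exists_valAt_neg hn
  obtain ⟨z', -, hz'⟩ := h.exists_valAt_neg hm
  have hF1 := ((hy.mul hz).sub (ValAt.const 1 k)).regularAt
  have hF2 := ((hy'.mul hz').sub (ValAt.const (-1) k)).regularAt
  obtain ⟨g, hg, hge⟩ := exists_eq_one_sub_pow_mul he0 hF1 hode
  have hvp := (valAt_one_sub_X (-1)).pow
  have hne : ∀ j : ℕ, (1 - (-1) : ℝ) ^ j ≠ 0 := fun j => pow_ne_zero j (by norm_num)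
  have hp : ∀ j : ℕ, ((1 - RatFunc.X : RatFunc ℝ)) ^ j ≠ 0 := fun j =>
    pow_ne_zero j one_sub_X_ne_zero
  have he' : RegularAt e (-1) := regularAt_of_xp_ode (add_one_ne_int h.hβ)
    (((hvp α).mul hF2.valAt).regularAt) hode
  have hg' : RegularAt g (-1) := by
    have : g = e / (1 - RatFunc.X) ^ (α + 1) := by
      rw [hge, mul_div_cancel_left₀ _ (hp _)]
    rw [this]
    exact (he'.valAt.div (hvp (α + 1)) (hne _)).regularAt
  refine hasQRAntideriv_of_ode hg hg' (mul_left_cancel₀ (hp α) ?_)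
  rw [← hode, hge, ratDeriv_mul, ratDeriv_one_sub_X_pow]
  simp only [map_add, map_one, map_natCast]
  push_cast
  ring

end ExcState

/-- The factor `4^q 2^p` lost in the steps is the ratio of the normalizations `2^(β + 1)` and `2^(b
+ 1)` for `β = b + 2q + p`. -/
theorem jacobiNorm_ratio {b : ℝ} (hb : ∀ m : ℤ, b ≠ m) (a p q n : ℕ) (k : ℝ) :
    k * jacobiNorm a b n / 4 ^ q / 2 ^ p / jacobiNorm (a + p) (b + 2 * q + p) 0 =
      k * nuC n a b / nuC 0 (a + p : ℕ) (b + 2 * q + p) := by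
  have hb' : ∀ m : ℤ, b + 2 * q + p ≠ m := fun m hm =>
    hb (m - 2 * q - p) (by push_cast; linarith)
  have h0 := jacobiNorm_ne_zero hb' (a + p) 0
  have h1 := jacobiNorm_eq hb' (a + p) 0
  rw [Nat.cast_zero] at h1
  rw [← h1, ← jacobiNorm_eq hb a n]
  have h2 : (2 : ℝ) ^ (b + 2 * q + p + 1) = 2 ^ (b + 1) * 4 ^ q * 2 ^ p := by
    rw [show b + 2 * q + p + 1 = b + 1 + (2 * q : ℕ) + p by push_cast; ring,
      Real.rpow_add_natCast two_ne_zero, Real.rpow_add_natCast two_ne_zero, pow_mul]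
    norm_num
  have h3 : (2 : ℝ) ^ (b + 1) ≠ 0 := (Real.rpow_pos_of_pos two_pos _).ne'
  rw [h2]
  field_simp

end ExJacobi

end

open ExJacobi in
theorem mainTheorem10 (a : ℕ) (b : ℝ) (hb : ∀ m : ℤ, b ≠ m) (K L : Finset ℕ)
    (hKL : Disjoint K L) (p q : ℕ) (hp : p = K.card) (hq : q = L.card)
    (α β : ℝ) (hα : α = a + p) (hβ : β = b + p + 2 * q) :
    ∃ (τ : Polynomial ℝ) (π : ℤ → RatFunc ℝ),
      AgreesWith (tauA K L a b) (algebraMap (Polynomial ℝ) (RatFunc ℝ) τ) ∧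
      (τ.natDegree : ℤ) = 2 * (∑ l ∈ L, (l : ℤ)) + (∑ k ∈ K, (k : ℤ))
        - (p + q).choose 2 - q.choose 2 + q * a ∧
      IsExceptionalRationalGauge τ α β ∧
      IsClassA α β ∧
      qrSpectrum (Trg τ α β) = sigmaQ α β ∧
      spectralDiagram (Trg τ α β) = diagramA K L a α β ∧
      (∀ x ∈ sigmaQ α β, ∃! s : Label, (x, s) ∈ diagramA K L a α β) ∧
      (∀ t : AsympType, indexSet (Trg τ α β) α β t = (fun i : ℤ => (i : ℝ)) '' indexA K L a t) ∧
      (∀ i ∈ indexA K L a .one,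
        AgreesWith (piA K L a b i) (π i) ∧ IsMonicRat (π i) ∧ (π i).intDegree = i ∧
        IsQuasiPolynomialEigenfunction (Trg τ α β) (π i) (lam α β .one i)) ∧
      (∀ (f : RatFunc ℝ) (μ : ℝ), IsQuasiPolynomialEigenfunction (Trg τ α β) f μ →
        ∃ i ∈ indexA K L a .one, ∃ c : ℝ, c ≠ 0 ∧ μ = lam α β .one i ∧
          f = RatFunc.C c * π i) ∧
      AreNorms (indexA K L a .one) π
        (fun i => kappaA K L a b ((i : ℝ) + p + q) * nuC ((i : ℝ) + p + q) a b) α β := by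
  subst hp hq
  obtain rfl : α = ((a + K.card : ℕ) : ℝ) := by rw [hα]; push_cast; ring
  obtain rfl : β = b + 2 * L.card + K.card := by rw [hβ]; ring
  clear hα hβ
  obtain ⟨τ₁, τ, π₁, π₂, r, h, hdeg, hR, hτ₁, hA, hτ, hπ⟩ := exists_state hb a hKL
  have hseed : ∀ j, AgreesWith (seeds K L a b j)
      (RatFunc.C (chiHat L a b (enum K j)) * π₁ (enum K j)) := fun j =>
    agreesWith_piHat hR (hA _ (Finset.disjoint_left.1 hKL (enum_mem K j))) (by ring)
  have hW : ratWr (fun i => RatFunc.C (chiHat L a b (enum K i)) * π₁ (enum K i)) ≠ 0 := by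
    intro h0
    rw [h0, mul_zero] at hτ
    exact h.iota_tau_ne_zero hτ
  have hindex : ∀ {i : ℤ}, i ∈ indexA K L a .one → ∃ n : ℕ, (n ∉ K ∧ n ∉ L) ∧
      i = n - (L.card + K.card) ∧ (i + K.card + L.card).toNat = n := by
    rintro i ⟨n, h1, h2, rfl⟩
    exact ⟨n, ⟨h1, h2⟩, by ring, by omega⟩
  -- For `i ∈ I₁` the number `i + p + q` is natural and the truncation is harmless; other values of
  -- `i` are never used.
  refine ⟨τ, fun i => RatFunc.C (chi K (i + K.card + L.card).toNat) *
    π₂ (i + K.card + L.card).toNat, ?_, hdeg, ?_, ?_, ?_, ?_, ?_, ?_, ?_, ?_, ?_⟩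
  · rw [hτ]
    exact (agreesWith_tauHat hτ₁).mul (agreesWith_wronskianDet hseed)
  · refine h.isExceptionalRationalGauge ((K ∪ L).finite_toSet.subset fun n hn => ?_)
    by_contra hcon
    rw [Finset.mem_coe, Finset.mem_union, not_or] at hcon
    exact hn hcon
  · exact Or.inl ⟨⟨_, rfl⟩, h.hβ⟩
  · rw [Trg_eq_opU h.tau_ne_zero, h.qrSpectrum_eq, h.sigmaQ_eq]
  · rw [Trg_eq_opU h.tau_ne_zero, h.spectralDiagram_eq, diagramA_eq hKL]
  · intro x hx
    rw [h.sigmaQ_eq] at hx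
    obtain ⟨n, rfl⟩ := hx
    have h1 := h.existsUnique_label n
    rw [h.spectralDiagram_eq] at h1
    rw [diagramA_eq hKL]
    push_cast at h1 ⊢
    exact h1
  · intro t
    rw [Trg_eq_opU h.tau_ne_zero, h.indexSet_eq]
    ext k
    constructor
    · rintro ⟨n, hn, rfl⟩
      exact ⟨_, (mem_indexA_iff hKL t _).2 ⟨n, hn, rfl⟩, rfl⟩
    · rintro ⟨i, hi, rfl⟩
      obtain ⟨n, hn, rfl⟩ := (mem_indexA_iff hKL t i).1 hi
      exact ⟨n, hn, rfl⟩
  · intro i hi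
    obtain ⟨n, hn, hin, hnat⟩ := hindex hi
    simp only [hnat]
    have h1 := h.lead n hn
    have h2 := h.isQuasiPolynomialEigenfunction hn
    refine ⟨agreesWith_piA hseed (by omega) (agreesWith_piHat hR (hA n hn.2) (by omega)) hW (hπ n),
      h1.isMonicRat, ?_, ?_⟩
    · rw [h1.intDegree_eq, hin]
    · rw [Trg_eq_opU h.tau_ne_zero, hin]
      push_cast at h2 ⊢
      exact h2
  · intro f μ hf
    rw [Trg_eq_opU h.tau_ne_zero] at hf
    obtain ⟨n, hn, k, hk, hμ, hfk⟩ := h.eigenfunction_cases (fun n hn => labA_eq_circ_iff.1 hn) hf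
    refine ⟨n - K.card - L.card, ⟨n, hn.1, hn.2, rfl⟩, k, hk, ?_, ?_⟩
    · rw [hμ]
      congr 1
      push_cast
      ring
    · dsimp only
      rw [hfk, show ((n : ℤ) - K.card - L.card + K.card + L.card).toNat = n by omega]
  · intro i hi j hj
    obtain ⟨n, hn, hin, hnat⟩ := hindex hi
    obtain ⟨m, hm, hjm, hmat⟩ := hindex hj
    simp only [hnat, hmat]
    have h1 := h.hasQRAntideriv hn hm
    rw [jacobiNorm_ratio hb] at h1
    have h2 : (i : ℝ) + K.card + L.card = n := by rw [hin]; push_cast; ring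
    rw [h2]
    convert h1 using 6
    omega
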